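/- **Setting.** Let $a,b$ be real-valued functions on $\mathbb R$, $\alpha=a+ib$, $\partial\mathcal E=\{a(x)\pm ib(x):x\in\mathbb R\}$, let $\mathcal E$ be the open region bounded by $\partial\mathcal E$, and suppose: (A1) $a,b$ are real analytic on $\mathbb R$ and extend analytically to a domain $\mathcal D\supset\mathbb R$ of $\mathbb C$; $b>0$ on $\mathbb R$. On $\mathcal D$ put $\alpha=a+ib$, $\tilde\alpha=a-ib$. (A2) $\alpha'(x)\neq0$ for all but finitely many $x\in\mathbb R$, and $\partial\mathcal E$ has no self-intersections. (A3) There is a domain $\mathcal L$ in the open upper half-plane $\mathbb C^+$ that contains a strip $\{0<\Im z<\ell\}$, $\ell>0$, and the part of $\mathcal E\cup\partial\mathcal E$ in $\mathbb C^+$, and $\alpha(\mathcal D)\supset\mathcal L$. (A4) There are $\mu_\pm\in\mathbb R$ and $p>1$ with $x^p(a(x)-\mu_\pm)\to0$ and $x^pb(x)\to0$ as $\Re x\to\pm\infty$ within $\{x\in\mathcal D:\alpha(x)\in\mathcal L\}$. Then there is an analytic inverse $x(z)$ of $\alpha$ on an open set $\mathcal C\subset\mathcal L$ that contains all points $\alpha(x)$,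 $x\in\mathbb R$, $\alpha'(x)\ne0$: $x(\mathcal C)\subset\mathcal D$, $\alpha(x(z))=z$ on $\mathcal C$ and $x(\alpha(x))=x$ for all $x\in\mathbb R$. Fix any such $\mathcal C$ and $x(z)$, a real number $f_0(\mu_+)$, and $x\in\mathbb R$ with $\alpha'(x)\neq0$. Let $\Lambda=\{t+i\eta(t):t\ge x\}$ be a contour of integration, where $\eta\in C^1(\mathbb R)$ is real, $\eta(x)=0$, $\eta(t)=0$ for all large $t$, and every point $t+i\sigma\eta(t)$ with $t\ge x$, $0\le\sigma\le1$ lies in $\mathbb R\cup x(\mathcal C)$ and satisfies $\Im\tilde\alpha<0$. (The real ray $[x,+\infty)$, $\eta=0$, always qualifies.) Let $\gamma_m=\alpha(\Lambda)\cup\{\mu_+\}\cup\overline{\alpha(\Lambda)}$, oriented from $\overline{\alpha(x)}$ to $\alpha(x)$. Let $R(y,z)=\sqrt{(z-\alpha(y))(z-\tilde\alpha(y))}$ be the branch that is continuous in $y$ along the contour of integration and tends to $-(z-\mu_+)$ as $y\to+\infty$. Define $$g(x,z)=-\tfrac12\Big[\int_{+\infty}^x\big(z-\mu_++R(y,z)\big)\,dy+\mu_+x\Big]+\tfrac12f_0(\mu_+),\qquad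 \Im z\ge0,\ z\notin\gamma_m,$$ with the integral along $\Lambda$, and $$f_0(z)=\int_{x(z)}^{+\infty}\big[z-\mu_++R(y,z)\big]\,dy+(z-\mu_+)x(z)+f_0(\mu_+),$$ with the integral along the vertical segment from $x(z)$ to $\mathbb R$ followed by the real axis (for $z=\alpha(s)$, $s\in\mathbb R$, along $[s,+\infty)$). Extend both to the lower half-plane by Schwarz reflection, $g(x,\bar z)=\overline{g(x,z)}$, $f_0(\bar z)=\overline{f_0(z)}$. **Theorem.** $\gamma_m$ is a Schwarz-symmetric simple arc with endpoints $\overline{\alpha(x)},\alpha(x)$ that meets $\mathbb R$ only at $\mu_+$. The branches and integrals above are well defined for $\Im z\ge 0$, $z\notin\gamma_m$ (for $g$) and for $z\in\alpha(\Lambda)$ (for $f_0$), and the integrals converge absolutely. $R(x,\cdot)$ (continued by reflection to the lower half-plane) is analytic off $\gamma_m$, with $R(x,z)^2=(z-\alpha(x))(z-\overline{\alpha(x)})$ and $R(x,z)/z\to-1$ as $z\to\infty$. $f_0$ is analytic at every point of $\alpha(\Lambda)\cap\mathcal C$, and continuous and Schwarz-symmetric on $\gamma_m$. Moreover $g,f_0$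 solve the scalar Riemann–Hilbert problem: (i) $g(x,\cdot)$ is analytic in $\overline{\mathbb C}\setminus\gamma_m$, including at $\infty$; (ii) $g_++g_-=f_0-xz$ on $\gamma_m$, where $g_+$ and $g_-$ are continuous functions along the arc, up to its endpoints, that are the nontangential limits of $g$ from the left and from the right at every interior point other than $\mu_+$ where the parametrization $t\mapsto\alpha(t+i\eta(t))$ (or its conjugate) has non-zero derivative, and at $\mu_+$ the limits along $\mathbb R$ from the left and from the right; (iii) near each endpoint $e\in\{\alpha(x),\overline{\alpha(x)}\}$, $g(x,z)=O(|z-e|^{3/2})+$ a function analytic at $e$. -/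

import Mathlib

open Set Filter Topology MeasureTheory Asymptotics
open scoped ComplexConjugate

noncomputable section

/-- `α = a + i b`. -/
def alpha (a b : ℂ → ℂ) (y : ℂ) : ℂ := a y + Complex.I * b y

/-- `α̃ = a - i b`, which is the complex conjugate of `α` on the real axis. -/
def alphaTilde (a b : ℂ → ℂ) (y : ℂ) : ℂ := a y - Complex.I * b y

/-- The curve `∂E = {a(x) ± i b(x) : x ∈ ℝ}`. -/
def boundaryE (a b : ℂ → ℂ) : Set ℂ :=
  range (fun x : ℝ => alpha a b x) ∪ range (fun x : ℝ => conj (alpha a b x))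

/-- The open region `E` bounded by the curve `∂E` (together with its limit points): the union of
the bounded connected components of the complement. -/
def regionE (a b : ℂ → ℂ) : Set ℂ :=
  {z | z ∈ (closure (boundaryE a b))ᶜ ∧
    Bornology.IsBounded (connectedComponentIn (closure (boundaryE a b))ᶜ z)}

/-- The conditions on `α = a + i b`. The functions `a`, `b` are given together with their analytic
continuation from the real axis to the domain `D`. -/
structure ConditionsA (a b : ℂ → ℂ) (D L : Set ℂ) (μm μp p : ℝ) : Prop where
  /- `a`, `b` are real analytic on `ℝ` and analytic on the domain `D`, and `b > 0` on `ℝ` -/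
  isOpen_D : IsOpen D
  isConnected_D : IsConnected D
  real_mem_D : ∀ x : ℝ, (x : ℂ) ∈ D
  analytic_a : DifferentiableOn ℂ a D
  analytic_b : DifferentiableOn ℂ b D
  real_a : ∀ x : ℝ, (a x).im = 0
  real_b : ∀ x : ℝ, (b x).im = 0
  pos_b : ∀ x : ℝ, 0 < (b x).re
  /- all but finitely many points of the curve are regular, and it has no self-intersections -/
  finite_critical : {x : ℝ | deriv (alpha a b) x = 0}.Finite
  injective : Function.Injective (fun x : ℝ => alpha a b x)
  /- `L` is a domain in the upper half-plane that contains a strip along the real axis and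
  the upper half of `E ∪ ∂E`, and is covered by `α(D)` -/
  isOpen_L : IsOpen L
  isConnected_L : IsConnected L
  L_upper : ∀ z ∈ L, 0 < z.im
  strip_L : ∃ ℓ : ℝ, 0 < ℓ ∧ ∀ z : ℂ, 0 < z.im → z.im < ℓ → z ∈ L
  region_L : ∀ z ∈ regionE a b ∪ boundaryE a b, 0 < z.im → z ∈ L
  L_subset : L ⊆ alpha a b '' D
  /- decay to `μ_±` faster than `x⁻ᵖ`, `p > 1`, as `Re x → ±∞` with `α(x) ∈ L` -/
  one_lt_p : 1 < p
  decay_a_right : Tendsto (fun y : ℂ => y ^ (p : ℂ) * (a y - μp))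
    (comap Complex.re atTop ⊓ 𝓟 {y | y ∈ D ∧ alpha a b y ∈ L}) (𝓝 0)
  decay_b_right : Tendsto (fun y : ℂ => y ^ (p : ℂ) * b y)
    (comap Complex.re atTop ⊓ 𝓟 {y | y ∈ D ∧ alpha a b y ∈ L}) (𝓝 0)
  decay_a_left : Tendsto (fun y : ℂ => y ^ (p : ℂ) * (a y - μm))
    (comap Complex.re atBot ⊓ 𝓟 {y | y ∈ D ∧ alpha a b y ∈ L}) (𝓝 0)
  decay_b_left : Tendsto (fun y : ℂ => y ^ (p : ℂ) * b y)
    (comap Complex.re atBot ⊓ 𝓟 {y | y ∈ D ∧ alpha a b y ∈ L}) (𝓝 0)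

/-- `X` is the inverse function `x(z)` of `α`, with `x(α(x)) = x` for all real `x`, continued
analytically to the open set `C ⊆ L` (`L` with cuts), which contains all regular points of the
curve. -/
structure IsConformalInverse (a b : ℂ → ℂ) (D L C : Set ℂ) (X : ℂ → ℂ) : Prop where
  isOpen : IsOpen C
  subset : C ⊆ L
  regular_mem : ∀ x : ℝ, deriv (alpha a b) x ≠ 0 → alpha a b x ∈ C
  analytic : DifferentiableOn ℂ X C
  mapsTo : MapsTo X C D
  right_inv : ∀ z ∈ C, alpha a b (X z) = z
  left_inv : ∀ x : ℝ, X (alpha a b x) = x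

/-- `r` is a continuous branch of the radical `R(y, z) = √((z - α(y)) (z - α̃(y)))` along the
contour `y = l(t)`, `t ≥ t₀`, with `R → -(z - μ)` at the end `y = +∞` of the contour. -/
def IsRadicalBranch (a b : ℂ → ℂ) (μ : ℝ) (l : ℝ → ℂ) (t₀ : ℝ) (z : ℂ) (r : ℝ → ℂ) : Prop :=
  ContinuousOn r (Ici t₀) ∧
  (∀ t ∈ Ici t₀, r t ^ 2 = (z - alpha a b (l t)) * (z - alphaTilde a b (l t))) ∧
  Tendsto r atTop (𝓝 (-(z - μ)))

open Classical in
/-- The radical `t ↦ R(l(t), z)` along the contour `l`. -/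
def radical (a b : ℂ → ℂ) (μ : ℝ) (l : ℝ → ℂ) (t₀ : ℝ) (z : ℂ) : ℝ → ℂ :=
  if h : ∃ r, IsRadicalBranch a b μ l t₀ z r then h.choose else 0

/-- The integrand of `∫ [z - μ + R(y, z)] dy` along the contour `y = l(t)`. -/
def integrand (a b : ℂ → ℂ) (μ : ℝ) (l : ℝ → ℂ) (t₀ : ℝ) (z : ℂ) (t : ℝ) : ℂ :=
  (z - μ + radical a b μ l t₀ z t) * deriv l t

/-- The contour `t + i η(t)` in the complex `x`-plane. -/
def graphContour (η : ℝ → ℝ) (t : ℝ) : ℂ := t + Complex.I * η t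

/-- The contour from `w` to `+∞` that runs (with unit speed, `t ≥ 0`) along the vertical segment
from `w` to the real axis and then along the real axis. For real `w` it is the ray `[w, +∞)`. -/
def contourFrom (w : ℂ) (t : ℝ) : ℂ :=
  ((w.re + max 0 (t - |w.im|) : ℝ) : ℂ) +
    Complex.I * ((Real.sign w.im * max 0 (|w.im| - t) : ℝ) : ℂ)

/-- The contour `y = t + i η(t)`, `t ≥ x`, joins `x` and `+∞`, coincides with the real axis near
`+∞`, and the region swept between it and the real axis consists of points of the real axis and
of the image `X(C)` of the inverse function, at which `α̃` stays in the lower half-plane. -/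
structure IsAdmissibleContour (a b : ℂ → ℂ) (C : Set ℂ) (X : ℂ → ℂ) (x : ℝ) (η : ℝ → ℝ) :
    Prop where
  smooth : ContDiff ℝ 1 η
  start : η x = 0
  tail : ∃ T : ℝ, ∀ t ≥ T, η t = 0
  region : ∀ t ≥ x, ∀ σ ∈ Icc (0 : ℝ) 1,
    graphContour (fun s => σ * η s) t ∈ range ((↑) : ℝ → ℂ) ∪ X '' C ∧
    (alphaTilde a b (graphContour (fun s => σ * η s) t)).im < 0

/-- The radical `R(x, z)` as a function of `z`, for real `x`; it is continued along the contour
`t + i η(t)` for `z` in the closed upper half-plane and by Schwarz reflection elsewhere. -/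
def R (a b : ℂ → ℂ) (μ : ℝ) (η : ℝ → ℝ) (x : ℝ) (z : ℂ) : ℂ :=
  if 0 ≤ z.im then radical a b μ (graphContour η) x z x
  else conj (radical a b μ (graphContour η) x (conj z) x)

/-- `-½ [∫_{+∞}^x (z - μ + R(y, z)) dy + μ x] + ½ k`, with the integral taken along the contour
`t + i η(t)`. -/
def gUpper (a b : ℂ → ℂ) (μ k : ℝ) (η : ℝ → ℝ) (x : ℝ) (z : ℂ) : ℂ :=
  -(1 / 2) * (-(∫ t in Ioi x, integrand a b μ (graphContour η) x z t) + μ * x) + (1 / 2) * k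

/-- The function `g(x, z)`; it is extended to the lower half-plane by Schwarz reflection.
`k` is the free real parameter `f₀(μ₊)`. -/
def g (a b : ℂ → ℂ) (μ k : ℝ) (η : ℝ → ℝ) (x : ℝ) (z : ℂ) : ℂ :=
  if 0 ≤ z.im then gUpper a b μ k η x z else conj (gUpper a b μ k η x (conj z))

/-- `∫_{x(z)}^{+∞} [z - μ + R(y, z)] dy + (z - μ) x(z) + k`. -/
def fUpper (a b : ℂ → ℂ) (X : ℂ → ℂ) (μ k : ℝ) (z : ℂ) : ℂ :=
  (∫ t in Ioi (0 : ℝ), integrand a b μ (contourFrom (X z)) 0 z t) + (z - μ) * X z + k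

open Classical in
/-- The function `f₀(z)`, with `f₀(μ) = k`; it is extended to the lower half-plane by Schwarz
reflection. -/
def f₀ (a b : ℂ → ℂ) (X : ℂ → ℂ) (μ k : ℝ) (z : ℂ) : ℂ :=
  if z = μ then k
  else if 0 ≤ z.im then fUpper a b X μ k z else conj (fUpper a b X μ k (conj z))

/-- The Schwarz-symmetric set whose upper half is the curve `c(s)`, `x ≤ s < ∞`, and which
meets the real axis in `μ`. -/
def mainArc (μ x : ℝ) (c : ℝ → ℂ) : Set ℂ :=
  {(μ : ℂ)} ∪ c '' Ici x ∪ (fun s => conj (c s)) '' Ici x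

/-- `c(s)`, `x ≤ s < ∞`, is a simple arc in the upper half-plane that joins `e = c(x)` to `μ`, so
that `mainArc μ x c` is a Schwarz-symmetric simple arc with endpoints `conj e` and `e`, which
meets the real axis only in `μ`. -/
structure IsMainArc (e : ℂ) (μ x : ℝ) (c : ℝ → ℂ) : Prop where
  start : c x = e
  continuousOn : ContinuousOn c (Ici x)
  injOn : InjOn c (Ici x)
  upper : ∀ s ≥ x, 0 < (c s).im
  tendsto : Tendsto c atTop (𝓝 (μ : ℂ))

/-- `v` is the nontangential limit of `F` at `z₀` from the left side of a curve that passes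
through `z₀` with tangent vector `τ`. -/
def HasLeftLimit (F : ℂ → ℂ) (z₀ τ v : ℂ) : Prop :=
  ∀ κ > (0 : ℝ), Tendsto F (𝓝[{z | κ * ‖z - z₀‖ < ((z - z₀) / τ).im}] z₀) (𝓝 v)

/-- `v` is the nontangential limit of `F` at `z₀` from the right side of a curve that passes
through `z₀` with tangent vector `τ`. -/
def HasRightLimit (F : ℂ → ℂ) (z₀ τ v : ℂ) : Prop := HasLeftLimit F z₀ (-τ) v

/-- `G` solves the scalar Riemann-Hilbert problem with data `F` on the main arc, which is oriented
from the lower endpoint to the upper endpoint. The boundary values are continuous on the arc; they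
are the one-sided limits of `G` at every point where the parametrization is regular, and at `μ`,
where the left and right sides are reached along the real axis. -/
structure SolvesRHP (μ x : ℝ) (c : ℝ → ℂ) (F G : ℂ → ℂ) : Prop where
  /- analyticity off the arc, including infinity -/
  analytic : DifferentiableOn ℂ G (mainArc μ x c)ᶜ
  analytic_infty : ∃ H : ℂ → ℂ, AnalyticAt ℂ H 0 ∧ ∀ᶠ z in cocompact ℂ, G z = H z⁻¹
  /- the data are Schwarz-symmetric and continuous -/
  data_symm : ∀ z ∈ mainArc μ x c, F (conj z) = conj (F z)
  data_cont : ContinuousOn F (mainArc μ x c)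
  /- `G₊ + G₋ = F - x z` -/
  jump : ∃ (up um lp lm : ℝ → ℂ) (mp mm : ℂ),
    (ContinuousOn up (Ici x) ∧ ContinuousOn um (Ici x) ∧
      ContinuousOn lp (Ici x) ∧ ContinuousOn lm (Ici x)) ∧
    (Tendsto up atTop (𝓝 mp) ∧ Tendsto um atTop (𝓝 mm) ∧
      Tendsto lp atTop (𝓝 mp) ∧ Tendsto lm atTop (𝓝 mm)) ∧
    (∀ s > x, deriv c s ≠ 0 →
      HasLeftLimit G (c s) (-deriv c s) (up s) ∧ HasRightLimit G (c s) (-deriv c s) (um s)) ∧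
    (∀ s > x, deriv c s ≠ 0 →
      HasLeftLimit G (conj (c s)) (conj (deriv c s)) (lp s) ∧
      HasRightLimit G (conj (c s)) (conj (deriv c s)) (lm s)) ∧
    Tendsto (fun u : ℝ => G u) (𝓝[<] μ) (𝓝 mp) ∧
    Tendsto (fun u : ℝ => G u) (𝓝[>] μ) (𝓝 mm) ∧
    (∀ s ≥ x, up s + um s = F (c s) - x * c s) ∧
    (∀ s ≥ x, lp s + lm s = F (conj (c s)) - x * conj (c s)) ∧
    mp + mm = F μ - x * μ
  /- `G = O((z - α)^{3/2}) + analytic` at both endpoints -/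
  endpoint_upper : ∃ A : ℂ → ℂ, AnalyticAt ℂ A (c x) ∧
    (fun z => G z - A z) =O[𝓝[(mainArc μ x c)ᶜ] (c x)]
      (fun z => ‖z - c x‖ ^ (3 / 2 : ℝ))
  endpoint_lower : ∃ A : ℂ → ℂ, AnalyticAt ℂ A (conj (c x)) ∧
    (fun z => G z - A z) =O[𝓝[(mainArc μ x c)ᶜ] (conj (c x))]
      (fun z => ‖z - conj (c x)‖ ^ (3 / 2 : ℝ))

end

/-! ### Square roots -/

/-! Factor `R(y,z) = -√(z - α(y)) √(z - α̃(y))`. On the region swept between `Λ` and the real axis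
`Im α̃ < 0`, so for `Im z ≥ 0` the number `z - α̃` stays in the upper half-plane and the second root
is the fixed branch `upperSqrt`. Only `√(z - α)` has to be continued, from `y = +∞`, and the only
obstruction is a later contour point with `α = z`. The continuation is made jointly in `z`, in the
contours `t + iση(t)` and in `t`, by lifting a homotopy through the squaring map (`exists_isRoot`).

All limits under the integral rest on one bound, uniform in `z`: `|z - μ + R| ≤ 9 m(t)` with a
decreasing integrable majorant `m` of `|α - μ|` and `|α̃ - μ|` (`norm_add_sweptRadical_le`). It
gives absolute convergence, holomorphy in the upper half-plane off the arc, and boundedness of `g`,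
hence analyticity at infinity. By Green's formula the contour may be moved through the swept region
(`integral_swept_sub`, and `integral_swept_sub_arc` for `z` on the arc). Moved to the real axis,
where `R² = |z - α|²` for real `z`, it shows that `g` is real there, so Schwarz reflection applies.

Jump. Let `z` tend to the arc point `c(s)` from one side. For `t > s` the root of `z - α` has a
two-sided limit. For `t < s` the limits from the two sides are opposite, namely `±i` times the root
of `c(t) - c(s)`, which is already defined (`tendsto_root_side`). In `g₊ + g₋` the radicals with `t
< s` therefore cancel and those with `t > s` double, and what remains is `f₀ - xz` (`gSide_add`),
because the vertical contour of `f₀` can be deformed into the rest of `Λ`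
(`integral_contourFrom_arc`). At `μ` every radical cancels.

Local structure. Put `w = x(z)`. Near the branch point, `R(y,z) = ζ r(w,y)` with `ζ² = y - w` and a
holomorphic nonvanishing `r`, so the integral of `R` from `w` to `y` is a function `localPrim` of
`ζ`, equal to `ζ(y - w)` times a function single-valued in `w`. Taken up to a fixed real point to
the right it is analytic in `z`; this gives analyticity of `f₀` (`analyticAt_f₀`). At the endpoint,
`g - (f₀ - xz)/2` is exactly `-½` times the primitive taken up to `y = x`, which has order `3/2`
(`g_endpoint`). The lower half of the arc follows by conjugation. -/

/-- The slope of `q` is the slope of `f` times `f t + f s`, and the last factor tends to `2 f s ≠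
0`. The field is left general because roots are differentiated both in complex `z` and in real
contour parameters. -/
theorem hasDerivAt_of_sq_eq {𝕜 : Type*} [NontriviallyNormedField 𝕜] [NormedAlgebra 𝕜 ℂ]
    {f q : 𝕜 → ℂ} {q' : ℂ} {s : 𝕜} (hf : ContinuousAt f s) (hq : HasDerivAt q q' s)
    (h : ∀ᶠ t in 𝓝 s, f t ^ 2 = q t) (h0 : f s ≠ 0) : HasDerivAt f (q' / (2 * f s)) s := by
  rw [hasDerivAt_iff_tendsto_slope] at hq ⊢
  have h1 : Tendsto (fun t => f t + f s) (𝓝[≠] s) (𝓝 (2 * f s)) := by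
    rw [two_mul]
    exact (hf.tendsto.mono_left nhdsWithin_le_nhds).add_const _
  have h2 : 2 * f s ≠ 0 := mul_ne_zero two_ne_zero h0
  refine (hq.div h1 h2).congr' ?_
  filter_upwards [h.filter_mono nhdsWithin_le_nhds, h1.eventually_ne h2] with t ht ht'
  rw [Pi.div_apply, slope_def_module, slope_def_module, ← ht, ← h.self_of_nhds,
    div_eq_iff ht', smul_mul_assoc]
  congr 1
  ring

theorem tendsto_zero_of_sq {ι : Type*} {l : Filter ι} {f : ι → ℂ}
    (h : Tendsto (fun i => f i ^ 2) l (𝓝 0)) : Tendsto f l (𝓝 0) := by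
  rw [tendsto_zero_iff_norm_tendsto_zero] at h ⊢
  have := h.sqrt
  simpa [Real.sqrt_sq] using this

/-- A path from the right to the left half-plane meets the imaginary axis, where `u² ≤ 0` and so
`|u² - 1| ≥ 1`. This is how the sign of a root is carried along a contour. -/
theorem re_pos_of_sq_near_one {X : Type*} [TopologicalSpace X] {S : Set X} (hS : IsPreconnected S)
    {f : X → ℂ} (hf : ContinuousOn f S) (h : ∀ s ∈ S, ‖f s ^ 2 - 1‖ < 1)
    {s₀ : X} (hs₀ : s₀ ∈ S) (h₀ : 0 < (f s₀).re) {s : X} (hs : s ∈ S) : 0 < (f s).re := by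
  by_contra! hneg
  obtain ⟨u, hu, hu0⟩ := hS.intermediate_value hs hs₀
    (Complex.continuous_re.comp_continuousOn hf) ⟨hneg, h₀.le⟩
  have h1 := h u hu
  have h2 : |(f u ^ 2 - 1).re| ≤ ‖f u ^ 2 - 1‖ := Complex.abs_re_le_norm _
  simp only [Function.comp_apply] at hu0
  rw [sq] at h1 h2
  rw [Complex.sub_re, Complex.mul_re, hu0, Complex.one_re, abs_le] at h2
  nlinarith [mul_self_nonneg (f u).im]

theorem norm_sub_one_le_of_re_pos {w : ℂ} (h : 0 < w.re) : ‖w - 1‖ ≤ ‖w ^ 2 - 1‖ := by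
  have h1 : w ^ 2 - 1 = (w - 1) * (w + 1) := by ring
  have h2 : 1 ≤ ‖w + 1‖ := by
    calc (1 : ℝ) ≤ (w + 1).re := by simp [h.le]
      _ ≤ ‖w + 1‖ := Complex.re_le_norm _
  rw [h1, norm_mul]
  exact le_mul_of_one_le_right (norm_nonneg _) h2

/-- The square root with a cut along the negative imaginary axis. -/
noncomputable def upperSqrt (w : ℂ) : ℂ :=
  Complex.exp (Complex.I * (Real.pi / 4 : ℝ)) * (-Complex.I * w) ^ (((2 : ℕ) : ℂ)⁻¹)

theorem upperSqrt_sq (w : ℂ) : upperSqrt w ^ 2 = w := by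
  rw [upperSqrt, mul_pow, Complex.cpow_nat_inv_pow _ two_ne_zero, ← Complex.exp_nat_mul]
  have : ((2 : ℕ) : ℂ) * (Complex.I * (Real.pi / 4 : ℝ)) = Real.pi / 2 * Complex.I := by
    push_cast; ring
  rw [this, Complex.exp_pi_div_two_mul_I]
  linear_combination (-w) * Complex.I_sq

theorem upperSqrt_ne_zero {w : ℂ} (hw : w ≠ 0) : upperSqrt w ≠ 0 := fun h => hw <| by
  rw [← upperSqrt_sq w, h]; simp

theorem differentiableAt_upperSqrt {w : ℂ} (hw : 0 < w.im ∨ w.re ≠ 0) :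
    DifferentiableAt ℂ upperSqrt w := by
  unfold upperSqrt
  refine (DifferentiableAt.cpow_const (by fun_prop) ?_).const_mul _
  rw [Complex.mem_slitPlane_iff]
  simpa using hw

theorem upperSqrt_zero : upperSqrt 0 = 0 := by
  have := upperSqrt_sq 0
  simpa using this

theorem continuousOn_upperSqrt : ContinuousOn upperSqrt {w | 0 ≤ w.im} := by
  intro w hw
  by_cases h : 0 < w.im ∨ w.re ≠ 0
  · exact (differentiableAt_upperSqrt h).continuousAt.continuousWithinAt
  · push Not at h
    have hw0 : w = 0 := Complex.ext h.2 (le_antisymm h.1 hw)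
    subst hw0
    have : Tendsto upperSqrt (𝓝 0) (𝓝 0) := tendsto_zero_of_sq (by
      simp only [upperSqrt_sq]; exact tendsto_id)
    have h1 : ContinuousAt upperSqrt 0 := by
      rw [ContinuousAt, upperSqrt_zero]; exact this
    exact h1.continuousWithinAt

theorem upperSqrt_one : upperSqrt 1 = 1 := by
  unfold upperSqrt
  rw [Complex.cpow_def_of_ne_zero (by simp), mul_one, Complex.log_neg_I, ← Complex.exp_add]
  convert Complex.exp_zero using 2
  push_cast; ring

theorem upperSqrt_neg_one : upperSqrt (-1) = Complex.I := by
  unfold upperSqrt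
  rw [Complex.cpow_def_of_ne_zero (by simp)]
  simp only [mul_neg, mul_one, neg_neg]
  nth_rw 3 [← Complex.exp_pi_div_two_mul_I]
  rw [Complex.log_I, ← Complex.exp_add]
  congr 1
  push_cast; ring

/-- Both sides are continuous roots of `-v` on the connected half-plane `Re v > 0`, which avoids
both cuts, and they agree at `v = 1`. This is the source of the factor `i` in the boundary values.
-/
theorem upperSqrt_neg {v : ℂ} (hv : 0 < v.re) : upperSqrt (-v) = Complex.I * upperSqrt v := by
  have hS : IsPreconnected {v : ℂ | 0 < v.re} := (convex_halfSpace_re_gt 0).isPreconnected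
  refine hS.eq_of_sq_eq (f := fun v => upperSqrt (-v)) (g := fun v => Complex.I * upperSqrt v)
    (fun w hw => ?_) (fun w hw => ?_) (fun w _ => ?_) (fun {w} hw => ?_) (y := 1) (by simp) ?_ hv
  · exact ((differentiableAt_upperSqrt (w := -w) (Or.inr (by simpa using (ne_of_gt hw)))).comp w
      differentiableAt_id.neg).continuousAt.continuousWithinAt
  · exact ((differentiableAt_upperSqrt
      (Or.inr (ne_of_gt hw))).const_mul _).continuousAt.continuousWithinAt
  · simp [mul_pow, upperSqrt_sq]
  · exact mul_ne_zero Complex.I_ne_zero (upperSqrt_ne_zero fun h => by simp [h] at hw)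
  · simp [upperSqrt_neg_one, upperSqrt_one]

/-- Continuous square roots along the radii of a fibrewise star-like set. -/
theorem exists_sqrt_of_starLike {Y : Type*} [TopologicalSpace Y] {O : Set (Y × ℝ)}
    (hO : ∀ p ∈ O, ∀ θ ∈ Icc (0 : ℝ) 1, (p.1, θ * p.2) ∈ O)
    {q : Y × ℝ → ℂ} (hq : ContinuousOn q O) (hq0 : ∀ p ∈ O, q p ≠ 0)
    {r₀ : Y → ℂ} (hr₀ : ContinuousOn (fun p : Y × ℝ => r₀ p.1) O)
    (hr₀q : ∀ p ∈ O, r₀ p.1 ^ 2 = q (p.1, 0)) :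
    ∃ r : Y × ℝ → ℂ, ContinuousOn r O ∧ (∀ p ∈ O, r p ^ 2 = q p) ∧
      ∀ y, (y, 0) ∈ O → r (y, 0) = r₀ y := by
  classical
  have cov := isCoveringMap_npow (𝕜 := ℂ) 2 (by norm_num)
  have h0 : ∀ p ∈ O, (p.1, (0 : ℝ)) ∈ O := fun p hp => by simpa using hO p hp 0 (by simp)
  -- The homotopy runs along each radius, from its origin, where `r₀` is a lift through squaring, to
  -- the given point; the lift at time one is the root.
  let H : C(unitInterval × O, {z : ℂ // z ≠ 0}) :=
    { toFun := fun p => ⟨q (p.2.1.1, p.1.1 * p.2.1.2), hq0 _ (hO _ p.2.2 _ p.1.2)⟩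
      continuous_toFun := by
        refine Continuous.subtype_mk ?_ _
        exact hq.comp_continuous (by fun_prop) fun p => hO _ p.2.2 _ p.1.2 }
  let f : C(O, {z : ℂ // z ≠ 0}) :=
    { toFun := fun p => ⟨r₀ p.1.1, fun h => by
        have := hr₀q p.1 p.2
        rw [h] at this
        exact hq0 _ (h0 _ p.2) (by rw [← this]; simp)⟩
      continuous_toFun := by
        refine Continuous.subtype_mk ?_ _
        exact hr₀.comp_continuous continuous_subtype_val fun p => p.2 }
  have H_0 : ∀ a : O, H (0, a) = ⟨(f a).1 ^ 2, pow_ne_zero 2 (f a).2⟩ := by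
    intro a
    apply Subtype.ext
    simp only [H, f, ContinuousMap.coe_mk]
    rw [hr₀q _ a.2]
    simp
  let K := cov.liftHomotopy H f H_0
  have hK : ∀ t (a : O), (K (t, a)).1 ^ 2 = q (a.1.1, t.1 * a.1.2) := fun t a =>
    congrArg Subtype.val (congrFun (cov.liftHomotopy_lifts H f H_0) (t, a))
  refine ⟨fun p => if h : p ∈ O then (K (1, ⟨p, h⟩)).1 else 0, ?_, ?_, ?_⟩
  · rw [continuousOn_iff_continuous_domRestrict]
    have : O.domRestrict (fun p => if h : p ∈ O then (K (1, ⟨p, h⟩)).1 else 0) =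
        fun a => (K (1, a)).1 := by
      ext a; simp [Set.domRestrict_apply]
    rw [this]
    exact continuous_subtype_val.comp (K.continuous.comp (by fun_prop))
  · intro p hp
    simp only [hp, dif_pos]
    rw [hK]; simp
  · intro y hy
    simp only [hy, dif_pos]
    -- Over the origin of a radius the path is constant, so the lift stays at `r₀`.
    have hc : H.comp ((ContinuousMap.id unitInterval).prodMk
        (ContinuousMap.const unitInterval ⟨(y, 0), hy⟩)) = ContinuousMap.const _
          ⟨q (y, 0), hq0 _ hy⟩ := by
      ext t; simp [H]
    have := cov.liftPath_const (x := ⟨q (y, 0), hq0 _ hy⟩) (e := f ⟨(y, 0), hy⟩) (by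
      apply Subtype.ext; simp only [f, ContinuousMap.coe_mk]; rw [hr₀q _ hy])
    have h2 : K (1, ⟨(y, 0), hy⟩) = f ⟨(y, 0), hy⟩ := by
      have h3 := congrArg (fun g : C(unitInterval, {z : ℂ // z ≠ 0}) => g 1) this
      simp only [ContinuousMap.const_apply] at h3
      rw [← h3]
      simp only [K, IsCoveringMap.liftHomotopy_apply]
      congr 1
      simp only [hc]
    rw [h2]; rfl

/-! ### Holomorphic functions -/

/-- Cauchy's estimate turns the majorant of the integrand into a majorant of its derivative, so one
may differentiate under the integral; the derivative is measurable in `t` as a limit of difference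
quotients. -/
theorem differentiableOn_integral_of_bound {S : Set ℝ} (hS : MeasurableSet S) {F : ℂ → ℝ → ℂ}
    {U : Set ℂ} (hU : IsOpen U) {M : ℝ → ℝ} (hM : IntegrableOn M S)
    (hmeas : ∀ z ∈ U, AEStronglyMeasurable (F z) (volume.restrict S))
    (hd : ∀ t ∈ S, DifferentiableOn ℂ (fun z => F z t) U)
    (hb : ∀ t ∈ S, ∀ z ∈ U, ‖F z t‖ ≤ M t) :
    DifferentiableOn ℂ (fun z => ∫ t in S, F z t) U := by
  intro z₀ hz₀
  obtain ⟨r, hr, hrU⟩ := Metric.isOpen_iff.1 hU z₀ hz₀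
  have hr2 : 0 < r / 2 := by linarith
  have hsub : ∀ z ∈ Metric.ball z₀ (r / 2), Metric.closedBall z (r / 4) ⊆ U := by
    intro z hz w hw
    apply hrU
    rw [Metric.mem_ball] at hz ⊢
    rw [Metric.mem_closedBall] at hw
    linarith [dist_triangle w z z₀]
  have hderiv : ∀ t ∈ S, ∀ z ∈ Metric.ball z₀ (r / 2),
      HasDerivAt (fun z => F z t) (deriv (fun z => F z t) z) z := fun t ht z hz =>
    ((hd t ht).differentiableAt (hU.mem_nhds (hsub z hz
      (Metric.mem_closedBall_self (by linarith))))).hasDerivAt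
  have hmeas' : AEStronglyMeasurable (fun t => deriv (fun z => F z t) z₀) (volume.restrict S) := by
    obtain ⟨u, hu⟩ := exists_seq_tendsto (𝓝[≠] z₀)
    have hu1 : ∀ᶠ n in atTop, u n ∈ U :=
      hu.eventually (mem_nhdsWithin_of_mem_nhds (hU.mem_nhds hz₀))
    obtain ⟨N, hN⟩ := eventually_atTop.1 hu1
    refine aestronglyMeasurable_of_tendsto_ae (u := atTop)
      (f := fun n t => slope (fun z => F z t) z₀ (u (n + N))) (fun n => ?_) ?_
    · simp only [slope_def_module]
      exact ((hmeas _ (hN _ (Nat.le_add_left N n))).sub (hmeas _ hz₀)).const_smul (u (n + N) - z₀)⁻¹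
    · filter_upwards [ae_restrict_mem hS] with t ht
      have := (hasDerivAt_iff_tendsto_slope.1
        (hderiv t ht z₀ (Metric.mem_ball_self hr2))).comp hu
      exact (tendsto_add_atTop_iff_nat N).2 this
  refine (hasDerivAt_integral_of_dominated_loc_of_deriv_le (bound := fun t => M t / (r / 4))
    (F' := fun z t => deriv (fun z => F z t) z)
    (Metric.ball_mem_nhds z₀ hr2) ?_ ?_ hmeas' ?_ (hM.div_const _) ?_).2.differentiableAt.differentiableWithinAt
  · filter_upwards [hU.mem_nhds hz₀] with z hz using hmeas z hz
  · exact hM.mono' (hmeas _ hz₀) ((ae_restrict_mem hS).mono fun t ht => hb t ht _ hz₀)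
  · filter_upwards [ae_restrict_mem hS] with t ht z hz
    refine Complex.norm_deriv_le_of_forall_mem_sphere_norm_le (by linarith) ?_ fun w hw =>
      hb t ht w (hsub z hz (Metric.sphere_subset_closedBall hw))
    refine DifferentiableOn.diffContOnCl ((hd t ht).mono ?_)
    exact (Metric.closure_ball_subset_closedBall).trans (hsub z hz)
  · filter_upwards [ae_restrict_mem hS] with t ht z hz using hderiv t ht z hz

/-- A continuous function that is holomorphic off the real axis is holomorphic. -/
theorem differentiableOn_of_off_real {f : ℂ → ℂ} {U : Set ℂ} (hU : IsOpen U)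
    (hc : ContinuousOn f U) (hd : ∀ z ∈ U, z.im ≠ 0 → DifferentiableAt ℂ f z) :
    DifferentiableOn ℂ f U := by
  refine (Complex.isConservativeOn_and_continuousOn_iff_isDifferentiableOn hU).1 ⟨?_, hc⟩
  have key : ∀ z w : ℂ, Complex.Rectangle z w ⊆ U → (0 ∉ Ioo (min z.im w.im) (max z.im w.im)) →
      (∫ x : ℝ in z.re..w.re, f (x + z.im * Complex.I)) -
      (∫ x : ℝ in z.re..w.re, f (x + w.im * Complex.I)) +
      Complex.I • (∫ y : ℝ in z.im..w.im, f (w.re + y * Complex.I)) -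
      Complex.I • (∫ y : ℝ in z.im..w.im, f (z.re + y * Complex.I)) = 0 := by
    intro z w hzw h0
    refine Complex.integral_boundary_rect_eq_zero_of_continuousOn_of_differentiableOn f z w
      (hc.mono hzw) fun u hu => (hd u (hzw ?_) ?_).differentiableWithinAt
    · exact ⟨Ioo_subset_Icc_self hu.1, Ioo_subset_Icc_self hu.2⟩
    · intro h
      have := hu.2
      rw [mem_preimage, h] at this
      exact h0 this
  intro z w hzw
  rw [← add_eq_zero_iff_eq_neg, Complex.wedgeIntegral_add_wedgeIntegral_eq]
  -- By Morera, rectangle integrals suffice. A rectangle that crosses the real axis is cut along it;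
  -- each half is holomorphic inside and continuous up to the boundary.
  by_cases h0 : 0 ∈ Ioo (min z.im w.im) (max z.im w.im)
  swap
  · exact key z w hzw h0
  have hmem0 : (0 : ℝ) ∈ (uIcc z.im w.im) := Ioo_subset_Icc_self h0
  have e1 := key z ⟨w.re, 0⟩ (fun u hu => hzw ⟨hu.1, uIcc_subset_uIcc_left hmem0 hu.2⟩) (by
    simp only [mem_Ioo, not_and, not_lt]
    intro h
    rcases le_total z.im 0 with h' | h' <;> simp_all)
  have e2 := key ⟨z.re, 0⟩ w (fun u hu => hzw ⟨hu.1, uIcc_subset_uIcc_right hmem0 hu.2⟩) (by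
    simp only [mem_Ioo, not_and, not_lt]
    intro h
    rcases le_total w.im 0 with h' | h' <;> simp_all)
  have hcv : ∀ x ∈ (uIcc z.re w.re), ContinuousOn (fun y : ℝ => f (x + y * Complex.I))
      (uIcc z.im w.im) := by
    intro x hx
    refine hc.comp (by fun_prop) fun y hy => hzw ?_
    exact ⟨by simpa using hx, by simpa using hy⟩
  have hv : ∀ x ∈ (uIcc z.re w.re), (∫ y : ℝ in z.im..w.im, f (x + y * Complex.I)) =
      (∫ y : ℝ in z.im..0, f (x + y * Complex.I)) + ∫ y : ℝ in (0 : ℝ)..w.im, f (x + y * Complex.I) := by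
    intro x hx
    rw [intervalIntegral.integral_add_adjacent_intervals]
    · exact ((hcv x hx).mono (uIcc_subset_uIcc_left hmem0)).intervalIntegrable
    · exact ((hcv x hx).mono (uIcc_subset_uIcc_right hmem0)).intervalIntegrable
  rw [hv _ right_mem_uIcc, hv _ left_mem_uIcc]
  simp only [smul_add]
  simp only at e1 e2
  linear_combination e1 + e2

theorem differentiableAt_conj_conj {f : ℂ → ℂ} {z : ℂ} (h : DifferentiableAt ℂ f (conj z)) :
    DifferentiableAt ℂ (fun w => conj (f (conj w))) z := by
  have := h.hasDerivAt.conj_conj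
  rw [Complex.conj_conj] at this
  exact this.differentiableAt

theorem conj_eq_self_of_im {z : ℂ} (h : z.im = 0) : conj z = z := Complex.conj_eq_iff_im.2 h

/-- Schwarz reflection: continuity. -/
theorem continuousOn_reflect {f : ℂ → ℂ} {U : Set ℂ} (hconj : ∀ z ∈ U, conj z ∈ U)
    (hc : ContinuousOn f (U ∩ {z | 0 ≤ z.im})) (hreal : ∀ z ∈ U, z.im = 0 → (f z).im = 0) :
    ContinuousOn (fun z => if 0 ≤ z.im then f z else conj (f (conj z))) U := by
  have h1 : ContinuousOn (fun z => if 0 ≤ z.im then f z else conj (f (conj z)))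
      (U ∩ {z | 0 ≤ z.im}) := hc.congr fun z hz => if_pos hz.2
  have h2 : ContinuousOn (fun z => if 0 ≤ z.im then f z else conj (f (conj z)))
      (U ∩ {z | z.im ≤ 0}) := by
    have : ContinuousOn (fun z => conj (f (conj z))) (U ∩ {z | z.im ≤ 0}) :=
      Complex.continuous_conj.comp_continuousOn (hc.comp Complex.continuous_conj.continuousOn
        fun z hz => ⟨hconj z hz.1, by simpa using hz.2⟩)
    refine this.congr fun z hz => ?_
    rcases lt_or_eq_of_le (mem_ofPred.1 hz.2) with h | h
    · exact if_neg (not_le.2 h)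
    · beta_reduce
      rw [if_pos h.ge, conj_eq_self_of_im h, conj_eq_self_of_im (hreal z hz.1 h)]
  intro z hz
  have h1' : ContinuousWithinAt (fun z => if 0 ≤ z.im then f z else conj (f (conj z)))
      (U ∩ {z | 0 ≤ z.im}) z := by
    by_cases h : 0 ≤ z.im
    · exact h1 z ⟨hz, h⟩
    · refine continuousWithinAt_of_notMem_closure fun hcl => h ?_
      exact (isClosed_le continuous_const Complex.continuous_im).closure_subset_iff.2
        inter_subset_right hcl
  have h2' : ContinuousWithinAt (fun z => if 0 ≤ z.im then f z else conj (f (conj z)))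
      (U ∩ {z | z.im ≤ 0}) z := by
    by_cases h : z.im ≤ 0
    · exact h2 z ⟨hz, h⟩
    · refine continuousWithinAt_of_notMem_closure fun hcl => h ?_
      exact (isClosed_le Complex.continuous_im continuous_const).closure_subset_iff.2
        inter_subset_right hcl
  refine (h1'.union h2').mono fun w hw => ?_
  rcases le_total 0 w.im with h | h
  · exact Or.inl ⟨hw, h⟩
  · exact Or.inr ⟨hw, h⟩

/-- Schwarz reflection: holomorphy. -/
theorem differentiableOn_reflect {f : ℂ → ℂ} {U : Set ℂ} (hU : IsOpen U)
    (hconj : ∀ z ∈ U, conj z ∈ U)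
    (hc : ContinuousOn f (U ∩ {z | 0 ≤ z.im})) (hreal : ∀ z ∈ U, z.im = 0 → (f z).im = 0)
    (hd : DifferentiableOn ℂ f (U ∩ {z | 0 < z.im})) :
    DifferentiableOn ℂ (fun z => if 0 ≤ z.im then f z else conj (f (conj z))) U := by
  refine differentiableOn_of_off_real hU (continuousOn_reflect hconj hc hreal) fun z hz h0 => ?_
  have hopen : IsOpen (U ∩ {z | 0 < z.im}) :=
    hU.inter (isOpen_lt continuous_const Complex.continuous_im)
  rcases lt_or_gt_of_ne h0 with h | h
  · have h1 : DifferentiableAt ℂ f (conj z) :=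
      hd.differentiableAt (hopen.mem_nhds ⟨hconj z hz, by simpa using h⟩)
    refine (differentiableAt_conj_conj h1).congr_of_eventuallyEq ?_
    filter_upwards [(isOpen_lt Complex.continuous_im continuous_const).mem_nhds h] with w hw
    exact if_neg (not_le.2 hw)
  · refine (hd.differentiableAt (hopen.mem_nhds ⟨hz, h⟩)).congr_of_eventuallyEq ?_
    filter_upwards [(isOpen_lt continuous_const Complex.continuous_im).mem_nhds h] with w hw
    exact if_pos (le_of_lt hw)

/-- A function that is holomorphic and bounded near infinity is holomorphic at infinity. -/
theorem analytic_infty_of_bounded {G : ℂ → ℂ} {S : Set ℂ} (hS : Bornology.IsBounded S) {M : ℝ}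
    (hd : DifferentiableOn ℂ G Sᶜ) (hb : ∀ z ∈ Sᶜ, ‖G z‖ ≤ M) :
    ∃ H : ℂ → ℂ, AnalyticAt ℂ H 0 ∧ ∀ᶠ z in cocompact ℂ, G z = H z⁻¹ := by
  obtain ⟨r, hr⟩ := hS.subset_ball (0 : ℂ)
  set ρ := max r 1
  have hρ : 0 < ρ := lt_of_lt_of_le one_pos (le_max_right _ _)
  have hmem : ∀ ζ ∈ Metric.ball (0 : ℂ) ρ⁻¹ \ {0}, ζ⁻¹ ∈ {w : ℂ | ρ < ‖w‖} := by
    intro ζ hζ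
    rw [mem_ofPred, norm_inv, lt_inv_comm₀ hρ (norm_pos_iff.2 hζ.2)]
    simpa using hζ.1
  have hmem' : {w : ℂ | ρ < ‖w‖} ⊆ Sᶜ := fun w hw hwS => by
    have := hr hwS
    rw [Metric.mem_ball, dist_zero_right] at this
    exact absurd (lt_trans this (lt_of_le_of_lt (le_max_left _ _) hw)) (lt_irrefl _)
  have hopen : IsOpen {w : ℂ | ρ < ‖w‖} := isOpen_lt continuous_const continuous_norm
  have hd' : DifferentiableOn ℂ (fun ζ => G ζ⁻¹) (Metric.ball (0 : ℂ) ρ⁻¹ \ {0}) := by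
    intro ζ hζ
    have h1 := (hd.mono hmem').differentiableAt (hopen.mem_nhds (hmem ζ hζ))
    exact (h1.comp ζ (differentiableAt_inv hζ.2)).differentiableWithinAt
  have hB : Metric.ball (0 : ℂ) ρ⁻¹ ∈ 𝓝 (0 : ℂ) := Metric.ball_mem_nhds _ (inv_pos.2 hρ)
  have := Complex.differentiableOn_update_limUnder_of_bddAbove hB hd'
    ⟨M, by rintro _ ⟨ζ, hζ, rfl⟩; exact hb _ (hmem' (hmem ζ hζ))⟩
  refine ⟨_, this.analyticAt hB, ?_⟩
  have hlarge : ∀ᶠ z : ℂ in cocompact ℂ, ρ < ‖z‖ :=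
    (tendsto_norm_cocompact_atTop).eventually (eventually_gt_atTop ρ)
  filter_upwards [hlarge] with z hz
  have hz0 : z ≠ 0 := norm_pos_iff.1 (hρ.trans hz)
  rw [Function.update_of_ne (inv_ne_zero hz0)]
  simp

/-! ### Branches of the radical -/

/-- Without zeros on the open ray, two roots agree there up to one sign, and the nonzero limit `-(z
- μ)` fixes it. The initial point may be a zero of the radical and is reached by continuity. -/
theorem radicalBranch_unique {a b : ℂ → ℂ} {μ : ℝ} {l : ℝ → ℂ} {t₀ : ℝ} {z : ℂ} {r r' : ℝ → ℂ}
    (hr : IsRadicalBranch a b μ l t₀ z r) (hr' : IsRadicalBranch a b μ l t₀ z r')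
    (hz : z ≠ μ) (h : ∀ t > t₀, z ≠ alpha a b (l t) ∧ z ≠ alphaTilde a b (l t)) :
    EqOn r r' (Ici t₀) := by
  have hne : ∀ t ∈ Ioi t₀, r' t ≠ 0 := by
    intro t ht h0
    have := hr'.2.1 t (Ioi_subset_Ici_self ht)
    rw [h0, zero_pow two_ne_zero, eq_comm, mul_eq_zero, sub_eq_zero, sub_eq_zero] at this
    rcases this with h' | h'
    · exact (h t ht).1 h'
    · exact (h t ht).2 h'
  have hI : EqOn r r' (Ioi t₀) := by
    rcases isPreconnected_Ioi.eq_or_eq_neg_of_sq_eq (hr.1.mono Ioi_subset_Ici_self)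
      (hr'.1.mono Ioi_subset_Ici_self) (fun t ht => by
        simp only [Pi.pow_apply]
        rw [hr.2.1 t (Ioi_subset_Ici_self ht), hr'.2.1 t (Ioi_subset_Ici_self ht)]) (fun {t} ht => hne t ht) with h1 | h1
    · exact h1
    · exfalso
      have h2 : Tendsto (-r') atTop (𝓝 (-(z - μ))) :=
        hr.2.2.congr' ((eventually_gt_atTop t₀).mono fun t ht => h1 ht)
      have h3 := tendsto_nhds_unique h2 hr'.2.2.neg
      rw [neg_neg, neg_eq_self] at h3
      exact hz (sub_eq_zero.1 h3)
  intro t ht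
  rcases eq_or_lt_of_le (mem_Ici.1 ht) with h1 | h1
  · subst h1
    have e1 := (hr.1 t₀ self_mem_Ici).mono Ioi_subset_Ici_self
    have e2 := (hr'.1 t₀ self_mem_Ici).mono Ioi_subset_Ici_self
    exact tendsto_nhds_unique e1.tendsto
      (e2.tendsto.congr' (eventually_nhdsWithin_of_forall fun t ht => (hI ht).symm))
  · exact hI h1

theorem radical_spec {a b : ℂ → ℂ} {μ : ℝ} {l : ℝ → ℂ} {t₀ : ℝ} {z : ℂ} {r : ℝ → ℂ}
    (hr : IsRadicalBranch a b μ l t₀ z r) :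
    IsRadicalBranch a b μ l t₀ z (radical a b μ l t₀ z) := by
  have h : ∃ r, IsRadicalBranch a b μ l t₀ z r := ⟨r, hr⟩
  rw [radical, dif_pos h]
  exact h.choose_spec

theorem radical_eqOn {a b : ℂ → ℂ} {μ : ℝ} {l : ℝ → ℂ} {t₀ : ℝ} {z : ℂ} {r : ℝ → ℂ}
    (hr : IsRadicalBranch a b μ l t₀ z r)
    (hz : z ≠ μ) (h : ∀ t > t₀, z ≠ alpha a b (l t) ∧ z ≠ alphaTilde a b (l t)) :
    EqOn (radical a b μ l t₀ z) r (Ici t₀) :=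
  radicalBranch_unique (radical_spec hr) hr hz h

/-! ### The curve on the real axis -/

theorem norm_le_rpow_neg_of_decay {h : ℂ → ℂ} {p : ℝ} {l : Filter ℂ} {l' : Filter ℝ}
    (hl : Tendsto (fun t : ℝ => (t : ℂ)) l' l) (h0 : ∀ᶠ t in l', t ≠ 0)
    (hd : Tendsto (fun y : ℂ => y ^ (p : ℂ) * h y) l (𝓝 0)) :
    ∀ᶠ t : ℝ in l', ‖h t‖ ≤ |t| ^ (-p) := by
  have h1 := (hd.comp hl).norm
  rw [norm_zero] at h1
  filter_upwards [h1.eventually (ge_mem_nhds zero_lt_one), h0] with t ht ht0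
  simp only [Function.comp_apply, norm_mul, Complex.norm_cpow_real, Complex.norm_real,
    Real.norm_eq_abs] at ht
  have hp : 0 < |t| ^ p := Real.rpow_pos_of_pos (abs_pos.2 ht0) p
  rw [Real.rpow_neg (abs_nonneg t), ← one_div, le_div_iff₀ hp, mul_comm]
  exact ht

section
variable {a b : ℂ → ℂ} {D L : Set ℂ} {μm μp p : ℝ}

namespace ConditionsA

theorem differentiableOn_alpha (h : ConditionsA a b D L μm μp p) :
    DifferentiableOn ℂ (alpha a b) D :=
  h.analytic_a.add (h.analytic_b.const_mul _)

theorem differentiableOn_alphaTilde (h : ConditionsA a b D L μm μp p) :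
    DifferentiableOn ℂ (alphaTilde a b) D :=
  h.analytic_a.sub (h.analytic_b.const_mul _)

theorem im_alpha (h : ConditionsA a b D L μm μp p) (x : ℝ) :
    (alpha a b x).im = (b x).re := by
  simp [alpha, h.real_a]

theorem im_alpha_pos (h : ConditionsA a b D L μm μp p) (x : ℝ) : 0 < (alpha a b x).im := by
  rw [h.im_alpha]; exact h.pos_b x

theorem alphaTilde_ofReal (h : ConditionsA a b D L μm μp p) (x : ℝ) :
    alphaTilde a b x = conj (alpha a b x) := by
  simp [alpha, alphaTilde, conj_eq_self_of_im (h.real_a x), conj_eq_self_of_im (h.real_b x),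
    sub_eq_add_neg]

theorem im_alphaTilde_neg (h : ConditionsA a b D L μm μp p) (x : ℝ) :
    (alphaTilde a b x).im < 0 := by
  rw [h.alphaTilde_ofReal, Complex.conj_im]
  exact neg_neg_of_pos (h.im_alpha_pos x)

theorem alpha_mem_L (h : ConditionsA a b D L μm μp p) (x : ℝ) : alpha a b x ∈ L :=
  h.region_L _ (Or.inr (Or.inl ⟨x, rfl⟩)) (h.im_alpha_pos x)

theorem tendsto_ofReal_right (h : ConditionsA a b D L μm μp p) :
    Tendsto (fun t : ℝ => (t : ℂ)) atTop
      (comap Complex.re atTop ⊓ 𝓟 {y | y ∈ D ∧ alpha a b y ∈ L}) := by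
  refine tendsto_inf.2 ⟨tendsto_comap_iff.2 ?_, tendsto_principal.2 <| .of_forall fun t =>
    ⟨h.real_mem_D t, h.alpha_mem_L t⟩⟩
  exact tendsto_id

theorem tendsto_ofReal_left (h : ConditionsA a b D L μm μp p) :
    Tendsto (fun t : ℝ => (t : ℂ)) atBot
      (comap Complex.re atBot ⊓ 𝓟 {y | y ∈ D ∧ alpha a b y ∈ L}) := by
  refine tendsto_inf.2 ⟨tendsto_comap_iff.2 ?_, tendsto_principal.2 <| .of_forall fun t =>
    ⟨h.real_mem_D t, h.alpha_mem_L t⟩⟩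
  exact tendsto_id

theorem decay_right (h : ConditionsA a b D L μm μp p) :
    ∀ᶠ t : ℝ in atTop, ‖a t - μp‖ ≤ |t| ^ (-p) ∧ ‖b t‖ ≤ |t| ^ (-p) :=
  (norm_le_rpow_neg_of_decay h.tendsto_ofReal_right (eventually_ne_atTop 0) h.decay_a_right).and
    (norm_le_rpow_neg_of_decay h.tendsto_ofReal_right (eventually_ne_atTop 0) h.decay_b_right)

theorem decay_left (h : ConditionsA a b D L μm μp p) :
    ∀ᶠ t : ℝ in atBot, ‖a t - μm‖ ≤ |t| ^ (-p) ∧ ‖b t‖ ≤ |t| ^ (-p) :=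
  (norm_le_rpow_neg_of_decay h.tendsto_ofReal_left (eventually_ne_atBot 0) h.decay_a_left).and
    (norm_le_rpow_neg_of_decay h.tendsto_ofReal_left (eventually_ne_atBot 0) h.decay_b_left)

theorem tendsto_alpha_of_decay {l : Filter ℝ} {μ : ℝ} (hp : 1 < p)
    (hd : ∀ᶠ t : ℝ in l, ‖a t - μ‖ ≤ |t| ^ (-p) ∧ ‖b t‖ ≤ |t| ^ (-p))
    (hl : Tendsto (fun t : ℝ => |t|) l atTop) :
    Tendsto (fun t : ℝ => alpha a b t) l (𝓝 μ) := by
  have h0 : Tendsto (fun t : ℝ => |t| ^ (-p)) l (𝓝 0) :=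
    (tendsto_rpow_neg_atTop (by linarith)).comp hl
  have h1 : Tendsto (fun t : ℝ => a t - μ) l (𝓝 0) :=
    squeeze_zero_norm' (hd.mono fun t ht => ht.1) h0
  have h2 : Tendsto (fun t : ℝ => b t) l (𝓝 0) :=
    squeeze_zero_norm' (hd.mono fun t ht => ht.2) h0
  have := (h1.add_const (μ : ℂ)).add (h2.const_mul Complex.I)
  simpa [alpha] using this

theorem tendsto_alpha_atTop (h : ConditionsA a b D L μm μp p) :
    Tendsto (fun t : ℝ => alpha a b t) atTop (𝓝 μp) :=
  tendsto_alpha_of_decay h.one_lt_p h.decay_right tendsto_abs_atTop_atTop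

theorem tendsto_alpha_atBot (h : ConditionsA a b D L μm μp p) :
    Tendsto (fun t : ℝ => alpha a b t) atBot (𝓝 μm) :=
  tendsto_alpha_of_decay h.one_lt_p h.decay_left tendsto_abs_atBot_atTop

theorem continuous_alpha (h : ConditionsA a b D L μm μp p) :
    Continuous (fun t : ℝ => alpha a b t) :=
  h.differentiableOn_alpha.continuousOn.comp_continuous Complex.continuous_ofReal h.real_mem_D

/-- The ends of the curve tend to real points, which are away from `α(x)` since `Im α(x) > 0`. The
remaining part is compact, and injectivity keeps it away from `α(x)`. -/
theorem eventually_near (h : ConditionsA a b D L μm μp p) (x : ℝ) {δ : ℝ} (hδ : 0 < δ) :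
    ∃ r > 0, ∀ y : ℝ, alpha a b y ∈ Metric.ball (alpha a b x) r → |y - x| < δ := by
  have hne : ∀ μ : ℝ, (μ : ℂ) ≠ alpha a b x := fun μ he => by
    have := h.im_alpha_pos x
    rw [← he] at this
    simp at this
  have hout : ∀ {μ : ℝ} {l : Filter ℝ}, Tendsto (fun t : ℝ => alpha a b t) l (𝓝 μ) →
      ∃ r > 0, ∀ᶠ t : ℝ in l, r ≤ dist (alpha a b t) (alpha a b x) := by
    intro μ l hl
    refine ⟨dist (μ : ℂ) (alpha a b x) / 2, half_pos (dist_pos.2 (hne μ)), ?_⟩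
    exact (hl.dist tendsto_const_nhds).eventually
      (le_mem_nhds (half_lt_self (dist_pos.2 (hne μ))))
  obtain ⟨r₁, hr₁, h₁⟩ := hout h.tendsto_alpha_atTop
  obtain ⟨r₂, hr₂, h₂⟩ := hout h.tendsto_alpha_atBot
  obtain ⟨T₁, hT₁⟩ := eventually_atTop.1 h₁
  obtain ⟨T₂, hT₂⟩ := eventually_atBot.1 h₂
  have hK : IsCompact ((fun t : ℝ => alpha a b t) '' (Icc T₂ T₁ \ Metric.ball x δ)) :=
    (isCompact_Icc.diff Metric.isOpen_ball).image h.continuous_alpha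
  have hx : alpha a b x ∉ (fun t : ℝ => alpha a b t) '' (Icc T₂ T₁ \ Metric.ball x δ) := by
    rintro ⟨y, hy, hyx⟩
    have := h.injective hyx
    subst this
    exact hy.2 (Metric.mem_ball_self hδ)
  obtain ⟨r₃, hr₃, h₃⟩ := Metric.isOpen_iff.1 hK.isClosed.isOpen_compl _ hx
  refine ⟨min (min r₁ r₂) r₃, by positivity, fun y hy => ?_⟩
  rw [Metric.mem_ball, lt_min_iff, lt_min_iff] at hy
  by_contra! hc
  refine h₃ (Metric.mem_ball.2 hy.2) ⟨y, ⟨⟨?_, ?_⟩, ?_⟩, rfl⟩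
  · by_contra! hlt
    exact absurd (hT₂ y hlt.le) (not_le.2 hy.1.2)
  · by_contra! hlt
    exact absurd (hT₁ y hlt.le) (not_le.2 hy.1.1)
  · rw [Metric.mem_ball, Real.dist_eq]
    exact not_lt.2 hc

/-- The inverse function theorem, on a ball so small that every real `y` with `α(y)` in it is close
to `x`; otherwise the local inverse could differ from `y` there. -/
theorem exists_local_inverse (h : ConditionsA a b D L μm μp p) {x : ℝ}
    (hx : deriv (alpha a b) x ≠ 0) :
    ∃ r > 0, ∃ φ : ℂ → ℂ, Metric.ball (alpha a b x) r ⊆ L ∧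
      DifferentiableOn ℂ φ (Metric.ball (alpha a b x) r) ∧
      MapsTo φ (Metric.ball (alpha a b x) r) D ∧
      (∀ z ∈ Metric.ball (alpha a b x) r, alpha a b (φ z) = z) ∧
      (∀ y : ℝ, alpha a b y ∈ Metric.ball (alpha a b x) r → φ (alpha a b y) = y) ∧
      ∃ V ∈ 𝓝 (x : ℂ), InjOn (alpha a b) V := by
  have han : AnalyticAt ℂ (alpha a b) x :=
    h.differentiableOn_alpha.analyticAt (h.isOpen_D.mem_nhds (h.real_mem_D x))
  have hs : HasStrictDerivAt (alpha a b) (deriv (alpha a b) x) x := han.hasStrictDerivAt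
  have hs' := hs.hasStrictFDerivAt_equiv hx
  set e := hs'.toOpenPartialHomeomorph (alpha a b) with he
  have hxe : (x : ℂ) ∈ e.source := hs'.mem_toOpenPartialHomeomorph_source
  have hcoe : ∀ y, e y = alpha a b y := fun y => rfl
  have hV : ∀ᶠ y in 𝓝 (x : ℂ), y ∈ e.source ∧ y ∈ D ∧ deriv (alpha a b) y ≠ 0 := by
    refine Eventually.and (e.open_source.mem_nhds hxe)
      (Eventually.and (h.isOpen_D.mem_nhds (h.real_mem_D x)) ?_)
    exact han.deriv.continuousAt.eventually_ne hx
  have hφ : ∀ᶠ z in 𝓝 (alpha a b x), z ∈ e.target ∧ (e.symm z ∈ D ∧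
      deriv (alpha a b) (e.symm z) ≠ 0) ∧ z ∈ L := by
    have hxt : alpha a b x ∈ e.target := e.map_source hxe
    refine Eventually.and (e.open_target.mem_nhds hxt)
      (Eventually.and ?_ (h.isOpen_L.mem_nhds (h.alpha_mem_L x)))
    have hc : Tendsto e.symm (𝓝 (alpha a b x)) (𝓝 (x : ℂ)) := by
      have := e.symm.continuousAt (x := alpha a b x) hxt
      rwa [ContinuousAt, ← hcoe x, e.left_inv hxe] at this
    exact (hc.eventually hV).mono fun z hz => hz.2
  obtain ⟨δ, hδ, hδV⟩ := Metric.eventually_nhds_iff.1 hV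
  obtain ⟨r₁, hr₁, h₁⟩ := Metric.eventually_nhds_iff.1 hφ
  obtain ⟨r₂, hr₂, h₂⟩ := h.eventually_near x hδ
  have hb : ∀ z ∈ Metric.ball (alpha a b x) (min r₁ r₂), dist z (alpha a b x) < r₁ := fun z hz =>
    (Metric.mem_ball.1 hz).trans_le (min_le_left _ _)
  refine ⟨min r₁ r₂, lt_min hr₁ hr₂, e.symm, fun z hz => (h₁ (hb z hz)).2.2, fun z hz => ?_,
    fun z hz => (h₁ (hb z hz)).2.1.1, fun z hz => ?_, fun y hy => ?_,
    e.source, e.open_source.mem_nhds hxe, e.injOn⟩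
  · obtain ⟨hz1, ⟨hz2, hz3⟩, -⟩ := h₁ (hb z hz)
    have hd : HasDerivAt e (deriv (alpha a b) (e.symm z)) (e.symm z) :=
      (h.differentiableOn_alpha.differentiableAt (h.isOpen_D.mem_nhds hz2)).hasDerivAt
    exact (e.hasDerivAt_symm hz1 hz3 hd).differentiableAt.differentiableWithinAt
  · exact e.right_inv (h₁ (hb z hz)).1
  · have hy' := h₂ y (Metric.ball_subset_ball (min_le_right _ _) hy)
    refine e.left_inv (hδV ?_).1
    rwa [Complex.dist_of_im_eq (by simp), Complex.ofReal_re, Complex.ofReal_re, Real.dist_eq]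

/-- The local inverses are glued over balls around the regular points of the curve; the identity
theorem makes them agree on overlaps. -/
theorem exists_isConformalInverse (h : ConditionsA a b D L μm μp p) :
    ∃ (C : Set ℂ) (X : ℂ → ℂ), IsConformalInverse a b D L C X := by
  classical
  choose! r hr φ hL hd hmaps hinv hleft V hV hVinj using
    fun (x : ℝ) (hx : deriv (alpha a b) x ≠ 0) => h.exists_local_inverse hx
  -- With halved radii, two meeting balls have the smaller centre `α(y)` inside the larger full
  -- ball. Near `α(y)` both inverses take values near `y`, where `α` is injective, and the
  -- intersection of the full balls is convex.
  have agree' : ∀ x y : ℝ, deriv (alpha a b) x ≠ 0 → deriv (alpha a b) y ≠ 0 → r y ≤ r x →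
      ∀ z ∈ Metric.ball (alpha a b x) (r x / 2), z ∈ Metric.ball (alpha a b y) (r y / 2) →
      φ x z = φ y z := by
    intro x y hx hy hyx z hzx hzy
    have hry := hr y hy
    rw [Metric.mem_ball] at hzx hzy
    have hyx' : alpha a b y ∈ Metric.ball (alpha a b x) (r x) := by
      rw [Metric.mem_ball]
      have := dist_triangle (alpha a b y) z (alpha a b x)
      rw [dist_comm _ z] at this
      linarith
    have hyy : alpha a b y ∈ Metric.ball (alpha a b y) (r y) := Metric.mem_ball_self (hr y hy)
    set W := Metric.ball (alpha a b x) (r x) ∩ Metric.ball (alpha a b y) (r y)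
    have hWo : IsOpen W := Metric.isOpen_ball.inter Metric.isOpen_ball
    have hWc : IsPreconnected W := ((convex_ball _ _).inter (convex_ball _ _)).isPreconnected
    have hx1 : DifferentiableOn ℂ (φ x) W := (hd x hx).mono inter_subset_left
    have hy1 : DifferentiableOn ℂ (φ y) W := (hd y hy).mono inter_subset_right
    have hyW : alpha a b y ∈ W := ⟨hyx', hyy⟩
    have hev : φ x =ᶠ[𝓝 (alpha a b y)] φ y := by
      have c1 : Tendsto (φ x) (𝓝 (alpha a b y)) (𝓝 (y : ℂ)) := by
        have := (hx1.differentiableAt (hWo.mem_nhds hyW)).continuousAt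
        rwa [ContinuousAt, hleft x hx y hyx'] at this
      have c2 : Tendsto (φ y) (𝓝 (alpha a b y)) (𝓝 (y : ℂ)) := by
        have := (hy1.differentiableAt (hWo.mem_nhds hyW)).continuousAt
        rwa [ContinuousAt, hleft y hy y hyy] at this
      filter_upwards [c1 (hV y hy), c2 (hV y hy), hWo.mem_nhds hyW] with w h1 h2 h3
      exact hVinj y hy h1 h2 (by rw [hinv x hx w h3.1, hinv y hy w h3.2])
    refine (hx1.analyticOnNhd hWo).eqOn_of_preconnected_of_eventuallyEq (hy1.analyticOnNhd hWo)
      hWc hyW hev ⟨?_, ?_⟩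
    · rw [Metric.mem_ball]; linarith [hr x hx]
    · rw [Metric.mem_ball]; linarith
  have agree : ∀ x y : ℝ, deriv (alpha a b) x ≠ 0 → deriv (alpha a b) y ≠ 0 →
      ∀ z ∈ Metric.ball (alpha a b x) (r x / 2), z ∈ Metric.ball (alpha a b y) (r y / 2) →
      φ x z = φ y z := by
    intro x y hx hy z hzx hzy
    rcases le_total (r y) (r x) with hle | hle
    · exact agree' x y hx hy hle z hzx hzy
    · exact (agree' y x hy hx hle z hzy hzx).symm
  let P : ℂ → ℝ → Prop := fun z x =>
    deriv (alpha a b) x ≠ 0 ∧ z ∈ Metric.ball (alpha a b x) (r x / 2)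
  -- Off the balls only critical points of the curve matter, where `x(α(x)) = x` is still required;
  -- the final value `0` plays no role.
  let X : ℂ → ℂ := fun z => if hz : ∃ x, P z x then φ hz.choose z
    else if hz' : ∃ x : ℝ, alpha a b x = z then hz'.choose else 0
  have hX : ∀ z x, P z x → X z = φ x z := by
    intro z x hzx
    have hz : ∃ x, P z x := ⟨x, hzx⟩
    simp only [X, hz, dif_pos]
    exact agree _ _ hz.choose_spec.1 hzx.1 _ hz.choose_spec.2 hzx.2
  have hbig : ∀ z x, P z x → z ∈ Metric.ball (alpha a b x) (r x) := fun z x hzx =>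
    Metric.ball_subset_ball (by linarith [hr x hzx.1]) hzx.2
  have hCo : IsOpen {z | ∃ x, P z x} := by
    have : {z | ∃ x, P z x} = ⋃ x ∈ {x : ℝ | deriv (alpha a b) x ≠ 0},
        Metric.ball (alpha a b x) (r x / 2) := by
      ext z; simp [P]
    rw [this]
    exact isOpen_biUnion fun _ _ => Metric.isOpen_ball
  refine ⟨{z | ∃ x, P z x}, X, hCo, ?_, ?_, ?_, ?_, ?_, ?_⟩
  · rintro z ⟨x, hzx⟩
    exact hL x hzx.1 (hbig z x hzx)
  · intro x hx
    exact ⟨x, hx, Metric.mem_ball_self (half_pos (hr x hx))⟩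
  · rintro z ⟨x, hzx⟩
    have : DifferentiableAt ℂ (φ x) z :=
      (hd x hzx.1).differentiableAt (Metric.isOpen_ball.mem_nhds (hbig z x hzx))
    refine (this.congr_of_eventuallyEq ?_).differentiableWithinAt
    filter_upwards [Metric.isOpen_ball.mem_nhds hzx.2] with w hw using hX w x ⟨hzx.1, hw⟩
  · rintro z ⟨x, hzx⟩
    rw [hX z x hzx]
    exact hmaps x hzx.1 (hbig z x hzx)
  · rintro z ⟨x, hzx⟩
    rw [hX z x hzx]
    exact hinv x hzx.1 z (hbig z x hzx)
  · intro y
    by_cases hz : ∃ x, P (alpha a b y) x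
    · obtain ⟨x, hzx⟩ := hz
      rw [hX _ x hzx]
      exact hleft x hzx.1 y (hbig _ x hzx)
    · have hz' : ∃ x : ℝ, alpha a b x = alpha a b y := ⟨y, rfl⟩
      simp only [X, hz, dif_neg, not_false_eq_true, hz', dif_pos]
      exact congrArg _ (h.injective hz'.choose_spec)

end ConditionsA
end

/-! ### The swept region and the square root of `z - α` on it -/

/-- The contours `t + i σ η(t)` that interpolate between the real axis and the graph of `η`. -/
def swept (η : ℝ → ℝ) (σ t : ℝ) : ℂ := t + Complex.I * (σ * η t : ℝ)

theorem swept_one (η : ℝ → ℝ) : swept η 1 = graphContour η := by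
  ext t; simp [swept, graphContour]

theorem swept_zero (η : ℝ → ℝ) (t : ℝ) : swept η 0 t = t := by
  simp [swept]

theorem swept_re (η : ℝ → ℝ) (σ t : ℝ) : (swept η σ t).re = t := by
  simp [swept]

/-- The data of an admissible contour over `[x, ∞)`, with an integrable majorant `m` for the
distance of `α` and `α̃` from `μ`. -/
structure IsSwept (a b : ℂ → ℂ) (η : ℝ → ℝ) (μ x T : ℝ) (m : ℝ → ℝ) (W : Set ℂ) : Prop where
  isOpen : IsOpen W
  diff_alpha : DifferentiableOn ℂ (alpha a b) W
  diff_tilde : DifferentiableOn ℂ (alphaTilde a b) W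
  mem : ∀ σ ∈ Icc (0 : ℝ) 1, ∀ t ≥ x, swept η σ t ∈ W
  upper : ∀ y ∈ W, 0 < (alpha a b y).im
  lower : ∀ y ∈ W, (alphaTilde a b y).im < 0
  inj : ∀ σ ∈ Icc (0 : ℝ) 1, ∀ t ≥ x, ∀ σ' ∈ Icc (0 : ℝ) 1, ∀ t' ≥ x,
    alpha a b (swept η σ t) = alpha a b (swept η σ' t') → swept η σ t = swept η σ' t'
  conj_real : ∀ t : ℝ, alphaTilde a b t = conj (alpha a b t)
  smooth : ContDiff ℝ 1 η
  start : η x = 0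
  tail : ∀ t ≥ T, η t = 0
  le_tail : x ≤ T
  anti : AntitoneOn m (Ici x)
  integrable : IntegrableOn m (Ioi x)
  tendsto : Tendsto m atTop (𝓝 0)
  bound : ∀ σ ∈ Icc (0 : ℝ) 1, ∀ t ≥ x, ‖alpha a b (swept η σ t) - μ‖ ≤ m t
  bound' : ∀ σ ∈ Icc (0 : ℝ) 1, ∀ t ≥ x, ‖alphaTilde a b (swept η σ t) - μ‖ ≤ m t

/-- The set of `(z, σ, t)` such that `z` is not met by `α` on the part of the contour beyond `t`. -/
def rootDom (a b : ℂ → ℂ) (η : ℝ → ℝ) (μ x : ℝ) : Set (ℂ × ℝ × ℝ) :=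
  {p | 0 ≤ p.1.im ∧ p.1 ≠ μ ∧ p.2.1 ∈ Icc (0 : ℝ) 1 ∧ x ≤ p.2.2 ∧
    ∀ t ≥ p.2.2, p.1 ≠ alpha a b (swept η p.2.1 t)}

/-- `U z σ t` is the square root of `z - α` along the contours `t + i σ η(t)`, continued from
`+∞`, and set to zero where `α = z`. -/
structure IsRoot (a b : ℂ → ℂ) (η : ℝ → ℝ) (μ x : ℝ) (U : ℂ → ℝ → ℝ → ℂ) : Prop where
  cont : ContinuousOn (fun p : ℂ × ℝ × ℝ => U p.1 p.2.1 p.2.2) (rootDom a b η μ x)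
  sq : ∀ p ∈ rootDom a b η μ x, U p.1 p.2.1 p.2.2 ^ 2 = p.1 - alpha a b (swept η p.2.1 p.2.2)
  lim : ∀ z : ℂ, 0 ≤ z.im → z ≠ μ → ∀ σ ∈ Icc (0 : ℝ) 1,
    Tendsto (U z σ) atTop (𝓝 (upperSqrt (z - μ)))
  zero : ∀ σ t, U (alpha a b (swept η σ t)) σ t = 0

section
variable {a b : ℂ → ℂ} {η : ℝ → ℝ} {μ x T : ℝ} {m : ℝ → ℝ} {W : Set ℂ}

theorem continuous_swept (hη : Continuous η) :
    Continuous (fun p : ℝ × ℝ => swept η p.1 p.2) := by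
  unfold swept; fun_prop

namespace IsSwept

variable (h : IsSwept a b η μ x T m W)
include h

theorem continuousOn_alpha :
    ContinuousOn (fun p : ℝ × ℝ => alpha a b (swept η p.1 p.2)) (Icc 0 1 ×ˢ Ici x) :=
  h.diff_alpha.continuousOn.comp (continuous_swept h.smooth.continuous).continuousOn
    fun p hp => h.mem p.1 hp.1 p.2 hp.2

theorem continuousOn_tilde :
    ContinuousOn (fun p : ℝ × ℝ => alphaTilde a b (swept η p.1 p.2)) (Icc 0 1 ×ˢ Ici x) :=
  h.diff_tilde.continuousOn.comp (continuous_swept h.smooth.continuous).continuousOn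
    fun p hp => h.mem p.1 hp.1 p.2 hp.2

theorem m_nonneg {t : ℝ} (ht : x ≤ t) : 0 ≤ m t :=
  (norm_nonneg _).trans (h.bound 0 (by simp) t ht)

theorem tendsto_alpha {σ : ℝ} (hσ : σ ∈ Icc (0 : ℝ) 1) :
    Tendsto (fun t => alpha a b (swept η σ t)) atTop (𝓝 μ) := by
  rw [tendsto_iff_norm_sub_tendsto_zero]
  exact squeeze_zero' (.of_forall fun _ => norm_nonneg _)
    ((eventually_ge_atTop x).mono fun t ht => h.bound σ hσ t ht) h.tendsto

theorem tendsto_tilde {σ : ℝ} (hσ : σ ∈ Icc (0 : ℝ) 1) :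
    Tendsto (fun t => alphaTilde a b (swept η σ t)) atTop (𝓝 μ) := by
  rw [tendsto_iff_norm_sub_tendsto_zero]
  exact squeeze_zero' (.of_forall fun _ => norm_nonneg _)
    ((eventually_ge_atTop x).mono fun t ht => h.bound' σ hσ t ht) h.tendsto

/-- The substitution `τ = 1/(t - x + 1)` puts the end `t = +∞` at `τ = 0`. Since `z` is not met
beyond `t`, the admissible `(z, σ, τ)` are star-like in `τ` towards `0`, and the root is continued
from `upperSqrt (z - μ)` there. -/
theorem exists_isRoot : ∃ U, IsRoot a b η μ x U := by
  classical
  let A : ℝ × ℝ → ℂ := fun p => if p.2 ≤ 0 then (μ : ℂ) else alpha a b (swept η p.1 (x - 1 + 1 / p.2))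
  have hge : ∀ τ : ℝ, 0 < τ → τ ≤ 1 → x ≤ x - 1 + 1 / τ := fun τ h0 h1 => by
    have := one_le_one_div h0 h1
    linarith
  have hAc : ContinuousOn A (Icc 0 1 ×ˢ Icc 0 1) := by
    rintro ⟨σ, τ⟩ ⟨hσ, hτ⟩
    simp only at hσ hτ
    rcases eq_or_lt_of_le hτ.1 with h0 | h0
    · subst h0
      rw [ContinuousWithinAt, tendsto_iff_norm_sub_tendsto_zero]
      have hA0 : A (σ, 0) = μ := by simp [A]
      rw [hA0]
      -- The majorant does not depend on `σ`, so the compactified `α` is jointly continuous at `τ =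
      -- 0`.
      let m' : ℝ → ℝ := fun τ => if τ ≤ 0 then 0 else m (x - 1 + 1 / τ)
      have hm' : Tendsto m' (𝓝 0) (𝓝 0) := by
        have h2 : Tendsto (fun τ => m (x - 1 + 1 / τ)) (𝓝[>] 0) (𝓝 0) := by
          refine h.tendsto.comp (tendsto_atTop_add_const_left _ _ ?_)
          exact tendsto_inv_nhdsGT_zero.congr fun t => (one_div t).symm
        have hs : 𝓝 (0 : ℝ) = 𝓝[≤] 0 ⊔ 𝓝[>] 0 := (nhdsLE_sup_nhdsGT 0).symm
        nth_rw 1 [hs]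
        refine tendsto_sup.2 ⟨?_, ?_⟩
        · exact tendsto_const_nhds.congr' (eventually_nhdsWithin_of_forall fun t ht =>
            (if_pos (mem_Iic.1 ht)).symm)
        · exact h2.congr' (eventually_nhdsWithin_of_forall fun t ht =>
            (if_neg (not_le.2 (mem_Ioi.1 ht))).symm)
      have hm2 : Tendsto (fun p : ℝ × ℝ => m' p.2) (𝓝[Icc 0 1 ×ˢ Icc 0 1] (σ, 0)) (𝓝 0) :=
        hm'.comp ((continuous_snd.tendsto (σ, (0 : ℝ))).mono_left nhdsWithin_le_nhds)
      refine squeeze_zero' (.of_forall fun _ => norm_nonneg _) ?_ hm2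
      filter_upwards [self_mem_nhdsWithin] with p hp
      by_cases hp0 : p.2 ≤ 0
      · simp [A, m', hp0]
      · simp only [A, m', hp0, if_false]
        exact h.bound _ hp.1 _ (hge _ (not_le.1 hp0) hp.2.2)
    · have h1 : ContinuousWithinAt (fun p : ℝ × ℝ => alpha a b (swept η p.1 (x - 1 + 1 / p.2)))
          (Icc 0 1 ×ˢ Ioc 0 1) (σ, τ) := by
        refine ContinuousWithinAt.comp (f := fun p : ℝ × ℝ => (p.1, x - 1 + 1 / p.2)) (x := (σ, τ))
          (t := Icc 0 1 ×ˢ Ici x)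
          (h.continuousOn_alpha (σ, x - 1 + 1 / τ) ⟨hσ, hge _ h0 hτ.2⟩) ?_ fun p hp =>
          ⟨hp.1, hge _ hp.2.1 hp.2.2⟩
        refine ContinuousAt.continuousWithinAt ?_
        refine continuousAt_fst.prodMk (continuousAt_const.add ?_)
        exact continuousAt_const.div continuousAt_snd h0.ne'
      have hn : ∀ᶠ p in 𝓝 ((σ, τ) : ℝ × ℝ), 0 < p.2 :=
        continuousAt_snd.eventually (lt_mem_nhds h0)
      have h2 : ContinuousWithinAt (fun p : ℝ × ℝ => alpha a b (swept η p.1 (x - 1 + 1 / p.2)))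
          (Icc 0 1 ×ˢ Icc 0 1) (σ, τ) := by
        refine h1.mono_of_mem_nhdsWithin ?_
        filter_upwards [self_mem_nhdsWithin, nhdsWithin_le_nhds hn] with p hp hp0
        exact ⟨hp.1, hp0, hp.2.2⟩
      refine h2.congr_of_eventuallyEq ?_ (if_neg (not_le.2 h0))
      filter_upwards [nhdsWithin_le_nhds hn] with p hp0
      exact if_neg (not_le.2 hp0)
  let O : Set ((ℂ × ℝ) × ℝ) := {p | 0 ≤ p.1.1.im ∧ p.1.1 ≠ μ ∧ p.1.2 ∈ Icc (0 : ℝ) 1 ∧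
    p.2 ∈ Icc (0 : ℝ) 1 ∧ ∀ θ ∈ Icc 0 p.2, p.1.1 ≠ A (p.1.2, θ)}
  have hOA : ∀ p ∈ O, (p.1.2, p.2) ∈ (Icc 0 1 ×ˢ Icc 0 1 : Set (ℝ × ℝ)) := fun p hp =>
    ⟨hp.2.2.1, hp.2.2.2.1⟩
  obtain ⟨r, hrc, hrsq, hr0⟩ := exists_sqrt_of_starLike (O := O)
    (q := fun p => p.1.1 - A (p.1.2, p.2)) (r₀ := fun y => upperSqrt (y.1 - μ))
    (by
      rintro ⟨⟨z, σ⟩, τ⟩ ⟨h1, h2, h3, h4, h5⟩ θ hθ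
      have hle : θ * τ ≤ τ := mul_le_of_le_one_left h4.1 hθ.2
      exact ⟨h1, h2, h3, ⟨mul_nonneg hθ.1 h4.1, hle.trans h4.2⟩,
        fun θ' hθ' => h5 θ' ⟨hθ'.1, hθ'.2.trans hle⟩⟩)
    (by
      refine ContinuousOn.sub (by fun_prop) (hAc.comp (by fun_prop) hOA))
    (by
      rintro p ⟨h1, h2, h3, h4, h5⟩
      exact sub_ne_zero.2 (h5 p.2 ⟨h4.1, le_rfl⟩))
    (by
      refine continuousOn_upperSqrt.comp (by fun_prop) fun p hp => ?_
      simpa using hp.1)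
    (by
      intro p hp
      rw [upperSqrt_sq]
      simp [A])
  have htau : ∀ t ≥ x, 0 < 1 / (t - x + 1) ∧ 1 / (t - x + 1) ≤ 1 := fun t ht => by
    have : 1 ≤ t - x + 1 := by linarith [show x ≤ t from ht]
    exact ⟨by positivity, by rw [div_le_one (by linarith)]; exact this⟩
  have hinv : ∀ t ≥ x, x - 1 + 1 / (1 / (t - x + 1)) = t := fun t _ => by
    rw [one_div_one_div]; ring
  have hmem : ∀ p ∈ rootDom a b η μ x, ((p.1, p.2.1), 1 / (p.2.2 - x + 1)) ∈ O := by
    rintro ⟨z, σ, t⟩ ⟨h1, h2, h3, h4, h5⟩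
    simp only at h1 h2 h3 h4 h5
    refine ⟨h1, h2, h3, ⟨(htau t h4).1.le, (htau t h4).2⟩, fun θ hθ => ?_⟩
    simp only [A]
    split_ifs with h0
    · exact h2
    · push Not at h0
      refine h5 _ ?_
      have h6 : 1 / (1 / (t - x + 1)) ≤ 1 / θ := one_div_le_one_div_of_le h0 hθ.2
      have := hinv t h4
      simp only [ge_iff_le]
      linarith
  -- The value `0` at `z = α`, a point outside `rootDom`, keeps the square identity valid at the
  -- branch point itself.
  refine ⟨fun z σ t => if z = alpha a b (swept η σ t) then 0 else r ((z, σ), 1 / (t - x + 1)),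
    ?_, ?_, ?_, fun σ t => if_pos rfl⟩
  · have hc : ContinuousOn (fun p : ℂ × ℝ × ℝ => r ((p.1, p.2.1), 1 / (p.2.2 - x + 1)))
        (rootDom a b η μ x) := by
      refine hrc.comp ?_ hmem
      refine ContinuousOn.prodMk (by fun_prop) (continuousOn_const.div (by fun_prop) ?_)
      intro p hp
      have : x ≤ p.2.2 := hp.2.2.2.1
      linarith
    refine hc.congr fun p hp => if_neg (hp.2.2.2.2 _ le_rfl)
  · intro p hp
    rw [if_neg (hp.2.2.2.2 _ le_rfl), hrsq _ (hmem p hp)]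
    simp only [A]
    rw [if_neg (not_le.2 (htau _ hp.2.2.2.1).1), hinv _ hp.2.2.2.1]
  · intro z hz hzμ σ hσ
    have h0 : ((z, σ), (0 : ℝ)) ∈ O := by
      refine ⟨hz, hzμ, hσ, by simp, fun θ hθ => ?_⟩
      simp only [A]
      rw [if_pos hθ.2]
      exact hzμ
    obtain ⟨t₁, ht₁⟩ := eventually_atTop.1 ((h.tendsto_alpha hσ).eventually_ne hzμ.symm)
    have hev : ∀ᶠ t in atTop, (z, σ, t) ∈ rootDom a b η μ x := by
      filter_upwards [eventually_ge_atTop x, eventually_ge_atTop t₁] with t h1 h2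
      exact ⟨hz, hzμ, hσ, h1, fun t' ht' => (ht₁ t' (h2.trans ht')).symm⟩
    have hτ : Tendsto (fun t : ℝ => (((z, σ), 1 / (t - x + 1)) : (ℂ × ℝ) × ℝ)) atTop
        (𝓝[O] ((z, σ), 0)) := by
      refine tendsto_nhdsWithin_iff.2 ⟨?_, hev.mono fun t ht => hmem _ ht⟩
      refine tendsto_const_nhds.prodMk_nhds ?_
      refine tendsto_const_nhds.div_atTop ?_
      exact tendsto_atTop_add_const_right _ _ (tendsto_atTop_add_const_right _ _ tendsto_id)
    have := (hrc _ h0).tendsto.comp hτ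
    rw [hr0 _ h0] at this
    refine this.congr' ?_
    filter_upwards [hev] with t ht
    exact (if_neg (ht.2.2.2.2 _ le_rfl)).symm

end IsSwept

/-! ### The radical on the swept region -/

/-- The radical `R(y, z)` at `y = t + i σ η(t)`. -/
noncomputable def sweptRadical (a b : ℂ → ℂ) (η : ℝ → ℝ) (U : ℂ → ℝ → ℝ → ℂ) (z : ℂ) (σ t : ℝ) : ℂ :=
  -U z σ t * upperSqrt (z - alphaTilde a b (swept η σ t))

theorem norm_add_radical_le_of_near {w r c d : ℂ} {M : ℝ} (hw : ‖w‖ ≤ 4 * M)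
    (hc : ‖c‖ ≤ M) (hd : ‖d‖ ≤ M) (hr : r ^ 2 = (w - c) * (w - d)) : ‖w + r‖ ≤ 9 * M := by
  have hM : 0 ≤ M := (norm_nonneg c).trans hc
  have h1 : ‖r‖ ^ 2 ≤ (5 * M) ^ 2 := by
    rw [← norm_pow, hr, norm_mul, sq]
    have e1 : ‖w - c‖ ≤ 5 * M := (norm_sub_le _ _).trans (by linarith)
    have e2 : ‖w - d‖ ≤ 5 * M := (norm_sub_le _ _).trans (by linarith)
    gcongr
  have h2 : ‖r‖ ≤ 5 * M := abs_le_of_sq_le_sq' h1 (by linarith) |>.2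
  linarith [norm_add_le w r]

/-- For `|w| > 4M` the quotient `r / (-w)` has its square within distance less than `1` of `1` on
the whole ray and tends to `1`, so it stays in the right half-plane and is itself as close to `1` as
its square. -/
theorem norm_add_radical_le_of_far {w : ℂ} {r c d : ℝ → ℂ} {M t : ℝ} (hw : 4 * M < ‖w‖)
    (hc : ∀ s ≥ t, ‖c s‖ ≤ M) (hd : ∀ s ≥ t, ‖d s‖ ≤ M)
    (hrc : ContinuousOn r (Ici t)) (hr : ∀ s ≥ t, r s ^ 2 = (w - c s) * (w - d s))
    (hlim : Tendsto r atTop (𝓝 (-w))) : ‖w + r t‖ ≤ 9 * M := by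
  have hM : 0 ≤ M := (norm_nonneg _).trans (hc t le_rfl)
  have hw0 : 0 < ‖w‖ := by linarith
  have hw1 : w ≠ 0 := norm_pos_iff.1 hw0
  -- `9/4 = 1/4 + 1 + 1`: the term `cd/w` is at most `M/4`. The far case thus gives `9M/4`; the
  -- constant `9 = 4 + 5` comes from the near case.
  have key : ∀ s ≥ t, ‖(r s / -w) ^ 2 - 1‖ ≤ (9 / 4) * M / ‖w‖ := by
    intro s hs
    have e : (r s / -w) ^ 2 - 1 = (c s * d s / w - c s - d s) / w := by
      rw [div_pow, hr s hs]
      field_simp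
      ring
    rw [e, norm_div]
    gcongr
    have e1 : ‖c s * d s / w‖ ≤ M / 4 := by
      rw [norm_div, norm_mul, div_le_iff₀ hw0]
      nlinarith [hc s hs, hd s hs, norm_nonneg (c s), norm_nonneg (d s),
        mul_le_mul (hc s hs) (hd s hs) (norm_nonneg _) hM]
    calc ‖c s * d s / w - c s - d s‖ ≤ ‖c s * d s / w‖ + ‖c s‖ + ‖d s‖ :=
          (norm_sub_le _ _).trans (by linarith [norm_sub_le (c s * d s / w) (c s)])
      _ ≤ 9 / 4 * M := by linarith [hc s hs, hd s hs]
  have hlt : (9 / 4) * M / ‖w‖ < 1 := by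
    rw [div_lt_one hw0]; linarith
  have hlim1 : Tendsto (fun s => r s / -w) atTop (𝓝 1) := by
    have := hlim.div_const (-w)
    rwa [div_self (neg_ne_zero.2 hw1)] at this
  have hre : ∀ᶠ s in atTop, 0 < (r s / -w).re :=
    ((Complex.continuous_re.tendsto 1).comp hlim1).eventually (lt_mem_nhds (by simp))
  obtain ⟨s₀, hs₀, hs₀t⟩ := (hre.and (eventually_ge_atTop t)).exists
  have hpos := re_pos_of_sq_near_one isPreconnected_Ici (hrc.div_const (-w))
    (fun s hs => (key s hs).trans_lt hlt) hs₀t hs₀ (self_mem_Ici (a := t))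
  have h1 := (norm_sub_one_le_of_re_pos hpos).trans (key t le_rfl)
  have e : w + r t = -w * (r t / -w - 1) := by field_simp; ring
  rw [e, norm_mul, norm_neg]
  calc ‖w‖ * ‖r t / -w - 1‖ ≤ ‖w‖ * ((9 / 4) * M / ‖w‖) := by gcongr
    _ = (9 / 4) * M := by field_simp
    _ ≤ 9 * M := by linarith

variable {U : ℂ → ℝ → ℝ → ℂ}

theorem rootDom_mono {z : ℂ} {σ t t' : ℝ} (hp : (z, σ, t) ∈ rootDom a b η μ x) (ht : t ≤ t') :
    (z, σ, t') ∈ rootDom a b η μ x :=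
  ⟨hp.1, hp.2.1, hp.2.2.1, hp.2.2.2.1.trans ht, fun s hs => hp.2.2.2.2 s (ht.trans hs)⟩

theorem sweptRadical_sq (hU : IsRoot a b η μ x U) {z : ℂ} {σ t : ℝ}
    (hp : (z, σ, t) ∈ rootDom a b η μ x ∨ z = alpha a b (swept η σ t)) :
    sweptRadical a b η U z σ t ^ 2 =
      (z - alpha a b (swept η σ t)) * (z - alphaTilde a b (swept η σ t)) := by
  rcases hp with hp | hp
  · rw [sweptRadical, mul_pow, neg_sq, hU.sq _ hp, upperSqrt_sq]
  · subst hp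
    rw [sweptRadical, hU.zero]
    simp

section
variable (h : IsSwept a b η μ x T m W) (hU : IsRoot a b η μ x U)
include h hU

theorem continuousOn_sweptRadical :
    ContinuousOn (fun p : ℂ × ℝ × ℝ => sweptRadical a b η U p.1 p.2.1 p.2.2)
      (rootDom a b η μ x) := by
  have hB : ContinuousOn (fun p : ℂ × ℝ × ℝ => alphaTilde a b (swept η p.2.1 p.2.2))
      (rootDom a b η μ x) :=
    h.continuousOn_tilde.comp (f := fun p : ℂ × ℝ × ℝ => p.2) (by fun_prop) fun p hp =>
      ⟨hp.2.2.1, hp.2.2.2.1⟩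
  refine hU.cont.neg.mul (continuousOn_upperSqrt.comp (continuousOn_fst.sub hB) fun p hp => ?_)
  have := h.lower _ (h.mem _ hp.2.2.1 _ hp.2.2.2.1)
  have h1 := hp.1
  simp only [mem_ofPred, Complex.sub_im]
  linarith

theorem tendsto_sweptRadical {z : ℂ} (hz : 0 ≤ z.im) (hzμ : z ≠ μ) {σ : ℝ}
    (hσ : σ ∈ Icc (0 : ℝ) 1) :
    Tendsto (sweptRadical a b η U z σ) atTop (𝓝 (-(z - μ))) := by
  have h1 : Tendsto (fun t => upperSqrt (z - alphaTilde a b (swept η σ t))) atTop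
      (𝓝 (upperSqrt (z - μ))) := by
    have h2 := continuousOn_upperSqrt (z - μ) (by simpa using hz)
    refine h2.tendsto.comp (tendsto_nhdsWithin_iff.2 ⟨tendsto_const_nhds.sub (h.tendsto_tilde hσ), ?_⟩)
    filter_upwards [eventually_ge_atTop x] with t ht
    have := h.lower _ (h.mem _ hσ _ ht)
    rw [Complex.sub_im]
    linarith
  have h3 := (hU.lim z hz hzμ σ hσ).neg.mul h1
  rwa [neg_mul, ← sq, upperSqrt_sq] at h3

/-- The start `t₀` may be a point with `α = z`. It lies outside `rootDom`, but the radical tends to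
zero there because its square does. -/
theorem continuousOn_sweptRadical_slice {z : ℂ} (hz : 0 ≤ z.im) (hzμ : z ≠ μ) {σ : ℝ}
    (hσ : σ ∈ Icc (0 : ℝ) 1) {t₀ : ℝ} (ht₀ : x ≤ t₀)
    (hne : ∀ t > t₀, z ≠ alpha a b (swept η σ t)) :
    ContinuousOn (sweptRadical a b η U z σ) (Ici t₀) := by
  have hmem : ∀ t > t₀, (z, σ, t) ∈ rootDom a b η μ x := fun t ht =>
    ⟨hz, hzμ, hσ, ht₀.trans (le_of_lt ht), fun s hs => hne s (lt_of_lt_of_le ht hs)⟩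
  have hsl : ∀ S : Set ℝ, (∀ t ∈ S, (z, σ, t) ∈ rootDom a b η μ x) →
      ContinuousOn (sweptRadical a b η U z σ) S := fun S hS =>
    (continuousOn_sweptRadical h hU).comp (f := fun t => (z, σ, t)) (by fun_prop) hS
  by_cases h0 : z = alpha a b (swept η σ t₀)
  · intro t ht
    rcases eq_or_lt_of_le (mem_Ici.1 ht) with h1 | h1
    · subst h1
      have hv : sweptRadical a b η U z σ t₀ = 0 := by
        rw [h0, sweptRadical, hU.zero]; simp
      rw [ContinuousWithinAt, hv]
      refine tendsto_zero_of_sq ?_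
      have hq : ContinuousWithinAt (fun t => (z - alpha a b (swept η σ t)) *
          (z - alphaTilde a b (swept η σ t))) (Ici t₀) t₀ := by
        have e1 := h.continuousOn_alpha.comp (f := fun t => (σ, t)) (s := Ici t₀) (by fun_prop)
          fun t ht => ⟨hσ, ht₀.trans (mem_Ici.1 ht)⟩
        have e2 := h.continuousOn_tilde.comp (f := fun t => (σ, t)) (s := Ici t₀) (by fun_prop)
          fun t ht => ⟨hσ, ht₀.trans (mem_Ici.1 ht)⟩
        exact ((continuousOn_const.sub e1).mul (continuousOn_const.sub e2)) t₀ self_mem_Ici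
      rw [ContinuousWithinAt, ← h0, sub_self, zero_mul] at hq
      refine hq.congr' ?_
      filter_upwards [self_mem_nhdsWithin] with t ht
      rw [sweptRadical_sq hU]
      rcases eq_or_lt_of_le (mem_Ici.1 ht) with h2 | h2
      · subst h2; exact Or.inr h0
      · exact Or.inl (hmem t h2)
    · exact ((hsl (Ioi t₀) fun t ht => hmem t ht) t h1).mono_of_mem_nhdsWithin
        (mem_nhdsWithin_of_mem_nhds (Ioi_mem_nhds h1))
  · refine hsl _ fun t ht => ⟨hz, hzμ, hσ, ht₀.trans ht, fun s hs => ?_⟩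
    rcases eq_or_lt_of_le (show t₀ ≤ s from le_trans ht hs) with h1 | h1
    · subst h1; exact h0
    · exact hne s h1

/-- The majorant decreases, so `M = m t` controls the whole tail beyond `t`. The bound does not
involve `z` and is what permits dominated convergence everywhere below. -/
theorem norm_add_sweptRadical_le {z : ℂ} (hz : 0 ≤ z.im) (hzμ : z ≠ μ) {σ t : ℝ}
    (hσ : σ ∈ Icc (0 : ℝ) 1) (ht : x ≤ t)
    (hp : (z, σ, t) ∈ rootDom a b η μ x ∨ z = alpha a b (swept η σ t)) :
    ‖z - μ + sweptRadical a b η U z σ t‖ ≤ 9 * m t := by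
  have hsq : ∀ {s}, ((z, σ, s) ∈ rootDom a b η μ x ∨ z = alpha a b (swept η σ s)) →
      sweptRadical a b η U z σ s ^ 2 = (z - μ - (alpha a b (swept η σ s) - μ)) *
        (z - μ - (alphaTilde a b (swept η σ s) - μ)) := fun hs => by
    rw [sweptRadical_sq hU hs]; ring
  rcases le_or_gt ‖z - μ‖ (4 * m t) with h1 | h1
  · exact norm_add_radical_le_of_near h1 (h.bound σ hσ t ht) (h.bound' σ hσ t ht) (hsq hp)
  · have hle : ∀ s ≥ t, m s ≤ m t := fun s hs => h.anti ht (ht.trans hs) hs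
    -- A far point is not met beyond `t`, since `|α - μ| ≤ m t` there.
    have hne : ∀ s ≥ t, z ≠ alpha a b (swept η σ s) := by
      intro s hs he
      have h2 := h.bound σ hσ s (ht.trans hs)
      rw [← he] at h2
      linarith [hle s hs, h.m_nonneg ht]
    have hmem : (z, σ, t) ∈ rootDom a b η μ x := ⟨hz, hzμ, hσ, ht, hne⟩
    refine norm_add_radical_le_of_far (c := fun s => alpha a b (swept η σ s) - μ)
      (d := fun s => alphaTilde a b (swept η σ s) - μ) h1
      (fun s hs => (h.bound σ hσ s (ht.trans hs)).trans (hle s hs))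
      (fun s hs => (h.bound' σ hσ s (ht.trans hs)).trans (hle s hs))
      (continuousOn_sweptRadical_slice h hU hz hzμ hσ ht fun s hs => hne s (le_of_lt hs))
      (fun s hs => hsq (Or.inl (rootDom_mono hmem hs))) ?_
    exact tendsto_sweptRadical h hU hz hzμ hσ

end
end

/-! ### Integrals along the contours -/

theorem isCompact_insert_image_Ici {Y : Type*} [TopologicalSpace Y] {c : ℝ → Y} {s : ℝ} {y : Y}
    (hc : ContinuousOn c (Ici s))
    (hy : Tendsto c atTop (𝓝 y)) : IsCompact (insert y (c '' Ici s)) := by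
  have h1 : Continuous fun t : ℝ => c (s + |t|) :=
    hc.comp_continuous (by fun_prop) fun t => by simp
  have h2 : Tendsto (fun t : ℝ => c (s + |t|)) (cocompact ℝ) (𝓝 y) := by
    refine hy.comp (tendsto_atTop_add_const_left _ _ ?_)
    exact tendsto_norm_cocompact_atTop.congr Real.norm_eq_abs
  convert h2.isCompact_insert_range_of_cocompact h1 using 2
  ext w
  constructor
  · rintro ⟨t, ht, rfl⟩
    exact ⟨t - s, by simp [abs_of_nonneg (sub_nonneg.2 (mem_Ici.1 ht))]⟩
  · rintro ⟨t, rfl⟩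
    exact ⟨s + |t|, by simp, rfl⟩

/-- Green's formula on a rectangle: by the fundamental theorem both sides are the double integral of
the common mixed derivative `K`, in the two orders. -/
theorem integral_rectangle_eq {F G K : ℝ → ℝ → ℂ} {s T : ℝ} (hsT : s ≤ T)
    (hK : ContinuousOn (fun p : ℝ × ℝ => K p.1 p.2) (Icc 0 1 ×ˢ Icc s T))
    (hFc : ∀ t ∈ Icc s T, ContinuousOn (fun σ => F σ t) (Icc 0 1))
    (hF : ∀ t ∈ Icc s T, ∀ σ ∈ Ioo (0 : ℝ) 1, HasDerivAt (fun σ => F σ t) (K σ t) σ)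
    (hGc : ∀ σ ∈ Icc (0 : ℝ) 1, ContinuousOn (fun t => G σ t) (Icc s T))
    (hG : ∀ σ ∈ Icc (0 : ℝ) 1, ∀ t ∈ Ioo s T, HasDerivAt (fun t => G σ t) (K σ t) t) :
    ∫ t in s..T, (F 1 t - F 0 t) = ∫ σ in (0 : ℝ)..1, (G σ T - G σ s) := by
  have e1 : ∀ t ∈ uIcc s T, F 1 t - F 0 t = ∫ σ in (0 : ℝ)..1, K σ t := by
    intro t ht
    rw [uIcc_of_le hsT] at ht
    refine (intervalIntegral.integral_eq_sub_of_hasDerivAt_of_le zero_le_one (hFc t ht) (hF t ht)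
      (ContinuousOn.intervalIntegrable_of_Icc zero_le_one ?_)).symm
    exact hK.comp (f := fun σ => (σ, t)) (by fun_prop) fun σ hσ => ⟨hσ, ht⟩
  have e2 : ∀ σ ∈ uIcc (0 : ℝ) 1, G σ T - G σ s = ∫ t in s..T, K σ t := by
    intro σ hσ
    rw [uIcc_of_le zero_le_one] at hσ
    refine (intervalIntegral.integral_eq_sub_of_hasDerivAt_of_le hsT (hGc σ hσ) (hG σ hσ)
      (ContinuousOn.intervalIntegrable_of_Icc hsT ?_)).symm
    exact hK.comp (f := fun t => (σ, t)) (by fun_prop) fun t ht => ⟨hσ, ht⟩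
  rw [intervalIntegral.integral_congr e1, intervalIntegral.integral_congr e2]
  simp only [intervalIntegral.integral_of_le hsT, intervalIntegral.integral_of_le zero_le_one]
  rw [integral_integral_swap (f := fun σ t => K σ t)]
  rw [Measure.prod_restrict]
  exact (hK.integrableOn_compact (isCompact_Icc.prod isCompact_Icc)).mono_set
    (prod_mono Ioc_subset_Icc_self Ioc_subset_Icc_self)

/-- The velocity of the contour `t + i σ η(t)`. -/
noncomputable def sweptVel (η : ℝ → ℝ) (σ t : ℝ) : ℂ := 1 + Complex.I * (σ * deriv η t : ℝ)

section
variable {a b : ℂ → ℂ} {η : ℝ → ℝ} {μ x T : ℝ} {m : ℝ → ℝ} {W : Set ℂ}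
  {U : ℂ → ℝ → ℝ → ℂ}

theorem hasDerivAt_swept (hη : ContDiff ℝ 1 η) (σ t : ℝ) :
    HasDerivAt (swept η σ) (sweptVel η σ t) t := by
  have h1 : HasDerivAt (fun t => σ * η t) (σ * deriv η t) t :=
    ((hη.differentiable one_ne_zero t).hasDerivAt).const_mul σ
  exact (Complex.ofRealCLM.hasDerivAt (x := t)).add (h1.ofReal_comp.const_mul Complex.I)

theorem hasDerivAt_swept_left (η : ℝ → ℝ) (σ t : ℝ) :
    HasDerivAt (fun σ => swept η σ t) (Complex.I * η t) σ := by
  have h1 : HasDerivAt (fun σ => σ * η t) (η t) σ := by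
    simpa using (hasDerivAt_id σ).mul_const (η t)
  simpa [swept] using (h1.ofReal_comp.const_mul Complex.I).const_add (t : ℂ)

theorem deriv_graphContour (hη : ContDiff ℝ 1 η) (t : ℝ) :
    deriv (graphContour η) t = sweptVel η 1 t := by
  rw [← swept_one]; exact (hasDerivAt_swept hη 1 t).deriv

theorem sweptVel_zero (η : ℝ → ℝ) (t : ℝ) : sweptVel η 0 t = 1 := by
  simp [sweptVel]

theorem continuous_sweptVel (hη : ContDiff ℝ 1 η) :
    Continuous (fun p : ℝ × ℝ => sweptVel η p.1 p.2) := by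
  have := hη.continuous_deriv le_rfl
  unfold sweptVel; fun_prop

theorem deriv_eq_zero_of_tail (hη : ContDiff ℝ 1 η) (ht : ∀ t ≥ T, η t = 0) {t : ℝ} (h : T ≤ t) :
    deriv η t = 0 := by
  rcases eq_or_lt_of_le h with rfl | h
  · have h1 : ∀ s ∈ Ioi T, deriv η s = 0 := fun s hs => by
      have : η =ᶠ[𝓝 s] fun _ => 0 := by
        filter_upwards [Ioi_mem_nhds hs] with u hu using ht u (le_of_lt hu)
      rw [this.deriv_eq, deriv_const]
    have h2 := (hη.continuous_deriv le_rfl).continuousWithinAt (s := Ioi T) (x := T)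
    refine tendsto_nhds_unique h2.tendsto (tendsto_const_nhds.congr' ?_)
    exact eventually_nhdsWithin_of_forall fun s hs => (h1 s hs).symm
  · have : η =ᶠ[𝓝 t] fun _ => 0 := by
      filter_upwards [Ioi_mem_nhds h] with u hu using ht u (le_of_lt hu)
    rw [this.deriv_eq, deriv_const]

/-- The integrand `(z - μ + R(y, z)) dy` along the contour `y = t + i σ η(t)`. -/
noncomputable def sweptIntegrand (a b : ℂ → ℂ) (η : ℝ → ℝ) (μ : ℝ) (U : ℂ → ℝ → ℝ → ℂ) (z : ℂ)
    (σ t : ℝ) : ℂ :=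
  (z - μ + sweptRadical a b η U z σ t) * sweptVel η σ t

/-- The points `z` of the closed upper half-plane that `α` does not meet on the part of the contour
beyond `s`. -/
def slitDom (a b : ℂ → ℂ) (η : ℝ → ℝ) (μ σ s : ℝ) : Set ℂ :=
  {z | 0 ≤ z.im ∧ z ∉ insert (μ : ℂ) ((fun t => alpha a b (swept η σ t)) '' Ici s)}

theorem mem_rootDom_of_slitDom {z : ℂ} {σ s t : ℝ} (hz : z ∈ slitDom a b η μ σ s)
    (hσ : σ ∈ Icc (0 : ℝ) 1) (hs : x ≤ s) (ht : s ≤ t) : (z, σ, t) ∈ rootDom a b η μ x := by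
  refine ⟨hz.1, fun h => hz.2 (Or.inl h), hσ, hs.trans ht, fun u hu h => hz.2 (Or.inr ?_)⟩
  exact ⟨u, ht.trans hu, h.symm⟩

theorem slitDom_of_mem_rootDom {z : ℂ} {σ s : ℝ} (hz : (z, σ, s) ∈ rootDom a b η μ x) :
    z ∈ slitDom a b η μ σ s := by
  refine ⟨hz.1, ?_⟩
  rintro (h | ⟨t, ht, h⟩)
  · exact hz.2.1 h
  · exact hz.2.2.2.2 t ht h.symm

section
variable (h : IsSwept a b η μ x T m W)
include h

theorem IsSwept.exists_vel_bound : ∃ V : ℝ, 0 ≤ V ∧ ∀ σ ∈ Icc (0 : ℝ) 1, ∀ t ≥ x,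
    ‖sweptVel η σ t‖ ≤ V := by
  obtain ⟨V, hV⟩ := (isCompact_Icc.prod isCompact_Icc).exists_bound_of_continuousOn
    (continuous_sweptVel h.smooth).continuousOn (s := Icc (0 : ℝ) 1 ×ˢ Icc x T)
  refine ⟨max V 1, by positivity, fun σ hσ t ht => ?_⟩
  rcases le_total t T with h1 | h1
  · exact (hV (σ, t) ⟨hσ, ht, h1⟩).trans (le_max_left _ _)
  · rw [sweptVel, deriv_eq_zero_of_tail h.smooth h.tail h1]
    simp

theorem IsSwept.isCompact_slit {σ s : ℝ} (hσ : σ ∈ Icc (0 : ℝ) 1) (hs : x ≤ s) :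
    IsCompact (insert (μ : ℂ) ((fun t => alpha a b (swept η σ t)) '' Ici s)) := by
  refine isCompact_insert_image_Ici ?_ (h.tendsto_alpha hσ)
  exact h.continuousOn_alpha.comp (f := fun t => (σ, t)) (by fun_prop) fun t ht =>
    ⟨hσ, hs.trans (mem_Ici.1 ht)⟩

theorem IsSwept.isOpen_slitDom {σ s : ℝ} (hσ : σ ∈ Icc (0 : ℝ) 1) (hs : x ≤ s) :
    IsOpen (slitDom a b η μ σ s ∩ {z | 0 < z.im}) := by
  have : slitDom a b η μ σ s ∩ {z | 0 < z.im} =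
      (insert (μ : ℂ) ((fun t => alpha a b (swept η σ t)) '' Ici s))ᶜ ∩ {z | 0 < z.im} := by
    ext z
    constructor
    · rintro ⟨h1, h2⟩; exact ⟨h1.2, h2⟩
    · rintro ⟨h1, h2⟩; exact ⟨⟨le_of_lt h2, h1⟩, h2⟩
  rw [this]
  exact (h.isCompact_slit hσ hs).isClosed.isOpen_compl.inter
    (isOpen_lt continuous_const Complex.continuous_im)

theorem IsSwept.ne_tilde {z : ℂ} (hz : 0 ≤ z.im) {σ t : ℝ} (hσ : σ ∈ Icc (0 : ℝ) 1) (ht : x ≤ t) :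
    z ≠ alphaTilde a b (swept η σ t) := fun h' => by
  have := h.lower _ (h.mem σ hσ t ht)
  rw [← h'] at this
  exact absurd hz (not_le.2 this)

end

section
variable (h : IsSwept a b η μ x T m W) (hU : IsRoot a b η μ x U)
include h hU

theorem norm_sweptIntegrand_le {V : ℝ} (hV : ∀ σ ∈ Icc (0 : ℝ) 1, ∀ t ≥ x, ‖sweptVel η σ t‖ ≤ V)
    {z : ℂ} (hz : 0 ≤ z.im) (hzμ : z ≠ μ) {σ t : ℝ} (hσ : σ ∈ Icc (0 : ℝ) 1) (ht : x ≤ t)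
    (hp : (z, σ, t) ∈ rootDom a b η μ x ∨ z = alpha a b (swept η σ t)) :
    ‖sweptIntegrand a b η μ U z σ t‖ ≤ 9 * m t * V := by
  rw [sweptIntegrand, norm_mul]
  have := h.m_nonneg ht
  gcongr
  · exact norm_add_sweptRadical_le h hU hz hzμ hσ ht hp
  · exact hV σ hσ t ht

theorem continuousOn_sweptIntegrand_slice {z : ℂ} (hz : 0 ≤ z.im) (hzμ : z ≠ μ) {σ : ℝ}
    (hσ : σ ∈ Icc (0 : ℝ) 1) {t₀ : ℝ} (ht₀ : x ≤ t₀)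
    (hne : ∀ t > t₀, z ≠ alpha a b (swept η σ t)) :
    ContinuousOn (sweptIntegrand a b η μ U z σ) (Ici t₀) := by
  refine (continuousOn_const.add
    (continuousOn_sweptRadical_slice h hU hz hzμ hσ ht₀ hne)).mul ?_
  exact ((continuous_sweptVel h.smooth).comp (f := fun t => (σ, t)) (by fun_prop)).continuousOn

theorem integrableOn_sweptIntegrand {z : ℂ} (hz : 0 ≤ z.im) (hzμ : z ≠ μ) {σ : ℝ}
    (hσ : σ ∈ Icc (0 : ℝ) 1) {t₀ : ℝ} (ht₀ : x ≤ t₀)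
    (hne : ∀ t > t₀, z ≠ alpha a b (swept η σ t)) :
    IntegrableOn (sweptIntegrand a b η μ U z σ) (Ioi t₀) := by
  obtain ⟨V, -, hV⟩ := h.exists_vel_bound
  have hm : IntegrableOn (fun t => 9 * m t * V) (Ioi t₀) :=
    ((h.integrable.mono_set (Ioi_subset_Ioi ht₀)).const_mul 9).mul_const V
  refine hm.mono' (((continuousOn_sweptIntegrand_slice h hU hz hzμ hσ ht₀ hne).mono
    Ioi_subset_Ici_self).aestronglyMeasurable measurableSet_Ioi) ?_
  filter_upwards [ae_restrict_mem measurableSet_Ioi] with t ht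
  have ht' : t₀ < t := ht
  exact norm_sweptIntegrand_le h hU hV hz hzμ hσ (ht₀.trans ht'.le)
    (Or.inl ⟨hz, hzμ, hσ, ht₀.trans ht'.le, fun s hs => hne s (ht'.trans_le hs)⟩)

theorem continuousOn_integral_swept {σ s : ℝ} (hσ : σ ∈ Icc (0 : ℝ) 1) (hs : x ≤ s) :
    ContinuousOn (fun z => ∫ t in Ioi s, sweptIntegrand a b η μ U z σ t)
      (slitDom a b η μ σ s) := by
  obtain ⟨V, -, hV⟩ := h.exists_vel_bound
  have hne : ∀ z ∈ slitDom a b η μ σ s, z ≠ μ := fun z hz h' => hz.2 (Or.inl h')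
  refine continuousOn_of_dominated (bound := fun t => 9 * m t * V) (fun z hz => ?_)
    (fun z hz => ?_) ?_ ?_
  · exact ((continuousOn_sweptIntegrand_slice h hU hz.1 (hne z hz) hσ hs fun t ht =>
      (mem_rootDom_of_slitDom hz hσ hs le_rfl).2.2.2.2 t (le_of_lt ht)).mono
      Ioi_subset_Ici_self).aestronglyMeasurable measurableSet_Ioi
  · filter_upwards [ae_restrict_mem measurableSet_Ioi] with t ht
    exact norm_sweptIntegrand_le h hU hV hz.1 (hne z hz) hσ (hs.trans (le_of_lt ht))
      (Or.inl (mem_rootDom_of_slitDom hz hσ hs (le_of_lt ht)))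
  · exact ((h.integrable.mono_set (Ioi_subset_Ioi hs)).const_mul 9).mul_const V
  · filter_upwards [ae_restrict_mem measurableSet_Ioi] with t ht
    refine ((continuousOn_id.sub continuousOn_const).add ?_).mul continuousOn_const
    exact (continuousOn_sweptRadical h hU).comp (f := fun z => (z, σ, t)) (by fun_prop)
      fun z hz => mem_rootDom_of_slitDom hz hσ hs (le_of_lt ht)

theorem differentiableOn_sweptRadical {σ s t : ℝ} (hσ : σ ∈ Icc (0 : ℝ) 1) (hs : x ≤ s)
    (ht : s ≤ t) :
    DifferentiableOn ℂ (fun z => sweptRadical a b η U z σ t)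
      (slitDom a b η μ σ s ∩ {z | 0 < z.im}) := by
  intro z hz
  have hmem : ∀ w ∈ slitDom a b η μ σ s ∩ {z | 0 < z.im}, (w, σ, t) ∈ rootDom a b η μ x :=
    fun w hw => mem_rootDom_of_slitDom hw.1 hσ hs ht
  have hnhds := (h.isOpen_slitDom hσ hs).mem_nhds hz
  have hc : ContinuousAt (fun w => sweptRadical a b η U w σ t) z :=
    ((continuousOn_sweptRadical h hU).comp (f := fun z => (z, σ, t)) (by fun_prop)
      hmem).continuousAt hnhds
  have hq : HasDerivAt (fun w => (w - alpha a b (swept η σ t)) * (w - alphaTilde a b (swept η σ t)))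
      (1 * (z - alphaTilde a b (swept η σ t)) + (z - alpha a b (swept η σ t)) * 1) z :=
    ((hasDerivAt_id z).sub_const _).mul ((hasDerivAt_id z).sub_const _)
  refine (hasDerivAt_of_sq_eq hc hq ?_ ?_).differentiableAt.differentiableWithinAt
  · filter_upwards [hnhds] with w hw
    exact sweptRadical_sq hU (Or.inl (hmem w hw))
  · intro h0
    have h1 := sweptRadical_sq hU (Or.inl (hmem z hz))
    rw [h0, zero_pow two_ne_zero, eq_comm, mul_eq_zero, sub_eq_zero, sub_eq_zero] at h1
    rcases h1 with h1 | h1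
    · exact (hmem z hz).2.2.2.2 t le_rfl h1
    · have h2 := h.lower _ (h.mem σ hσ t (hs.trans ht))
      rw [← h1] at h2
      exact absurd hz.2 (not_lt.2 h2.le)

theorem differentiableOn_integral_swept {σ s : ℝ} (hσ : σ ∈ Icc (0 : ℝ) 1) (hs : x ≤ s) :
    DifferentiableOn ℂ (fun z => ∫ t in Ioi s, sweptIntegrand a b η μ U z σ t)
      (slitDom a b η μ σ s ∩ {z | 0 < z.im}) := by
  obtain ⟨V, -, hV⟩ := h.exists_vel_bound
  have hne : ∀ z ∈ slitDom a b η μ σ s, z ≠ μ := fun z hz h' => hz.2 (Or.inl h')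
  refine differentiableOn_integral_of_bound (M := fun t => 9 * m t * V) measurableSet_Ioi
    (h.isOpen_slitDom hσ hs) ?_ (fun z hz => ?_) (fun t ht => ?_) (fun t ht z hz => ?_)
  · exact ((h.integrable.mono_set (Ioi_subset_Ioi hs)).const_mul 9).mul_const V
  · exact ((continuousOn_sweptIntegrand_slice h hU hz.1.1 (hne z hz.1) hσ hs fun t ht =>
      (mem_rootDom_of_slitDom hz.1 hσ hs le_rfl).2.2.2.2 t (le_of_lt ht)).mono
      Ioi_subset_Ici_self).aestronglyMeasurable measurableSet_Ioi
  · refine DifferentiableOn.mul_const (DifferentiableOn.add (by fun_prop) ?_) _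
    exact differentiableOn_sweptRadical h hU hσ hs (le_of_lt ht)
  · exact norm_sweptIntegrand_le h hU hV hz.1.1 (hne z hz.1) hσ (hs.trans (le_of_lt ht))
      (Or.inl (mem_rootDom_of_slitDom hz.1 hσ hs (le_of_lt ht)))

theorem isRadicalBranch_swept {z : ℂ} (hz : 0 ≤ z.im) (hzμ : z ≠ μ) {σ : ℝ}
    (hσ : σ ∈ Icc (0 : ℝ) 1) {t₀ : ℝ} (ht₀ : x ≤ t₀)
    (hne : ∀ t > t₀, z ≠ alpha a b (swept η σ t)) :
    IsRadicalBranch a b μ (swept η σ) t₀ z (sweptRadical a b η U z σ) := by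
  refine ⟨continuousOn_sweptRadical_slice h hU hz hzμ hσ ht₀ hne, fun t ht => ?_,
    tendsto_sweptRadical h hU hz hzμ hσ⟩
  refine sweptRadical_sq hU ?_
  by_cases h1 : z = alpha a b (swept η σ t)
  · exact Or.inr h1
  · refine Or.inl ⟨hz, hzμ, hσ, ht₀.trans ht, fun s hs => ?_⟩
    rcases eq_or_lt_of_le (show t ≤ s from hs) with h2 | h2
    · subst h2; exact h1
    · exact hne s (lt_of_le_of_lt ht h2)

/-- Beyond `T` every contour is the real axis, and the branch is determined by its behaviour at
`+∞`. -/
theorem sweptRadical_tail {z : ℂ} (hz : 0 ≤ z.im) (hzμ : z ≠ μ) {σ : ℝ}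
    (hσ : σ ∈ Icc (0 : ℝ) 1) {t₀ : ℝ} (ht₀ : T ≤ t₀)
    (hne : ∀ t > t₀, z ≠ alpha a b (swept η σ t)) :
    EqOn (sweptRadical a b η U z σ) (sweptRadical a b η U z 0) (Ici t₀) := by
  have e : ∀ t ≥ t₀, swept η σ t = swept η 0 t := fun t ht => by
    simp [swept, h.tail t (ht₀.trans ht)]
  have hx : x ≤ t₀ := h.le_tail.trans ht₀
  have h0 : (0 : ℝ) ∈ Icc (0 : ℝ) 1 := by simp
  have b1 := isRadicalBranch_swept h hU hz hzμ hσ hx hne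
  have b2 := isRadicalBranch_swept h hU hz hzμ h0 hx fun t ht => by
    rw [← e t (le_of_lt ht)]; exact hne t ht
  have b1' : IsRadicalBranch a b μ (swept η 0) t₀ z (sweptRadical a b η U z σ) :=
    ⟨b1.1, fun t ht => by rw [b1.2.1 t ht, e t ht], b1.2.2⟩
  refine radicalBranch_unique b1' b2 hzμ fun t ht => ⟨?_, ?_⟩
  · rw [← e t (le_of_lt ht)]; exact hne t ht
  · exact h.ne_tilde hz h0 (hx.trans (le_of_lt ht))

/-- Deformation of the contour to the real axis. -/
theorem integral_swept_sub {z : ℂ} {s : ℝ}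
    (hmem : ∀ σ ∈ Icc (0 : ℝ) 1, (z, σ, s) ∈ rootDom a b η μ x) :
    (∫ t in Ioi s, sweptIntegrand a b η μ U z 1 t) - ∫ t in Ioi s, sweptIntegrand a b η μ U z 0 t =
      -∫ σ in (0 : ℝ)..1, (z - μ + sweptRadical a b η U z σ s) * (Complex.I * η s) := by
  have h01 : (0 : ℝ) ∈ Icc (0 : ℝ) 1 := by simp
  have h11 : (1 : ℝ) ∈ Icc (0 : ℝ) 1 := by simp
  have hz : 0 ≤ z.im := (hmem 0 h01).1
  have hzμ : z ≠ μ := (hmem 0 h01).2.1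
  have hs : x ≤ s := (hmem 0 h01).2.2.2.1
  have hne : ∀ σ ∈ Icc (0 : ℝ) 1, ∀ t ≥ s, z ≠ alpha a b (swept η σ t) := fun σ hσ =>
    (hmem σ hσ).2.2.2.2
  have hdom : ∀ σ ∈ Icc (0 : ℝ) 1, ∀ t ≥ s, (z, σ, t) ∈ rootDom a b η μ x := fun σ hσ t ht =>
    rootDom_mono (hmem σ hσ) ht
  -- Beyond `T'` the two contours coincide, so only a rectangle has to be compared.
  set T' := max s T
  have hsT : s ≤ T' := le_max_left _ _
  let Q : ℂ → ℂ := fun y => (z - alpha a b y) * (z - alphaTilde a b y)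
  have hQd : DifferentiableOn ℂ Q W :=
    ((differentiableOn_const z).sub h.diff_alpha).mul ((differentiableOn_const z).sub h.diff_tilde)
  have hQ' : ∀ y ∈ W, HasDerivAt Q (deriv Q y) y := fun y hy =>
    (hQd.differentiableAt (h.isOpen.mem_nhds hy)).hasDerivAt
  have hRc : ContinuousOn (fun p : ℝ × ℝ => sweptRadical a b η U z p.1 p.2)
      (Icc 0 1 ×ˢ Ici s) :=
    (continuousOn_sweptRadical h hU).comp (f := fun p : ℝ × ℝ => (z, p.1, p.2)) (by fun_prop)
      fun p hp => hdom p.1 hp.1 p.2 hp.2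
  have hRsq : ∀ σ ∈ Icc (0 : ℝ) 1, ∀ t ≥ s,
      sweptRadical a b η U z σ t ^ 2 = Q (swept η σ t) := fun σ hσ t ht =>
    sweptRadical_sq hU (Or.inl (hdom σ hσ t ht))
  have hR0 : ∀ σ ∈ Icc (0 : ℝ) 1, ∀ t ≥ s, sweptRadical a b η U z σ t ≠ 0 := by
    intro σ hσ t ht h0
    have := hRsq σ hσ t ht
    rw [h0, zero_pow two_ne_zero, eq_comm, mul_eq_zero, sub_eq_zero, sub_eq_zero] at this
    rcases this with h1 | h1
    · exact hne σ hσ t ht h1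
    · exact h.ne_tilde hz hσ (hs.trans ht) h1
  have hW : ∀ σ ∈ Icc (0 : ℝ) 1, ∀ t ≥ s, swept η σ t ∈ W := fun σ hσ t ht =>
    h.mem σ hσ t (hs.trans ht)
  -- The form `(z - μ + R) dy` is closed: the `σ`-derivative of its `t`-component and the
  -- `t`-derivative of its `σ`-component agree, as `R` is holomorphic in `y` and mixed derivatives
  -- of the contour commute.
  let K : ℝ → ℝ → ℂ := fun σ t =>
    deriv Q (swept η σ t) * (Complex.I * η t) * sweptVel η σ t /
      (2 * sweptRadical a b η U z σ t) +
      (z - μ + sweptRadical a b η U z σ t) * (Complex.I * deriv η t)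
  have hηd := h.smooth.continuous_deriv le_rfl
  have hηc := h.smooth.continuous
  have hvc := continuous_sweptVel h.smooth
  have key := integral_rectangle_eq (F := fun σ t => sweptIntegrand a b η μ U z σ t)
    (G := fun σ t => (z - μ + sweptRadical a b η U z σ t) * (Complex.I * η t)) (K := K) hsT
    (by
      have hR := hRc.mono (prod_mono_right (s := Icc (0 : ℝ) 1) (fun t ht => (mem_Icc.1 ht).1 : Icc s T' ⊆ Ici s))
      refine ContinuousOn.add (ContinuousOn.div (ContinuousOn.mul (ContinuousOn.mul ?_ ?_) ?_) ?_ ?_)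
        (ContinuousOn.mul ?_ ?_)
      · exact (hQd.deriv h.isOpen).continuousOn.comp
          (continuous_swept hηc).continuousOn fun p hp => hW p.1 hp.1 p.2 hp.2.1
      · fun_prop
      · exact hvc.continuousOn
      · exact continuousOn_const.mul hR
      · intro p hp
        exact mul_ne_zero two_ne_zero (hR0 p.1 hp.1 p.2 hp.2.1)
      · exact continuousOn_const.add hR
      · fun_prop)
    (by
      intro t ht
      refine ContinuousOn.mul (continuousOn_const.add ?_) ?_
      · exact hRc.comp (f := fun σ => (σ, t)) (by fun_prop) fun σ hσ => ⟨hσ, ht.1⟩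
      · exact (hvc.comp (f := fun σ => (σ, t)) (by fun_prop)).continuousOn)
    (by
      intro t ht σ hσ
      have hσ' := Ioo_subset_Icc_self hσ
      have hc : ContinuousAt (fun σ => sweptRadical a b η U z σ t) σ :=
        (hRc.comp (f := fun σ => (σ, t)) (s := Icc 0 1) (by fun_prop)
          fun σ hσ => ⟨hσ, ht.1⟩).continuousAt (Icc_mem_nhds hσ.1 hσ.2)
      have hq : HasDerivAt (fun σ => Q (swept η σ t))
          (deriv Q (swept η σ t) * (Complex.I * η t)) σ :=
        HasDerivAt.comp (h₂ := Q) (h := fun σ => swept η σ t) σ (hQ' _ (hW σ hσ' t ht.1)) (hasDerivAt_swept_left η σ t)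
      have hr := hasDerivAt_of_sq_eq hc hq (by
        filter_upwards [Icc_mem_nhds hσ.1 hσ.2] with σ' h1 using hRsq σ' h1 t ht.1)
        (hR0 σ hσ' t ht.1)
      have hv : HasDerivAt (fun σ => sweptVel η σ t) (Complex.I * deriv η t) σ := by
        have h1 : HasDerivAt (fun σ => σ * deriv η t) (deriv η t) σ := by
          simpa using (hasDerivAt_id σ).mul_const (deriv η t)
        simpa [sweptVel] using (h1.ofReal_comp.const_mul Complex.I).const_add (1 : ℂ)
      refine ((hr.const_add (z - μ)).mul hv).congr_deriv ?_
      simp only [K]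
      ring)
    (by
      intro σ hσ
      refine ContinuousOn.mul (continuousOn_const.add ?_) (by fun_prop)
      exact hRc.comp (f := fun t => (σ, t)) (by fun_prop) fun t ht => ⟨hσ, ht.1⟩)
    (by
      intro σ hσ t ht
      have hc : ContinuousAt (fun t => sweptRadical a b η U z σ t) t :=
        (hRc.comp (f := fun t => (σ, t)) (s := Ici s) (by fun_prop)
          fun t ht => ⟨hσ, ht⟩).continuousAt (Ici_mem_nhds ht.1)
      have hq : HasDerivAt (fun t => Q (swept η σ t))
          (deriv Q (swept η σ t) * sweptVel η σ t) t :=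
        HasDerivAt.comp (h₂ := Q) (h := fun t => swept η σ t) t (hQ' _ (hW σ hσ t ht.1.le)) (hasDerivAt_swept h.smooth σ t)
      have hr := hasDerivAt_of_sq_eq hc hq (by
        filter_upwards [Ici_mem_nhds ht.1] with t' h1 using hRsq σ hσ t' h1) (hR0 σ hσ t ht.1.le)
      have hv : HasDerivAt (fun t => Complex.I * (η t : ℂ)) (Complex.I * deriv η t) t :=
        ((h.smooth.differentiable one_ne_zero t).hasDerivAt.ofReal_comp).const_mul Complex.I
      refine ((hr.const_add (z - μ)).mul hv).congr_deriv ?_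
      simp only [K]
      ring)
  have hint : ∀ σ ∈ Icc (0 : ℝ) 1, ∀ t₀ ≥ s,
      IntegrableOn (sweptIntegrand a b η μ U z σ) (Ioi t₀) := fun σ hσ t₀ ht₀ =>
    integrableOn_sweptIntegrand h hU hz hzμ hσ (hs.trans ht₀) fun t ht =>
      hne σ hσ t (le_trans ht₀ (le_of_lt ht))
  have htail : ∫ t in Ioi T', sweptIntegrand a b η μ U z 1 t =
      ∫ t in Ioi T', sweptIntegrand a b η μ U z 0 t := by
    refine setIntegral_congr_fun measurableSet_Ioi fun t ht => ?_
    have htT : T' ≤ t := le_of_lt ht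
    simp only [sweptIntegrand]
    rw [sweptRadical_tail h hU hz hzμ h11 (le_max_right s T) (fun u hu => hne 1 h11 u
      (hsT.trans (le_of_lt hu))) htT, sweptVel, sweptVel,
      deriv_eq_zero_of_tail h.smooth h.tail ((le_max_right s T).trans htT)]
    simp
  rw [← intervalIntegral.integral_interval_add_Ioi (hint 1 h11 s le_rfl) (hint 1 h11 T' hsT),
    ← intervalIntegral.integral_interval_add_Ioi (hint 0 h01 s le_rfl) (hint 0 h01 T' hsT), htail,
    add_sub_add_right_eq_sub, ← intervalIntegral.integral_sub, key,
    ← intervalIntegral.integral_neg]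
  · refine intervalIntegral.integral_congr fun σ _ => ?_
    simp [h.tail T' (le_max_right s T)]
  · exact (intervalIntegrable_iff_integrableOn_Ioc_of_le hsT).2
      ((hint 1 h11 s le_rfl).mono_set Ioc_subset_Ioi_self)
  · exact (intervalIntegrable_iff_integrableOn_Ioc_of_le hsT).2
      ((hint 0 h01 s le_rfl).mono_set Ioc_subset_Ioi_self)

end
end

/-! ### Boundary values on the arc -/

theorem tendsto_upperSqrt {ι : Type*} {l : Filter ι} {f : ι → ℂ} {w : ℂ} (hf : Tendsto f l (𝓝 w))
    (hw : 0 < w.im ∨ w.re ≠ 0) : Tendsto (fun i => upperSqrt (f i)) l (𝓝 (upperSqrt w)) :=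
  (differentiableAt_upperSqrt hw).continuousAt.tendsto.comp hf

/-- A square root function that is continuous off the ray `-i ε [0, ∞)` and picks up the factor `j`
when the positive half-plane is reached from the negative one. -/
structure IsSideSqrt (S : ℂ → ℂ) (ε : ℝ) (j : ℂ) : Prop where
  sq : ∀ w, S w ^ 2 = w
  cont : ∀ w : ℂ, (0 < ε * w.im ∨ w.re ≠ 0) → ContinuousAt S w
  neg : ∀ v : ℂ, 0 < v.re → S (-v) = j * S v

theorem isSideSqrt_upperSqrt : IsSideSqrt upperSqrt 1 Complex.I :=
  ⟨upperSqrt_sq, fun _ hw => (differentiableAt_upperSqrt (by simpa using hw)).continuousAt,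
    fun _ => upperSqrt_neg⟩

theorem isSideSqrt_conj :
    IsSideSqrt (fun w => conj (upperSqrt (conj w))) (-1) (-Complex.I) := by
  refine ⟨fun w => ?_, fun w hw => ?_, fun v hv => ?_⟩
  · rw [← map_pow, upperSqrt_sq, Complex.conj_conj]
  · have h1 : ContinuousAt upperSqrt (conj w) :=
      (differentiableAt_upperSqrt (by simpa using hw)).continuousAt
    exact Complex.continuous_conj.continuousAt.comp
      (h1.comp (f := fun w => conj w) Complex.continuous_conj.continuousAt)
  · rw [map_neg, upperSqrt_neg (by simpa using hv)]
    simp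

theorem IsSideSqrt.ne_zero {S : ℂ → ℂ} {ε : ℝ} {j : ℂ} (hS : IsSideSqrt S ε j) {w : ℂ}
    (hw : w ≠ 0) : S w ≠ 0 := fun h => hw <| by rw [← hS.sq w, h]; simp

/-- On the cut `Re ζ = -Re q`, so `|ζ| ≥ |d|/2`. The cone condition then gives `ε Im ζ > κ|d|/2 ≥
|Im q|`, hence `ε Im (ζ + q) > 0`, a contradiction. -/
theorem sector_avoids_cut {ε κ e d : ℝ} {ζ q : ℂ} (he : e ≤ 1 / 2) (heκ : e ≤ κ / 2)
    (he0 : 0 ≤ e) (hζ : κ * ‖ζ‖ < ε * ζ.im) (hε : |ε| = 1) (hq : ‖q - d‖ ≤ e * |d|) :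
    0 < ε * (ζ + q).im ∨ (ζ + q).re ≠ 0 := by
  by_contra! hcon
  obtain ⟨h1, h2⟩ := hcon
  have h3 : |q.re - d| ≤ e * |d| := by
    have := (Complex.abs_re_le_norm (q - d)).trans hq
    simpa using this
  have h4 : |ε * q.im| ≤ e * |d| := by
    have := (Complex.abs_im_le_norm (q - d)).trans hq
    rw [abs_mul, hε, one_mul]
    simpa using this
  rw [Complex.add_im, mul_add] at h1
  rw [Complex.add_re] at h2
  have h5 : |ζ.re| ≤ ‖ζ‖ := Complex.abs_re_le_norm ζ
  have h6 : ζ.re = -q.re := by linarith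
  rw [h6, abs_neg] at h5
  have h7 : |d| ≤ |q.re| + e * |d| := by
    have := abs_sub_abs_le_abs_sub d q.re
    rw [abs_sub_comm d] at this
    linarith
  have h8 : |d| / 2 ≤ ‖ζ‖ := by nlinarith [abs_nonneg d]
  have h9 := (abs_le.1 h4).1
  have hκ : 0 ≤ κ := by linarith
  nlinarith [abs_nonneg d, mul_le_mul_of_nonneg_left h8 hκ,
    mul_le_mul_of_nonneg_right heκ (abs_nonneg d)]

section
variable {a b : ℂ → ℂ} {η : ℝ → ℝ} {μ x T : ℝ} {m : ℝ → ℝ} {W : Set ℂ}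
  {U : ℂ → ℝ → ℝ → ℂ} {j : ℂ}

/-- The upper half of the main arc. -/
def arcPt (a b : ℂ → ℂ) (η : ℝ → ℝ) (s : ℝ) : ℂ := alpha a b (swept η 1 s)

/-- The one-sided boundary values of the square root of `z - α(t)` at the point `s` of the arc. -/
noncomputable def bdRoot (a b : ℂ → ℂ) (η : ℝ → ℝ) (U : ℂ → ℝ → ℝ → ℂ) (j : ℂ) (s t : ℝ) : ℂ :=
  if s ≤ t then U (arcPt a b η s) 1 t else j * U (arcPt a b η t) 1 s

/-- The one-sided boundary values of the integrand at the point `s` of the arc. -/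
noncomputable def bdIntegrand (a b : ℂ → ℂ) (η : ℝ → ℝ) (μ : ℝ) (U : ℂ → ℝ → ℝ → ℂ) (j : ℂ)
    (s t : ℝ) : ℂ :=
  (arcPt a b η s - μ + -bdRoot a b η U j s t *
    upperSqrt (arcPt a b η s - alphaTilde a b (swept η 1 t))) * sweptVel η 1 t

/-- The one-sided boundary values of the integrand at `μ`. -/
noncomputable def bdIntegrandInfty (a b : ℂ → ℂ) (η : ℝ → ℝ) (μ : ℝ) (j : ℂ) (t : ℝ) : ℂ :=
  (-(j * upperSqrt (arcPt a b η t - μ)) * upperSqrt (μ - alphaTilde a b (swept η 1 t))) *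
    sweptVel η 1 t

theorem mem01 : (1 : ℝ) ∈ Icc (0 : ℝ) 1 := by simp
theorem mem00 : (0 : ℝ) ∈ Icc (0 : ℝ) 1 := by simp

section
variable (h : IsSwept a b η μ x T m W)
include h

theorem IsSwept.continuousOn_arcPt : ContinuousOn (arcPt a b η) (Ici x) :=
  h.continuousOn_alpha.comp (f := fun t => ((1 : ℝ), t)) (by fun_prop) fun t ht => ⟨mem01, ht⟩

theorem IsSwept.arcPt_im {s : ℝ} (hs : x ≤ s) : 0 < (arcPt a b η s).im :=
  h.upper _ (h.mem 1 mem01 s hs)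

theorem IsSwept.arcPt_ne_mu {s : ℝ} (hs : x ≤ s) : arcPt a b η s ≠ μ := fun he => by
  have := h.arcPt_im hs
  rw [he] at this
  simp at this

theorem IsSwept.arcPt_inj {s t : ℝ} (hs : x ≤ s) (ht : x ≤ t)
    (he : arcPt a b η s = arcPt a b η t) : s = t := by
  have := h.inj 1 mem01 s hs 1 mem01 t ht he
  rw [← swept_re η 1 s, this, swept_re]

theorem IsSwept.arcPt_mem_rootDom {s t : ℝ} (hs : x ≤ s) (ht : s < t) :
    (arcPt a b η s, 1, t) ∈ rootDom a b η μ x := by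
  refine ⟨(h.arcPt_im hs).le, h.arcPt_ne_mu hs, mem01, hs.trans ht.le, fun u hu he => ?_⟩
  have htu : t ≤ u := hu
  have := h.arcPt_inj hs (hs.trans (ht.le.trans htu)) he
  linarith

theorem IsSwept.arcPt_sub_tilde_im {s t : ℝ} (hs : x ≤ s) (ht : x ≤ t) :
    0 < (arcPt a b η s - alphaTilde a b (swept η 1 t)).im := by
  have h1 := h.arcPt_im hs
  have h2 := h.lower _ (h.mem 1 mem01 t ht)
  rw [Complex.sub_im]; linarith

end

section
variable (h : IsSwept a b η μ x T m W) (hU : IsRoot a b η μ x U) (hj : j ^ 2 = -1)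
include h hU hj

/-- For `t < s` the root of `c(s) - c(t)` is obtained from that of `c(t) - c(s)`, which is available
as `s` lies beyond `t`; the factor `j` with `j² = -1` corrects the sign. -/
theorem bdRoot_sq {s t : ℝ} (hs : x ≤ s) (ht : x ≤ t) :
    bdRoot a b η U j s t ^ 2 = arcPt a b η s - arcPt a b η t := by
  unfold bdRoot
  split_ifs with hst
  · rcases eq_or_lt_of_le hst with h1 | h1
    · subst h1
      rw [arcPt, hU.zero]; simp
    · exact hU.sq _ (h.arcPt_mem_rootDom hs h1)
  · rw [mul_pow, hU.sq _ (h.arcPt_mem_rootDom ht (not_le.1 hst)), hj, arcPt, arcPt]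
    ring

theorem bdRoot_ne_zero {s t : ℝ} (hs : x ≤ s) (ht : x ≤ t) (hst : s ≠ t) :
    bdRoot a b η U j s t ≠ 0 := fun h0 => by
  have := bdRoot_sq h hU hj hs ht
  rw [h0, zero_pow two_ne_zero, eq_comm, sub_eq_zero] at this
  exact hst (h.arcPt_inj hs ht this)

theorem continuousOn_bdRoot :
    ContinuousOn (fun p : ℝ × ℝ => bdRoot a b η U j p.1 p.2) (Ici x ×ˢ Ici x) := by
  have hc := h.continuousOn_arcPt
  have hc1 : ContinuousOn (fun p : ℝ × ℝ => arcPt a b η p.1) (Ici x ×ˢ Ici x) :=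
    hc.comp continuousOn_fst fun p hp => hp.1
  have hc2 : ContinuousOn (fun p : ℝ × ℝ => arcPt a b η p.2) (Ici x ×ˢ Ici x) :=
    hc.comp continuousOn_snd fun p hp => hp.2
  rintro ⟨s, t⟩ ⟨hs, ht⟩
  rcases lt_trichotomy s t with hst | hst | hst
  · have hn : ∀ᶠ p in 𝓝 ((s, t) : ℝ × ℝ), p.1 < p.2 :=
      (isOpen_lt continuous_fst continuous_snd).mem_nhds hst
    have h1 : ContinuousOn (fun p : ℝ × ℝ => U (arcPt a b η p.1) 1 p.2)
        ((Ici x ×ˢ Ici x) ∩ {p | p.1 < p.2}) := by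
      refine hU.cont.comp (f := fun p : ℝ × ℝ => (arcPt a b η p.1, (1 : ℝ), p.2)) ?_ fun p hp =>
        h.arcPt_mem_rootDom hp.1.1 hp.2
      exact (hc1.mono inter_subset_left).prodMk (by fun_prop)
    refine ((h1 (s, t) ⟨⟨hs, ht⟩, hst⟩).mono_of_mem_nhdsWithin
      (inter_mem self_mem_nhdsWithin (mem_nhdsWithin_of_mem_nhds hn))).congr_of_eventuallyEq ?_
      (if_pos hst.le)
    filter_upwards [nhdsWithin_le_nhds hn] with p hp using if_pos hp.le
  · subst hst
    have h0 : bdRoot a b η U j s s = 0 := by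
      have := bdRoot_sq h hU hj hs hs
      simpa using this
    rw [ContinuousWithinAt, h0]
    refine tendsto_zero_of_sq ?_
    have h1 := (hc1.sub hc2) (s, s) ⟨hs, hs⟩
    rw [ContinuousWithinAt, Pi.sub_apply, sub_self] at h1
    refine h1.congr' ?_
    filter_upwards [self_mem_nhdsWithin] with p hp
    exact (bdRoot_sq h hU hj hp.1 hp.2).symm
  · have hn : ∀ᶠ p in 𝓝 ((s, t) : ℝ × ℝ), p.2 < p.1 :=
      (isOpen_lt continuous_snd continuous_fst).mem_nhds hst
    have h1 : ContinuousOn (fun p : ℝ × ℝ => j * U (arcPt a b η p.2) 1 p.1)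
        ((Ici x ×ˢ Ici x) ∩ {p | p.2 < p.1}) := by
      refine continuousOn_const.mul (hU.cont.comp
        (f := fun p : ℝ × ℝ => (arcPt a b η p.2, (1 : ℝ), p.1)) ?_ fun p hp =>
        h.arcPt_mem_rootDom hp.1.2 hp.2)
      exact (hc2.mono inter_subset_left).prodMk (by fun_prop)
    refine ((h1 (s, t) ⟨⟨hs, ht⟩, hst⟩).mono_of_mem_nhdsWithin
      (inter_mem self_mem_nhdsWithin (mem_nhdsWithin_of_mem_nhds hn))).congr_of_eventuallyEq ?_
      (if_neg (not_le.2 hst))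
    filter_upwards [nhdsWithin_le_nhds hn] with p hp using if_neg (not_le.2 hp)

theorem continuousOn_bdIntegrand :
    ContinuousOn (fun p : ℝ × ℝ => bdIntegrand a b η μ U j p.1 p.2) (Ici x ×ˢ Ici x) := by
  have hc1 : ContinuousOn (fun p : ℝ × ℝ => arcPt a b η p.1) (Ici x ×ˢ Ici x) :=
    h.continuousOn_arcPt.comp continuousOn_fst fun p hp => hp.1
  have hB : ContinuousOn (fun p : ℝ × ℝ => alphaTilde a b (swept η 1 p.2)) (Ici x ×ˢ Ici x) :=
    h.continuousOn_tilde.comp (f := fun p : ℝ × ℝ => ((1 : ℝ), p.2)) (by fun_prop)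
      fun p hp => ⟨mem01, hp.2⟩
  refine ((hc1.sub continuousOn_const).add ((continuousOn_bdRoot h hU hj).neg.mul
    (continuousOn_upperSqrt.comp (hc1.sub hB) fun p hp =>
      (h.arcPt_sub_tilde_im hp.1 hp.2).le))).mul ?_
  exact ((continuous_sweptVel h.smooth).comp (f := fun p : ℝ × ℝ => ((1 : ℝ), p.2))
    (by fun_prop)).continuousOn

/-- The boundary values obey the same majorant as the integrand itself, so their integrals can be
passed to the limit too. -/
theorem norm_bdIntegrand_le {V : ℝ} (hV : ∀ σ ∈ Icc (0 : ℝ) 1, ∀ t ≥ x, ‖sweptVel η σ t‖ ≤ V)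
    {s t : ℝ} (hs : x ≤ s) (ht : x ≤ t) : ‖bdIntegrand a b η μ U j s t‖ ≤ 9 * m t * V := by
  rw [bdIntegrand, norm_mul]
  have hm := h.m_nonneg ht
  gcongr
  · rcases le_or_gt s t with hst | hst
    · have h1 := norm_add_sweptRadical_le h hU (z := arcPt a b η s) (h.arcPt_im hs).le
        (h.arcPt_ne_mu hs) mem01 ht (by
          rcases eq_or_lt_of_le hst with h1 | h1
          · subst h1; exact Or.inr rfl
          · exact Or.inl (h.arcPt_mem_rootDom hs h1))
      simpa only [sweptRadical, bdRoot, hst, if_true] using h1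
    -- For `t < s` the sign of the root is irrelevant: `|c(s) - μ| ≤ m s ≤ m t`, so the near case
    -- applies.
    · refine norm_add_radical_le_of_near (c := arcPt a b η t - μ)
        (d := alphaTilde a b (swept η 1 t) - μ) ?_ (h.bound 1 mem01 t ht) (h.bound' 1 mem01 t ht) ?_
      · have h1 := h.bound 1 mem01 s hs
        have h2 := h.anti ht hs hst.le
        simp only [arcPt]
        linarith
      · rw [mul_pow, neg_sq, bdRoot_sq h hU hj hs ht, upperSqrt_sq]
        ring
  · exact hV 1 mem01 t ht

theorem integrableOn_bdIntegrand {s : ℝ} (hs : x ≤ s) :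
    IntegrableOn (bdIntegrand a b η μ U j s) (Ioi x) := by
  obtain ⟨V, -, hV⟩ := h.exists_vel_bound
  have hm : IntegrableOn (fun t => 9 * m t * V) (Ioi x) := (h.integrable.const_mul 9).mul_const V
  refine hm.mono' (ContinuousOn.aestronglyMeasurable ?_ measurableSet_Ioi) ?_
  · exact (continuousOn_bdIntegrand h hU hj).comp (f := fun t => (s, t)) (by fun_prop)
      fun t ht => ⟨hs, Ioi_subset_Ici_self ht⟩
  · filter_upwards [ae_restrict_mem measurableSet_Ioi] with t ht
    exact norm_bdIntegrand_le h hU hj hV hs (le_of_lt ht)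

theorem continuousOn_integral_bd :
    ContinuousOn (fun s => ∫ t in Ioi x, bdIntegrand a b η μ U j s t) (Ici x) := by
  obtain ⟨V, -, hV⟩ := h.exists_vel_bound
  refine continuousOn_of_dominated (bound := fun t => 9 * m t * V) (fun s hs => ?_)
    (fun s hs => ?_) ((h.integrable.const_mul 9).mul_const V) ?_
  · exact (integrableOn_bdIntegrand h hU hj hs).aestronglyMeasurable
  · filter_upwards [ae_restrict_mem measurableSet_Ioi] with t ht
    exact norm_bdIntegrand_le h hU hj hV hs (le_of_lt ht)
  · filter_upwards [ae_restrict_mem measurableSet_Ioi] with t ht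
    exact (continuousOn_bdIntegrand h hU hj).comp (f := fun s => (s, t)) (by fun_prop)
      fun s hs => ⟨hs, Ioi_subset_Ici_self ht⟩

/-- Every fixed `t` is eventually below `s`, so the boundary root becomes `j` times a root continued
out to `+∞`, whose limit is known. -/
theorem tendsto_integral_bd_atTop :
    Tendsto (fun s => ∫ t in Ioi x, bdIntegrand a b η μ U j s t) atTop
      (𝓝 (∫ t in Ioi x, bdIntegrandInfty a b η μ j t)) := by
  obtain ⟨V, -, hV⟩ := h.exists_vel_bound
  refine tendsto_integral_filter_of_dominated_convergence (bound := fun t => 9 * m t * V) ?_ ?_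
    ((h.integrable.const_mul 9).mul_const V) ?_
  · filter_upwards [eventually_ge_atTop x] with s hs
    exact (integrableOn_bdIntegrand h hU hj hs).aestronglyMeasurable
  · filter_upwards [eventually_ge_atTop x] with s hs
    filter_upwards [ae_restrict_mem measurableSet_Ioi] with t ht
    exact norm_bdIntegrand_le h hU hj hV hs (le_of_lt ht)
  · filter_upwards [ae_restrict_mem measurableSet_Ioi] with t ht
    have ht' : x ≤ t := le_of_lt ht
    have hc : Tendsto (arcPt a b η) atTop (𝓝 μ) := h.tendsto_alpha mem01
    have h1 : Tendsto (fun s => bdRoot a b η U j s t) atTop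
        (𝓝 (j * upperSqrt (arcPt a b η t - μ))) := by
      refine ((hU.lim _ (h.arcPt_im ht').le (h.arcPt_ne_mu ht') 1 mem01).const_mul j).congr' ?_
      filter_upwards [eventually_gt_atTop t] with s hs using (if_neg (not_le.2 hs)).symm
    have h2 : Tendsto (fun s => upperSqrt (arcPt a b η s - alphaTilde a b (swept η 1 t))) atTop
        (𝓝 (upperSqrt (μ - alphaTilde a b (swept η 1 t)))) := by
      refine tendsto_upperSqrt (hc.sub_const _) (Or.inl ?_)
      have := h.lower _ (h.mem 1 mem01 t ht')
      simpa using this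
    have h3 := ((hc.sub_const (μ : ℂ)).add (h1.neg.mul h2)).mul_const (sweptVel η 1 t)
    rw [sub_self, zero_add] at h3
    exact h3

end

section
variable (h : IsSwept a b η μ x T m W) (hU : IsRoot a b η μ x U)
include h hU

/-- For real `u` the whole arc minus `u` lies in the upper half-plane, so the root is a constant
`±i` times `upperSqrt (c(t) - u)`. The constant is read off at `t = +∞`: `i` for `u < μ` and `-i`
for `u > μ`. -/
theorem root_of_real {u : ℝ} (hj : j ^ 2 = -1) (hu : u ≠ μ)
    (huj : upperSqrt (u - μ) = j * upperSqrt (μ - u)) {t : ℝ} (ht : x ≤ t) :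
    U u 1 t = j * upperSqrt (arcPt a b η t - u) := by
  have huμ : (u : ℂ) ≠ μ := fun h' => hu (by exact_mod_cast h')
  have him : ∀ t ≥ x, 0 < (arcPt a b η t - u).im := fun t ht => by
    simpa using h.arcPt_im ht
  have hmem : ∀ t ≥ x, ((u : ℂ), 1, t) ∈ rootDom a b η μ x := fun t ht =>
    ⟨by simp, huμ, mem01, ht, fun s hs he => by
      have := h.arcPt_im (le_trans (show x ≤ t from ht) hs)
      rw [arcPt, ← he] at this
      simp at this⟩
  have hg : ContinuousOn (fun t => j * upperSqrt (arcPt a b η t - u)) (Ici x) :=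
    continuousOn_const.mul (continuousOn_upperSqrt.comp
      (h.continuousOn_arcPt.sub continuousOn_const) fun t ht => (him t ht).le)
  have hf : ContinuousOn (fun t => U u 1 t) (Ici x) :=
    hU.cont.comp (f := fun t => ((u : ℂ), (1 : ℝ), t)) (by fun_prop) hmem
  have hj0 : j ≠ 0 := fun h0 => by simp [h0] at hj
  have hg0 : ∀ t ∈ Ici x, j * upperSqrt (arcPt a b η t - u) ≠ 0 := fun t ht =>
    mul_ne_zero hj0 (upperSqrt_ne_zero fun h0 => by
      have := him t ht
      rw [h0] at this
      simp at this)
  rcases isPreconnected_Ici.eq_or_eq_neg_of_sq_eq hf hg (fun t ht => by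
    simp only [Pi.pow_apply]
    rw [hU.sq _ (hmem t ht), mul_pow, upperSqrt_sq, hj, arcPt]
    ring) (fun {t} ht => hg0 t ht) with h1 | h1
  · exact h1 ht
  · exfalso
    have l1 := hU.lim u (by simp) huμ 1 mem01
    have l2 : Tendsto (fun t => j * upperSqrt (arcPt a b η t - u)) atTop
        (𝓝 (j * upperSqrt (μ - u))) := by
      refine Tendsto.const_mul j ?_
      have := continuousOn_upperSqrt ((μ : ℂ) - u) (by simp)
      refine this.tendsto.comp (tendsto_nhdsWithin_iff.2
        ⟨(h.tendsto_alpha mem01).sub_const (u : ℂ), ?_⟩)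
      filter_upwards [eventually_ge_atTop x] with t ht using (him t ht).le
    have l3 : Tendsto (fun t => U u 1 t) atTop (𝓝 (-(j * upperSqrt (μ - u)))) :=
      l2.neg.congr' ((eventually_ge_atTop x).mono fun t ht => (h1 ht).symm)
    have l4 := tendsto_nhds_unique l1 l3
    rw [huj, self_eq_neg, mul_eq_zero] at l4
    rcases l4 with l4 | l4
    · exact hj0 l4
    · exact upperSqrt_ne_zero (sub_ne_zero.2 huμ.symm) l4

theorem tendsto_integral_swept_real (hj : j ^ 2 = -1) {l : Filter ℝ} [l.IsCountablyGenerated]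
    (hl : l ≤ 𝓝 μ)
    (hlj : ∀ᶠ u : ℝ in l, u ≠ μ ∧ upperSqrt (u - μ) = j * upperSqrt (μ - u)) :
    Tendsto (fun u : ℝ => ∫ t in Ioi x, sweptIntegrand a b η μ U u 1 t) l
      (𝓝 (∫ t in Ioi x, bdIntegrandInfty a b η μ j t)) := by
  obtain ⟨V, -, hV⟩ := h.exists_vel_bound
  have hslit : ∀ u : ℝ, u ≠ μ → ((u : ℂ), 1, x) ∈ rootDom a b η μ x := fun u hu =>
    ⟨by simp, fun h' => hu (Complex.ofReal_injective h'), mem01, le_rfl, fun s hs he => by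
      have := h.arcPt_im hs
      rw [arcPt, ← he] at this
      simp at this⟩
  refine tendsto_integral_filter_of_dominated_convergence (bound := fun t => 9 * m t * V) ?_ ?_
    ((h.integrable.const_mul 9).mul_const V) ?_
  · filter_upwards [hlj] with u hu
    have hm := hslit u hu.1
    exact (integrableOn_sweptIntegrand h hU hm.1 hm.2.1 mem01 le_rfl fun t ht =>
      hm.2.2.2.2 t (le_of_lt ht)).aestronglyMeasurable
  · filter_upwards [hlj] with u hu
    filter_upwards [ae_restrict_mem measurableSet_Ioi] with t ht
    have hm := hslit u hu.1
    exact norm_sweptIntegrand_le h hU hV hm.1 hm.2.1 mem01 (le_of_lt ht)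
      (Or.inl (rootDom_mono hm (le_of_lt ht)))
  · filter_upwards [ae_restrict_mem measurableSet_Ioi] with t ht
    have ht' : x ≤ t := le_of_lt ht
    have hu : Tendsto (fun u : ℝ => (u : ℂ)) l (𝓝 μ) :=
      (Complex.continuous_ofReal.tendsto μ).mono_left hl
    have h1 : Tendsto (fun u : ℝ => j * upperSqrt (arcPt a b η t - u)) l
        (𝓝 (j * upperSqrt (arcPt a b η t - μ))) := by
      refine Tendsto.const_mul j (tendsto_upperSqrt (hu.const_sub _) (Or.inl ?_))
      simpa using h.arcPt_im ht'
    have h2 : Tendsto (fun u : ℝ => upperSqrt (u - alphaTilde a b (swept η 1 t))) l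
        (𝓝 (upperSqrt (μ - alphaTilde a b (swept η 1 t)))) := by
      refine tendsto_upperSqrt (hu.sub_const _) (Or.inl ?_)
      have := h.lower _ (h.mem 1 mem01 t ht')
      simpa using this
    have h3 := ((hu.sub_const (μ : ℂ)).add (h1.neg.mul h2)).mul_const (sweptVel η 1 t)
    rw [sub_self, zero_add] at h3
    refine h3.congr' ?_
    filter_upwards [hlj] with u hu
    rw [sweptIntegrand, sweptRadical, root_of_real h hU hj hu.1 hu.2 ht']

end
end

section
variable {a b : ℂ → ℂ} {η : ℝ → ℝ} {μ x T : ℝ} {m : ℝ → ℝ} {W : Set ℂ}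
  {U : ℂ → ℝ → ℝ → ℂ} {j : ℂ}

theorem contDiff_swept (hη : ContDiff ℝ 1 η) (σ : ℝ) : ContDiff ℝ 1 (swept η σ) := by
  have h1 : ContDiff ℝ 1 fun t : ℝ => ((σ * η t : ℝ) : ℂ) :=
    Complex.ofRealCLM.contDiff.comp (contDiff_const.mul hη)
  have h2 : ContDiff ℝ 1 fun t : ℝ => (t : ℂ) := Complex.ofRealCLM.contDiff
  exact h2.add (contDiff_const.mul h1)

theorem IsSwept.hasStrictDerivAt_arcPt (h : IsSwept a b η μ x T m W) {s : ℝ} (hs : x ≤ s) :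
    HasStrictDerivAt (arcPt a b η) (deriv (arcPt a b η) s) s := by
  have h1 : HasStrictDerivAt (alpha a b) (deriv (alpha a b) (swept η 1 s)) (swept η 1 s) :=
    (h.diff_alpha.analyticAt (h.isOpen.mem_nhds (h.mem 1 mem01 s hs))).hasStrictDerivAt
  have h2 : HasStrictDerivAt (swept η 1) (deriv (swept η 1) s) s :=
    (contDiff_swept h.smooth 1).contDiffAt.hasStrictDerivAt one_ne_zero
  have h3 := HasStrictDerivAt.comp (h₂ := alpha a b) (h := swept η 1) s h1 h2
  have h4 : deriv (arcPt a b η) s = _ := h3.hasDerivAt.deriv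
  rw [h4]
  exact h3

/-- Strict differentiability controls chords between any two points near `s₀`. Division by `-c'`
turns the arc into a nearly straight line along the real axis, oriented from the lower to the upper
endpoint. -/
theorem exists_chord_bound {c : ℝ → ℂ} {s₀ x : ℝ} {c' : ℂ}
    (hc : HasStrictDerivAt c c' s₀) (hc0 : c' ≠ 0) (hx : x < s₀) {e : ℝ} (he : 0 < e) :
    ∃ δ > 0, x ≤ s₀ - δ ∧ ∀ s ∈ Icc (s₀ - δ) (s₀ + δ), ∀ t ∈ Icc (s₀ - δ) (s₀ + δ),
      ‖(c s - c t) / -c' - (t - s : ℝ)‖ ≤ e * |t - s| := by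
  have h1 := hc.hasStrictFDerivAt.isLittleO.def (c := e * ‖c'‖) (by positivity)
  obtain ⟨δ, hδ, hδ'⟩ := Metric.eventually_nhds_iff.1 h1
  refine ⟨min (δ / 2) (s₀ - x), lt_min (half_pos hδ) (sub_pos.2 hx),
    by linarith [min_le_right (δ / 2) (s₀ - x)], fun s hs t ht => ?_⟩
  have hd : ∀ s ∈ Icc (s₀ - min (δ / 2) (s₀ - x)) (s₀ + min (δ / 2) (s₀ - x)), dist s s₀ < δ := by
    intro s hs
    have := min_le_left (δ / 2) (s₀ - x)
    rw [Real.dist_eq, abs_lt]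
    constructor <;> linarith [hs.1, hs.2]
  have h2 := hδ' (y := (s, t)) (max_lt (hd s hs) (hd t ht))
  have e1 : (c s - c t) / -c' - (t - s : ℝ) = (c s - c t - (s - t : ℝ) • c') / -c' := by
    rw [Complex.real_smul]
    field_simp
    push_cast
    ring
  rw [e1, norm_div, norm_neg, div_le_iff₀ (norm_pos_iff.2 hc0)]
  simp only [ContinuousLinearMap.toSpanSingleton_apply, Real.norm_eq_abs] at h2
  calc _ ≤ e * ‖c'‖ * |s - t| := h2
    _ = _ := by rw [abs_sub_comm]; ring

section
variable {S : ℂ → ℂ} {ε : ℝ} {s₀ : ℝ}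

/-- Points that tend to `α(s₀)` inside a cone to one side of the arc are eventually off the arc. -/
theorem sideFilter_slitDom (h : IsSwept a b η μ x T m W) (hε : |ε| = 1) (hs₀ : x < s₀)
    (hreg : deriv (arcPt a b η) s₀ ≠ 0) {κ : ℝ} (hκ : 0 < κ) :
    ∀ᶠ z in 𝓝[{z | κ * ‖z - arcPt a b η s₀‖ <
      ε * ((z - arcPt a b η s₀) / -deriv (arcPt a b η) s₀).im}] (arcPt a b η s₀),
      z ∈ slitDom a b η μ 1 x ∩ {z | 0 < z.im} := by
  set c := arcPt a b η with hc
  set c' := deriv c s₀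
  have hc'0 : 0 < ‖c'‖ := norm_pos_iff.2 hreg
  -- The bound `κ ‖c'‖ / 2` fits the cone, whose constant becomes `κ ‖c'‖` after division by `-c'`;
  -- the bound `1/2` keeps the real part of a chord comparable to its length.
  obtain ⟨δ, hδ, hδx, hch⟩ := exists_chord_bound (h.hasStrictDerivAt_arcPt hs₀.le) hreg hs₀
    (e := min (1 / 2) (κ * ‖c'‖ / 2)) (by positivity)
  have hK : IsCompact ((insert (μ : ℂ) (c '' Ici (s₀ + δ))) ∪ c '' Icc x (s₀ - δ)) := by
    refine (h.isCompact_slit mem01 (by linarith)).union (isCompact_Icc.image_of_continuousOn ?_)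
    exact h.continuousOn_arcPt.mono Icc_subset_Ici_self
  have hz₀K : c s₀ ∉ (insert (μ : ℂ) (c '' Ici (s₀ + δ))) ∪ c '' Icc x (s₀ - δ) := by
    rintro ((h1 | ⟨t, ht, h1⟩) | ⟨t, ht, h1⟩)
    · exact h.arcPt_ne_mu hs₀.le h1
    · have ht' : s₀ + δ ≤ t := ht
      have := h.arcPt_inj (by linarith) hs₀.le h1
      linarith
    · have := h.arcPt_inj ht.1 hs₀.le h1
      linarith [ht.2]
  have e1 : ∀ᶠ z in 𝓝 (c s₀), z ∉ (insert (μ : ℂ) (c '' Ici (s₀ + δ))) ∪ c '' Icc x (s₀ - δ) :=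
    hK.isClosed.isOpen_compl.mem_nhds hz₀K
  have e2 : ∀ᶠ z in 𝓝 (c s₀), 0 < z.im :=
    (isOpen_lt continuous_const Complex.continuous_im).mem_nhds (h.arcPt_im hs₀.le)
  filter_upwards [nhdsWithin_le_nhds e1, nhdsWithin_le_nhds e2, self_mem_nhdsWithin]
    with z h1 h2 h3
  refine ⟨⟨le_of_lt h2, ?_⟩, h2⟩
  rintro (h4 | ⟨t, ht, h4⟩)
  · exact h1 (Or.inl (Or.inl h4))
  · by_cases hI : t ∈ Icc (s₀ - δ) (s₀ + δ)
    · have h5 := sector_avoids_cut (ε := ε) (κ := κ * ‖c'‖) (e := min (1 / 2) (κ * ‖c'‖ / 2))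
        (d := t - s₀) (ζ := (z - c s₀) / -c') (q := (c s₀ - c t) / -c')
        (min_le_left _ _) (min_le_right _ _) (by positivity) (by
          rw [norm_div, norm_neg]
          calc κ * ‖c'‖ * (‖z - c s₀‖ / ‖c'‖) = κ * ‖z - c s₀‖ := by field_simp
            _ < _ := h3) hε (hch s₀ ⟨by linarith, by linarith⟩ t hI)
      have h6 : (z - c s₀) / -c' + (c s₀ - c t) / -c' = 0 := by
        rw [← add_div, sub_add_sub_cancel, ← h4, hc, arcPt, sub_self, zero_div]
      rw [h6] at h5
      simp at h5
    · rw [mem_Icc, not_and_or, not_le, not_le] at hI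
      rcases hI with hI | hI
      · exact h1 (Or.inr ⟨t, ⟨ht, hI.le⟩, h4⟩)
      · exact h1 (Or.inl (Or.inr ⟨t, hI.le, h4⟩))

/-- Near a regular point, chords of the arc point in the direction of the tangent, and points
inside a cone to one side of the arc are separated from it. -/
theorem exists_side_interval (h : IsSwept a b η μ x T m W) (hs₀ : x < s₀)
    (hreg : deriv (arcPt a b η) s₀ ≠ 0) {κ : ℝ} (hκ : 0 < κ) (hε : |ε| = 1) :
    ∃ δ > 0, x ≤ s₀ - δ ∧
      (∀ s ∈ Icc (s₀ - δ) (s₀ + δ), ∀ u ∈ Icc (s₀ - δ) (s₀ + δ), s < u →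
        0 < ((arcPt a b η s - arcPt a b η u) / -deriv (arcPt a b η) s₀).re) ∧
      ∀ z, κ * ‖z - arcPt a b η s₀‖ <
          ε * ((z - arcPt a b η s₀) / -deriv (arcPt a b η) s₀).im →
        ∀ u ∈ Icc (s₀ - δ) (s₀ + δ),
          0 < ε * ((z - arcPt a b η u) / -deriv (arcPt a b η) s₀).im ∨
            ((z - arcPt a b η u) / -deriv (arcPt a b η) s₀).re ≠ 0 := by
  set c := arcPt a b η with hc
  set c' := deriv c s₀ with hc'
  have hc'0 : 0 < ‖c'‖ := norm_pos_iff.2 hreg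
  obtain ⟨δ, hδ, hδx, hch⟩ := exists_chord_bound (h.hasStrictDerivAt_arcPt hs₀.le) hreg hs₀
    (e := min (1 / 2) (κ * ‖c'‖ / 2)) (by positivity)
  have hs₀I : s₀ ∈ Icc (s₀ - δ) (s₀ + δ) := ⟨by linarith, by linarith⟩
  -- chords point in the direction of the tangent
  have hre : ∀ s ∈ Icc (s₀ - δ) (s₀ + δ), ∀ u ∈ Icc (s₀ - δ) (s₀ + δ), s < u →
      0 < ((c s - c u) / -c').re := by
    intro s hs u hu hsu
    have h1 := (Complex.abs_re_le_norm _).trans (hch s hs u hu)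
    rw [Complex.sub_re, Complex.ofReal_re, abs_of_pos (sub_pos.2 hsu), abs_le] at h1
    have h2 : min (1 / 2) (κ * ‖c'‖ / 2) * (u - s) ≤ 1 / 2 * (u - s) := by
      have := sub_pos.2 hsu
      gcongr
      exact min_le_left _ _
    linarith [h1.1]
  refine ⟨δ, hδ, hδx, hre, fun z h3 u hu => ?_⟩
  have h5 := sector_avoids_cut (ε := ε) (κ := κ * ‖c'‖) (e := min (1 / 2) (κ * ‖c'‖ / 2))
    (d := u - s₀) (ζ := (z - c s₀) / -c') (q := (c s₀ - c u) / -c')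
    (min_le_left _ _) (min_le_right _ _) (by positivity) (by
      rw [norm_div, norm_neg]
      calc κ * ‖c'‖ * (‖z - c s₀‖ / ‖c'‖) = κ * ‖z - c s₀‖ := by field_simp
        _ < _ := h3) hε (hch s₀ hs₀I u hu)
  rwa [← add_div, sub_add_sub_cancel] at h5

/-- The quotient of `U` and the model root `S` of the rescaled chord has a constant square, and the
triangle `s < u` is connected, so the quotient is constant along the arc. -/
theorem root_ratio_arc (h : IsSwept a b η μ x T m W) (hU : IsRoot a b η μ x U)
    (hS : IsSideSqrt S ε j) {c' : ℂ} {I : Set ℝ} (hI : Convex ℝ I) (hIx : ∀ u ∈ I, x ≤ u)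
    (hre : ∀ s ∈ I, ∀ u ∈ I, s < u → 0 < ((arcPt a b η s - arcPt a b η u) / -c').re)
    {s u s' u' : ℝ} (hs : s ∈ I) (hu : u ∈ I) (hsu : s < u) (hs' : s' ∈ I) (hu' : u' ∈ I)
    (hsu' : s' < u') :
    U (arcPt a b η s) 1 u * S ((arcPt a b η s' - arcPt a b η u') / -c') =
      U (arcPt a b η s') 1 u' * S ((arcPt a b η s - arcPt a b η u) / -c') := by
  set c := arcPt a b η with hc
  have hcI : ContinuousOn c I := h.continuousOn_arcPt.mono hIx
  let Δ : Set (ℝ × ℝ) := (I ×ˢ I) ∩ {p | p.1 < p.2}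
  have hΔ : IsPreconnected Δ := by
    refine (((hI).prod (hI)).inter ?_).isPreconnected
    have : {p : ℝ × ℝ | p.1 < p.2} = {p | (LinearMap.fst ℝ ℝ ℝ - LinearMap.snd ℝ ℝ ℝ) p < 0} := by
      ext p; simp
    rw [this]
    exact convex_halfSpace_lt (LinearMap.isLinear _) 0
  have hΔ1 : ContinuousOn (fun p : ℝ × ℝ => c p.1) Δ :=
    hcI.comp continuousOn_fst fun p hp => hp.1.1
  have hΔ2 : ContinuousOn (fun p : ℝ × ℝ => c p.2) Δ :=
    hcI.comp continuousOn_snd fun p hp => hp.1.2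
  have hmemΔ : ∀ p ∈ Δ, (c p.1, (1 : ℝ), p.2) ∈ rootDom a b η μ x := fun p hp =>
    h.arcPt_mem_rootDom (hIx _ hp.1.1) hp.2
  have hUc : ContinuousOn (fun p : ℝ × ℝ => U (c p.1) 1 p.2) Δ :=
    hU.cont.comp (f := fun p : ℝ × ℝ => (c p.1, (1 : ℝ), p.2))
      (hΔ1.prodMk (by fun_prop)) hmemΔ
  have hSc : ContinuousOn (fun p : ℝ × ℝ => S ((c p.1 - c p.2) / -c')) Δ := fun p hp =>
    (hS.cont _ (Or.inr (hre _ hp.1.1 _ hp.1.2 hp.2).ne')).comp_continuousWithinAt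
      (f := fun p : ℝ × ℝ => (c p.1 - c p.2) / -c') (((hΔ1.sub hΔ2).div_const (-c')) p hp)
  have hp : (s, u) ∈ Δ := ⟨⟨hs, hu⟩, hsu⟩
  have hp' : (s', u') ∈ Δ := ⟨⟨hs', hu'⟩, hsu'⟩
  have hf : ContinuousOn (fun p : ℝ × ℝ => U (c p.1) 1 p.2 * S ((c s' - c u') / -c')) Δ :=
    hUc.mul continuousOn_const
  have hg : ContinuousOn (fun p : ℝ × ℝ => U (c s') 1 u' * S ((c p.1 - c p.2) / -c')) Δ :=
    continuousOn_const.mul hSc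
  have key := hΔ.eq_of_sq_eq hf hg (fun p hp => ?_) (fun {p} hp => ?_) hp' rfl hp
  · exact key
  · simp only [Pi.pow_apply, mul_pow, hS.sq, hU.sq _ (hmemΔ p hp), hU.sq _ (hmemΔ _ hp')]
    simp only [hc, arcPt]
    ring
  · have hv := hre _ hp.1.1 _ hp.1.2 hp.2
    refine mul_ne_zero (fun h0 => ?_) (hS.ne_zero fun h0 => by simp [h0] at hv)
    have := hU.sq _ (hmemΔ _ hp')
    simp only [h0] at this
    have hv' := hre _ hs' _ hu' hsu'
    rw [zero_pow two_ne_zero] at this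
    have e0 : c s' - c u' = 0 := this.symm
    simp [e0] at hv'

/-- For a fixed `z` in the cone, `(z - c(u)) / -c'` avoids the cut of `S`, so the quotient of `U`
and `S` is constant in `u`, even as `u` passes `s₀`. -/
theorem root_ratio_slice (h : IsSwept a b η μ x T m W) (hU : IsRoot a b η μ x U)
    (hS : IsSideSqrt S ε j) {c' : ℂ} (hc' : c' ≠ 0) {s t : ℝ} (hs : x ≤ s) {z : ℂ}
    (hz : z ∈ slitDom a b η μ 1 x)
    (hzl : ∀ u ∈ Icc s t, 0 < ε * ((z - arcPt a b η u) / -c').im ∨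
      ((z - arcPt a b η u) / -c').re ≠ 0)
    {u v : ℝ} (hu : u ∈ Icc s t) (hv : v ∈ Icc s t) :
    U z 1 u * S ((z - arcPt a b η v) / -c') = U z 1 v * S ((z - arcPt a b η u) / -c') := by
  set c := arcPt a b η with hc
  have hIx : ∀ u ∈ Icc s t, x ≤ u := fun u hu => hs.trans hu.1
  have hcI : ContinuousOn c (Icc s t) := h.continuousOn_arcPt.mono hIx
  have hdom : ∀ u ≥ x, (z, 1, u) ∈ rootDom a b η μ x :=
    fun u hu => mem_rootDom_of_slitDom hz mem01 le_rfl hu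
  have hne : ∀ w ∈ Icc s t, z - c w ≠ 0 := fun w hw =>
    sub_ne_zero.2 ((hdom w (hIx w hw)).2.2.2.2 w le_rfl)
  have hUc : ContinuousOn (fun w => U z 1 w) (Icc s t) :=
    hU.cont.comp (f := fun w => (z, (1 : ℝ), w)) (by fun_prop) fun w hw => hdom w (hIx w hw)
  have hSc : ContinuousOn (fun w => S ((z - c w) / -c')) (Icc s t) :=
    fun w hw => (hS.cont _ (hzl w hw)).comp_continuousWithinAt (f := fun w => (z - c w) / -c')
      (((continuousOn_const.sub hcI).div_const (-c')) w hw)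
  have hf : ContinuousOn (fun u => U z 1 u * S ((z - c v) / -c')) (Icc s t) :=
    hUc.mul continuousOn_const
  have hg : ContinuousOn (fun u => U z 1 v * S ((z - c u) / -c')) (Icc s t) :=
    continuousOn_const.mul hSc
  have key := isPreconnected_Icc.eq_of_sq_eq hf hg (fun w hw => ?_) (fun {w} hw => ?_) hv rfl hu
  · exact key
  · simp only [Pi.pow_apply, mul_pow, hS.sq, hU.sq _ (hdom w (hIx w hw)),
      hU.sq _ (hdom v (hIx v hv)), hc, arcPt]
    ring
  · refine mul_ne_zero (fun h0 => ?_) (hS.ne_zero (div_ne_zero (hne w hw) (neg_ne_zero.2 hc')))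
    have := hU.sq _ (hdom v (hIx v hv))
    simp only [h0] at this
    exact hne v hv (by rw [hc, arcPt, ← this]; simp)

/-- Beyond `s₀` this is continuity of `U`. The comparison with `S`, adapted to the side, carries the
limit across `s₀` to nearby `t < s₀`, and a connectedness argument carries it down to all smaller
`t`. -/
theorem tendsto_root_side (h : IsSwept a b η μ x T m W) (hU : IsRoot a b η μ x U)
    (hj : j ^ 2 = -1) (hS : IsSideSqrt S ε j) (hε : |ε| = 1) (hs₀ : x < s₀)
    (hreg : deriv (arcPt a b η) s₀ ≠ 0) {κ : ℝ} (hκ : 0 < κ) {t : ℝ} (ht : x ≤ t) (hts : t ≠ s₀) :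
    Tendsto (fun z => U z 1 t) (𝓝[{z | κ * ‖z - arcPt a b η s₀‖ <
      ε * ((z - arcPt a b η s₀) / -deriv (arcPt a b η) s₀).im}] (arcPt a b η s₀))
      (𝓝 (bdRoot a b η U j s₀ t)) := by
  have hslit := sideFilter_slitDom h hε hs₀ hreg hκ
  set c := arcPt a b η with hc
  set c' := deriv c s₀ with hc'
  set l := 𝓝[{z | κ * ‖z - c s₀‖ < ε * ((z - c s₀) / -c').im}] (c s₀)
  have hl : l ≤ 𝓝 (c s₀) := nhdsWithin_le_nhds
  have hc'0 : 0 < ‖c'‖ := norm_pos_iff.2 hreg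
  have hdom : ∀ z ∈ slitDom a b η μ 1 x ∩ {z | 0 < z.im}, ∀ u ≥ x, (z, 1, u) ∈ rootDom a b η μ x :=
    fun z hz u hu => mem_rootDom_of_slitDom hz.1 mem01 le_rfl hu
  -- beyond `s₀`
  have hright : ∀ u > s₀, Tendsto (fun z => U z 1 u) l (𝓝 (U (c s₀) 1 u)) := by
    intro u hu
    have h1 := hU.cont (c s₀, 1, u) (h.arcPt_mem_rootDom hs₀.le hu)
    refine Tendsto.comp (g := fun p : ℂ × ℝ × ℝ => U p.1 p.2.1 p.2.2)
      (f := fun z : ℂ => (z, (1 : ℝ), u)) h1.tendsto (tendsto_nhdsWithin_iff.2 ⟨?_, ?_⟩)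
    · exact (tendsto_id.mono_left hl).prodMk_nhds tendsto_const_nhds
    · filter_upwards [hslit] with z hz using hdom z hz u (hs₀.le.trans hu.le)
  obtain ⟨δ, hδ, hδx, hre, hlin⟩ := exists_side_interval h hs₀ hreg hκ hε
  simp only [← hc, ← hc'] at hre hlin
  have hs₀I : s₀ ∈ Icc (s₀ - δ) (s₀ + δ) := ⟨by linarith, by linarith⟩
  have hIx : ∀ u ∈ Icc (s₀ - δ) (s₀ + δ), x ≤ u := fun u hu => hδx.trans hu.1
  have hmid : ∀ u ∈ Ico (s₀ - δ) s₀, Tendsto (fun z => U z 1 u) l (𝓝 (bdRoot a b η U j s₀ u)) := by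
    intro u hu
    have huI : u ∈ Icc (s₀ - δ) (s₀ + δ) := ⟨hu.1, by linarith [hu.2]⟩
    have hvI : s₀ + δ ∈ Icc (s₀ - δ) (s₀ + δ) := ⟨by linarith, le_rfl⟩
    have hv := hre _ hs₀I _ hvI (by linarith)
    have hu' := hre _ huI _ hs₀I hu.2
    have hSt : ∀ w : ℂ, (0 < ε * ((c s₀ - w) / -c').im ∨ ((c s₀ - w) / -c').re ≠ 0) →
        Tendsto (fun z => S ((z - w) / -c')) l (𝓝 (S ((c s₀ - w) / -c'))) := fun w hw =>
      (hS.cont _ hw).tendsto.comp (((tendsto_id.mono_left hl).sub_const w).div_const (-c'))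
    have hu'' : ((c s₀ - c u) / -c').re ≠ 0 := by
      rw [← neg_sub, neg_div, Complex.neg_re]
      exact neg_ne_zero.2 hu'.ne'
    have hSv : S ((c s₀ - c (s₀ + δ)) / -c') ≠ 0 := hS.ne_zero fun h0 => by simp [h0] at hv
    have l1 := ((hright (s₀ + δ) (by linarith)).mul (hSt (c u) (Or.inr hu''))).div
      (hSt (c (s₀ + δ)) (Or.inr hv.ne')) hSv
    -- `S(-v) = j S(v)` applied to the reversed chord produces the factor `j`; the constant quotient
    -- along the arc does the rest.
    have e1 : bdRoot a b η U j s₀ u = U (c s₀) 1 (s₀ + δ) * S ((c s₀ - c u) / -c') /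
        S ((c s₀ - c (s₀ + δ)) / -c') := by
      rw [eq_div_iff hSv, bdRoot, if_neg (not_le.2 hu.2),
        show (c s₀ - c u) / -c' = -((c u - c s₀) / -c') by ring, hS.neg _ hu']
      have := root_ratio_arc h hU hS (convex_Icc _ _) hIx hre huI hs₀I hu.2 hs₀I hvI (by linarith)
      linear_combination j * this
    rw [e1]
    refine l1.congr' ?_
    have hSv' : ∀ᶠ z in l, S ((z - c (s₀ + δ)) / -c') ≠ 0 :=
      (hSt (c (s₀ + δ)) (Or.inr hv.ne')).eventually_ne hSv
    filter_upwards [hslit, self_mem_nhdsWithin, hSv'] with z hz hzl hz'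
    rw [Pi.div_apply, div_eq_iff hz']
    exact (root_ratio_slice h hU hS hreg hδx hz.1 (hlin z hzl) huI hvI).symm
  rcases lt_or_gt_of_ne hts with hlt | hgt
  swap
  · have := hright t hgt
    rwa [bdRoot, if_pos hgt.le]
  rcases le_or_gt (s₀ - δ) t with h1 | h1
  · exact hmid t ⟨h1, hlt⟩
  -- below `s₀ - δ`
  set I := Icc x (s₀ - δ) with hI
  have hIne : ∀ u ∈ I, x ≤ u ∧ s₀ ≠ u := fun u hu => ⟨hu.1, by have := hu.2; intro h2; linarith⟩
  have hb0 : ∀ u ∈ I, bdRoot a b η U j s₀ u ≠ 0 := fun u hu =>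
    bdRoot_ne_zero h hU hj hs₀.le hu.1 (hIne u hu).2
  have hbc : ContinuousOn (fun u => bdRoot a b η U j s₀ u) I :=
    (continuousOn_bdRoot h hU hj).comp (f := fun u => (s₀, u)) (by fun_prop) fun u hu =>
      ⟨hs₀.le, hu.1⟩
  obtain ⟨d, hd, hdI⟩ : ∃ d > 0, ∀ u ∈ I, d ≤ ‖c s₀ - c u‖ := by
    have hK : IsCompact (c '' I) :=
      isCompact_Icc.image_of_continuousOn (h.continuousOn_arcPt.mono Icc_subset_Ici_self)
    have hn : c s₀ ∉ c '' I := by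
      rintro ⟨u, hu, he⟩
      exact (hIne u hu).2 (h.arcPt_inj hu.1 hs₀.le he).symm
    obtain ⟨d, hd, hdK⟩ := Metric.isOpen_iff.1 hK.isClosed.isOpen_compl _ hn
    refine ⟨d, hd, fun u hu => ?_⟩
    by_contra! hlt
    refine hdK (a := c u) ?_ ⟨u, hu, rfl⟩
    rwa [Metric.mem_ball, dist_comm, dist_eq_norm]
  -- The square of the quotient differs from `1` by `(z - c(s₀)) / (c(s₀) - c(u))`, uniformly small
  -- on `I`, so the sign known at `s₀ - δ` persists down to `x`.
  have hWsq : ∀ z ∈ slitDom a b η μ 1 x ∩ {z | 0 < z.im}, ∀ u ∈ I,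
      ‖(U z 1 u / bdRoot a b η U j s₀ u) ^ 2 - 1‖ ≤ ‖z - c s₀‖ / d := by
    intro z hz u hu
    have hne : c s₀ - c u ≠ 0 := sub_ne_zero.2 fun he =>
      (hIne u hu).2 (h.arcPt_inj hs₀.le hu.1 he)
    have e1 : (U z 1 u / bdRoot a b η U j s₀ u) ^ 2 - 1 = (z - c s₀) / (c s₀ - c u) := by
      rw [div_pow, bdRoot_sq h hU hj hs₀.le hu.1, hU.sq _ (hdom z hz u hu.1)]
      have e2 : alpha a b (swept η 1 u) = c u := rfl
      rw [div_sub_one hne, e2]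
      congr 1
      ring
    rw [e1, norm_div]
    gcongr
    exact hdI u hu
  have ht3 : s₀ - δ ∈ I := ⟨hδx, le_rfl⟩
  have htI : t ∈ I := ⟨ht, h1.le⟩
  have hlim3 : Tendsto (fun z => U z 1 (s₀ - δ) / bdRoot a b η U j s₀ (s₀ - δ)) l (𝓝 1) := by
    have := (hmid (s₀ - δ) ⟨le_rfl, by linarith⟩).div_const (bdRoot a b η U j s₀ (s₀ - δ))
    rwa [div_self (hb0 _ ht3)] at this
  have hre3 : ∀ᶠ z in l, 0 < (U z 1 (s₀ - δ) / bdRoot a b η U j s₀ (s₀ - δ)).re :=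
    ((Complex.continuous_re.tendsto 1).comp hlim3).eventually (lt_mem_nhds (by simp))
  have hzd : Tendsto (fun z => ‖z - c s₀‖ / d) l (𝓝 0) := by
    have := (((tendsto_id (α := ℂ)).mono_left hl).sub_const (c s₀)).norm.div_const d
    simpa using this
  have hfin : Tendsto (fun z => U z 1 t / bdRoot a b η U j s₀ t) l (𝓝 1) := by
    rw [tendsto_iff_norm_sub_tendsto_zero]
    refine squeeze_zero' (.of_forall fun _ => norm_nonneg _) ?_ hzd
    filter_upwards [hslit, hre3, hzd.eventually (gt_mem_nhds one_pos)] with z hz hz3 hz1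
    have hUc : ContinuousOn (fun w => U z 1 w) I :=
      hU.cont.comp (f := fun w => (z, (1 : ℝ), w)) (by fun_prop) fun w hw => hdom z hz w hw.1
    have hpos := re_pos_of_sq_near_one isPreconnected_Icc (hUc.div hbc hb0)
      (fun u hu => (hWsq z hz u hu).trans_lt hz1) ht3 hz3 htI
    exact (norm_sub_one_le_of_re_pos hpos).trans (hWsq z hz t htI)
  have := hfin.mul_const (bdRoot a b η U j s₀ t)
  rw [one_mul] at this
  refine this.congr fun z => ?_
  rw [div_mul_cancel₀ _ (hb0 t htI)]

/-- The one-sided limits of the contour integral at regular points of the arc. -/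
theorem tendsto_integral_side (h : IsSwept a b η μ x T m W) (hU : IsRoot a b η μ x U)
    (hj : j ^ 2 = -1) (hS : IsSideSqrt S ε j) (hε : |ε| = 1) (hs₀ : x < s₀)
    (hreg : deriv (arcPt a b η) s₀ ≠ 0) {κ : ℝ} (hκ : 0 < κ) :
    Tendsto (fun z => ∫ t in Ioi x, sweptIntegrand a b η μ U z 1 t)
      (𝓝[{z | κ * ‖z - arcPt a b η s₀‖ <
      ε * ((z - arcPt a b η s₀) / -deriv (arcPt a b η) s₀).im}] (arcPt a b η s₀))
      (𝓝 (∫ t in Ioi x, bdIntegrand a b η μ U j s₀ t)) := by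
  obtain ⟨V, -, hV⟩ := h.exists_vel_bound
  have hslit := sideFilter_slitDom h hε hs₀ hreg hκ
  have hne : ∀ z ∈ slitDom a b η μ 1 x, z ≠ μ := fun z hz h' => hz.2 (Or.inl h')
  refine tendsto_integral_filter_of_dominated_convergence (bound := fun t => 9 * m t * V) ?_ ?_
    ((h.integrable.const_mul 9).mul_const V) ?_
  · filter_upwards [hslit] with z hz
    exact (integrableOn_sweptIntegrand h hU hz.1.1 (hne z hz.1) mem01 le_rfl fun t ht =>
      (mem_rootDom_of_slitDom hz.1 mem01 le_rfl le_rfl).2.2.2.2 t (le_of_lt ht)).aestronglyMeasurable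
  · filter_upwards [hslit] with z hz
    filter_upwards [ae_restrict_mem measurableSet_Ioi] with t ht
    exact norm_sweptIntegrand_le h hU hV hz.1.1 (hne z hz.1) mem01 (le_of_lt ht)
      (Or.inl (mem_rootDom_of_slitDom hz.1 mem01 le_rfl (le_of_lt ht)))
  · have hae : ∀ᵐ t ∂(volume.restrict (Ioi x)), t ≠ s₀ :=
      ae_restrict_of_ae (Measure.ae_ne volume s₀)
    filter_upwards [ae_restrict_mem measurableSet_Ioi, hae] with t ht hts
    have ht' : x ≤ t := le_of_lt ht
    have hz : Tendsto (fun z : ℂ => z) (𝓝[{z | κ * ‖z - arcPt a b η s₀‖ <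
        ε * ((z - arcPt a b η s₀) / -deriv (arcPt a b η) s₀).im}] (arcPt a b η s₀))
        (𝓝 (arcPt a b η s₀)) := tendsto_id.mono_left nhdsWithin_le_nhds
    have h1 := tendsto_root_side h hU hj hS hε hs₀ hreg hκ ht' hts
    have h2 := tendsto_upperSqrt (hz.sub_const (alphaTilde a b (swept η 1 t)))
      (Or.inl (h.arcPt_sub_tilde_im hs₀.le ht'))
    exact ((hz.sub_const (μ : ℂ)).add (h1.neg.mul h2)).mul_const (sweptVel η 1 t)

end
end

/-! ### The vertical contours in the definition of `f₀`. -/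

section
variable {E : Type*} [NormedAddCommGroup E]

theorem integrableOn_Ioi_comp_add {f : ℝ → E} {c d : ℝ} (hf : IntegrableOn f (Ioi (c + d))) :
    IntegrableOn (fun t => f (t + d)) (Ioi c) := by
  have h1 := ((measurePreserving_add_right volume d).integrableOn_comp_preimage
    (measurableEmbedding_addRight d) (f := f) (s := Ioi (c + d))).2 hf
  simpa [Function.comp_def] using h1

theorem integral_Ioi_comp_add [NormedSpace ℝ E] (f : ℝ → E) (c d : ℝ) :
    ∫ t in Ioi c, f (t + d) = ∫ t in Ioi (c + d), f t := by
  have h1 := (measurePreserving_add_right volume d).setIntegral_preimage_emb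
    (measurableEmbedding_addRight d) f (Ioi (c + d))
  simpa using h1

theorem contourFrom_of_le {w : ℂ} {t : ℝ} (ht : t ≤ |w.im|) :
    contourFrom w t = w.re + Complex.I * ((Real.sign w.im * (|w.im| - t) : ℝ) : ℂ) := by
  rw [contourFrom, max_eq_left (sub_nonpos.2 ht), max_eq_right (sub_nonneg.2 ht), add_zero]

theorem contourFrom_of_ge {w : ℂ} {t : ℝ} (ht : |w.im| ≤ t) :
    contourFrom w t = ((w.re + (t - |w.im|) : ℝ) : ℂ) := by
  rw [contourFrom, max_eq_right (sub_nonneg.2 ht), max_eq_left (sub_nonpos.2 ht)]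
  simp

theorem hasDerivAt_contourFrom_of_lt {w : ℂ} {t : ℝ} (ht : t < |w.im|) :
    HasDerivAt (contourFrom w) (-(Complex.I * Real.sign w.im)) t := by
  have h1 : HasDerivAt (fun t : ℝ => Real.sign w.im * (|w.im| - t)) (-Real.sign w.im) t := by
    simpa using ((hasDerivAt_id t).const_sub |w.im|).const_mul (Real.sign w.im)
  have h2 := (h1.ofReal_comp.const_mul Complex.I).const_add (w.re : ℂ)
  refine (h2.congr_of_eventuallyEq ?_).congr_deriv (by push_cast; ring)
  filter_upwards [Iio_mem_nhds ht] with u hu using contourFrom_of_le (le_of_lt hu)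

theorem hasDerivAt_contourFrom_of_gt {w : ℂ} {t : ℝ} (ht : |w.im| < t) :
    HasDerivAt (contourFrom w) 1 t := by
  have h1 : HasDerivAt (fun t : ℝ => w.re + (t - |w.im|)) 1 t := by
    simpa using ((hasDerivAt_id t).sub_const |w.im|).const_add w.re
  refine (h1.ofReal_comp.congr_of_eventuallyEq ?_).congr_deriv (by simp)
  filter_upwards [Ioi_mem_nhds ht] with u hu using contourFrom_of_ge (le_of_lt hu)

end

section
variable {a b : ℂ → ℂ} {η : ℝ → ℝ} {μ x T : ℝ} {m : ℝ → ℝ} {W : Set ℂ}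
  {U : ℂ → ℝ → ℝ → ℂ} {j : ℂ} {s : ℝ}

theorem real_sign_mul_abs (r : ℝ) : Real.sign r * |r| = r := by
  rcases lt_trichotomy r 0 with h | h | h
  · rw [Real.sign_of_neg h, abs_of_neg h]; ring
  · simp [h]
  · rw [Real.sign_of_pos h, abs_of_pos h, one_mul]

theorem swept_one_im (η : ℝ → ℝ) (s : ℝ) : (swept η 1 s).im = η s := by simp [swept]

/-- The vertical segment is the edge of the swept region over `s`, traversed from `σ = 1` to `σ =
0`. When `η s = 0` the quotient is read as `0`, which is the correct `σ`. -/
theorem contourFrom_swept (η : ℝ → ℝ) (s : ℝ) {t : ℝ} (ht : 0 ≤ t) :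
    contourFrom (swept η 1 s) t =
      swept η (max 0 (|η s| - t) / |η s|) (s + max 0 (t - |η s|)) := by
  rcases le_or_gt |η s| t with h1 | h1
  · rw [contourFrom_of_ge (by rwa [swept_one_im]), swept_re, swept_one_im,
      max_eq_left (sub_nonpos.2 h1), zero_div, swept_zero, max_eq_right (sub_nonneg.2 h1)]
  · rw [contourFrom_of_le (by rw [swept_one_im]; exact h1.le), swept_re, swept_one_im,
      max_eq_right (sub_nonneg.2 h1.le), max_eq_left (sub_nonpos.2 h1.le), add_zero, swept]
    have h2 : |η s| ≠ 0 := (ht.trans_lt h1).ne'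
    congr 3
    rw [div_mul_eq_mul_div, eq_div_iff h2, mul_right_comm, real_sign_mul_abs]
    ring

section
variable (h : IsSwept a b η μ x T m W) (hU : IsRoot a b η μ x U)
include h

/-- A contour point has real part `t`, and `α` is injective on the swept region, so `c(s)` is met at
the parameter `s` at most. -/
theorem IsSwept.arcPt_mem_rootDom_or (hs : x ≤ s) {σ t : ℝ} (hσ : σ ∈ Icc (0 : ℝ) 1) (ht : s ≤ t) :
    (arcPt a b η s, σ, t) ∈ rootDom a b η μ x ∨ arcPt a b η s = alpha a b (swept η σ t) := by
  by_cases h0 : arcPt a b η s = alpha a b (swept η σ t)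
  · exact Or.inr h0
  · refine Or.inl ⟨(h.arcPt_im hs).le, h.arcPt_ne_mu hs, hσ, hs.trans ht, fun u hu he => h0 ?_⟩
    have htu : t ≤ u := hu
    have h1 := congrArg Complex.re
      (h.inj 1 mem01 s hs σ hσ u (hs.trans (ht.trans htu)) he)
    rw [swept_re, swept_re] at h1
    have h2 : u = t := le_antisymm (by linarith) htu
    rw [← h2]
    exact he

include hU

theorem continuousOn_sweptRadical_arc (hs : x ≤ s) :
    ContinuousOn (fun p : ℝ × ℝ => sweptRadical a b η U (arcPt a b η s) p.1 p.2)
      (Icc 0 1 ×ˢ Ici s) := by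
  set z := arcPt a b η s with hz
  have hA : ContinuousOn (fun p : ℝ × ℝ => alpha a b (swept η p.1 p.2)) (Icc 0 1 ×ˢ Ici s) :=
    h.continuousOn_alpha.mono (prod_mono_right (Ici_subset_Ici.2 hs))
  have hB : ContinuousOn (fun p : ℝ × ℝ => alphaTilde a b (swept η p.1 p.2)) (Icc 0 1 ×ˢ Ici s) :=
    h.continuousOn_tilde.mono (prod_mono_right (Ici_subset_Ici.2 hs))
  intro p hp
  by_cases h0 : z = alpha a b (swept η p.1 p.2)
  · have hv : sweptRadical a b η U z p.1 p.2 = 0 := by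
      rw [h0, sweptRadical, hU.zero]; simp
    rw [ContinuousWithinAt, hv]
    refine tendsto_zero_of_sq ?_
    have hq := ((continuousOn_const (c := z)).sub hA).mul ((continuousOn_const (c := z)).sub hB) p hp
    rw [ContinuousWithinAt] at hq
    simp only [Pi.mul_apply, Pi.sub_apply, ← h0, sub_self, zero_mul] at hq
    refine hq.congr' ?_
    filter_upwards [self_mem_nhdsWithin] with q hq
    exact (sweptRadical_sq hU (h.arcPt_mem_rootDom_or hs hq.1 hq.2)).symm
  · have hev : ∀ᶠ q in 𝓝[Icc 0 1 ×ˢ Ici s] p, z ≠ alpha a b (swept η q.1 q.2) :=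
      ((hA p hp).eventually_ne (Ne.symm h0)).mono fun q hq => Ne.symm hq
    have hmem := (h.arcPt_mem_rootDom_or hs hp.1 hp.2).resolve_right h0
    refine Tendsto.comp (g := fun q : ℂ × ℝ × ℝ => sweptRadical a b η U q.1 q.2.1 q.2.2)
      (f := fun q : ℝ × ℝ => (z, q.1, q.2)) ((continuousOn_sweptRadical h hU) _ hmem).tendsto
      (tendsto_nhdsWithin_iff.2 ⟨?_, ?_⟩)
    · have : Continuous fun q : ℝ × ℝ => (z, q.1, q.2) := by fun_prop
      exact (this.tendsto p).mono_left nhdsWithin_le_nhds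
    · filter_upwards [hev, self_mem_nhdsWithin] with q h1 h2
      exact (h.arcPt_mem_rootDom_or hs h2.1 h2.2).resolve_right h1

/-- Deformation of the contour to the real axis, for a point of the arc. -/
theorem integral_swept_sub_arc (hs : x ≤ s) :
    (∫ t in Ioi s, sweptIntegrand a b η μ U (arcPt a b η s) 1 t) -
      ∫ t in Ioi s, sweptIntegrand a b η μ U (arcPt a b η s) 0 t =
      -∫ σ in (0 : ℝ)..1, (arcPt a b η s - μ + sweptRadical a b η U (arcPt a b η s) σ s) *
        (Complex.I * η s) := by
  set z := arcPt a b η s with hz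
  have hzi := (h.arcPt_im hs).le
  have hzμ := h.arcPt_ne_mu hs
  have hne : ∀ σ ∈ Icc (0 : ℝ) 1, ∀ t > s, z ≠ alpha a b (swept η σ t) := by
    intro σ hσ t ht he
    have h1 := congrArg Complex.re (h.inj 1 mem01 s hs σ hσ t (hs.trans (le_of_lt ht)) he)
    rw [swept_re, swept_re] at h1
    exact (ne_of_gt ht) h1.symm
  have hint : ∀ σ ∈ Icc (0 : ℝ) 1, IntegrableOn (sweptIntegrand a b η μ U z σ) (Ioi s) :=
    fun σ hσ => integrableOn_sweptIntegrand h hU hzi hzμ hσ hs (hne σ hσ)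
  have hl : ∀ σ ∈ Icc (0 : ℝ) 1, Tendsto (fun u => ∫ t in Ioi u, sweptIntegrand a b η μ U z σ t)
      (𝓝[>] s) (𝓝 (∫ t in Ioi s, sweptIntegrand a b η μ U z σ t)) := by
    intro σ hσ
    have hc : ContinuousOn (fun u => ∫ t in s..u, sweptIntegrand a b η μ U z σ t) (Icc s (s + 1)) := by
      have := intervalIntegral.continuousOn_primitive_interval (a := s) (b := s + 1) (μ := volume)
        (f := sweptIntegrand a b η μ U z σ) (by
          rw [uIcc_of_le (by linarith), integrableOn_Icc_iff_integrableOn_Ioc]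
          exact (hint σ hσ).mono_set Ioc_subset_Ioi_self)
      rwa [uIcc_of_le (by linarith)] at this
    have h1 := (hc s ⟨le_rfl, by linarith⟩).mono_of_mem_nhdsWithin (s := Ioi s)
      (Icc_mem_nhdsGT (by linarith))
    rw [ContinuousWithinAt, intervalIntegral.integral_same] at h1
    have h2 := (tendsto_const_nhds (x := ∫ t in Ioi s, sweptIntegrand a b η μ U z σ t)).sub h1
    rw [sub_zero] at h2
    refine h2.congr' ?_
    filter_upwards [self_mem_nhdsWithin] with u hu
    rw [← intervalIntegral.integral_interval_add_Ioi (hint σ hσ)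
      ((hint σ hσ).mono_set (Ioi_subset_Ioi (le_of_lt hu)))]
    ring
  have hr : Tendsto (fun u => -∫ σ in (0 : ℝ)..1, (z - μ + sweptRadical a b η U z σ u) *
      (Complex.I * η u)) (𝓝[>] s) (𝓝 (-∫ σ in (0 : ℝ)..1, (z - μ + sweptRadical a b η U z σ s) *
      (Complex.I * η s))) := by
    have hg : ContinuousOn (fun p : ℝ × ℝ => (z - μ + sweptRadical a b η U z p.1 p.2) *
        (Complex.I * η p.2)) (Icc 0 1 ×ˢ Ici s) := by
      refine (continuousOn_const.add (continuousOn_sweptRadical_arc h hU hs)).mul ?_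
      have := h.smooth.continuous
      fun_prop
    obtain ⟨M, hM⟩ := (isCompact_Icc.prod (isCompact_Icc (a := s) (b := s + 1))).exists_bound_of_continuousOn
      (hg.mono (prod_mono_right Icc_subset_Ici_self))
    refine (intervalIntegral.tendsto_integral_filter_of_dominated_convergence (fun _ => M) ?_ ?_
      (by simp) ?_).neg
    · filter_upwards [self_mem_nhdsWithin] with u hu
      rw [uIoc_of_le zero_le_one]
      refine ContinuousOn.aestronglyMeasurable ?_ measurableSet_Ioc
      exact hg.comp (f := fun σ : ℝ => (σ, u)) (by fun_prop) fun σ hσ =>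
        ⟨Ioc_subset_Icc_self hσ, Ioi_subset_Ici_self hu⟩
    · filter_upwards [Icc_mem_nhdsGT (show s < s + 1 by linarith)] with u hu
      refine .of_forall fun σ hσ => hM (σ, u) ⟨?_, hu⟩
      rw [uIoc_of_le zero_le_one] at hσ
      exact Ioc_subset_Icc_self hσ
    · refine .of_forall fun σ hσ => ?_
      rw [uIoc_of_le zero_le_one] at hσ
      have := hg.comp (f := fun u : ℝ => (σ, u)) (s := Ici s) (by fun_prop) (fun u hu =>
        ⟨Ioc_subset_Icc_self hσ, hu⟩) s self_mem_Ici
      exact (this.mono Ioi_subset_Ici_self).tendsto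
  -- At `s` itself `z` is met by `α`, so the deformation is made from `u > s` and `u` tends to `s`.
  refine tendsto_nhds_unique ((hl 1 mem01).sub (hl 0 mem00)) (hr.congr' ?_)
  filter_upwards [self_mem_nhdsWithin] with u hu
  have hu' : s < u := hu
  refine (integral_swept_sub h hU fun σ hσ => ?_).symm
  exact ⟨hzi, hzμ, hσ, hs.trans hu'.le, fun t ht => hne σ hσ t (hu'.trans_le ht)⟩

/-- The branch of the radical along the contour from a point of the arc. -/
theorem isRadicalBranch_contourFrom (hs : x ≤ s) :
    IsRadicalBranch a b μ (contourFrom (swept η 1 s)) 0 (arcPt a b η s)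
      (fun t => sweptRadical a b η U (arcPt a b η s) (max 0 (|η s| - t) / |η s|)
        (s + max 0 (t - |η s|))) := by
  have hσ : ∀ t ≥ (0 : ℝ), max 0 (|η s| - t) / |η s| ∈ Icc (0 : ℝ) 1 := fun t ht =>
    ⟨by positivity, div_le_one_of_le₀ (max_le (abs_nonneg _) (by linarith)) (abs_nonneg _)⟩
  refine ⟨?_, fun t ht => ?_, ?_⟩
  · exact (continuousOn_sweptRadical_arc h hU hs).comp
      (f := fun t => (max 0 (|η s| - t) / |η s|, s + max 0 (t - |η s|))) (by fun_prop)
      fun t ht => ⟨hσ t ht, by simp⟩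
  · rw [contourFrom_swept η s ht]
    exact sweptRadical_sq hU (h.arcPt_mem_rootDom_or hs (hσ t ht) (by simp))
  · have h1 := (tendsto_sweptRadical h hU (h.arcPt_im hs).le (h.arcPt_ne_mu hs) mem00).comp
      (tendsto_atTop_add_const_left atTop (s - |η s|) tendsto_id)
    refine h1.congr' ?_
    filter_upwards [eventually_ge_atTop |η s|] with t ht
    rw [max_eq_left (sub_nonpos.2 ht), zero_div, max_eq_right (sub_nonneg.2 ht)]
    simp only [Function.comp, id]
    congr 1
    ring

omit hU in
theorem contourFrom_ne (hs : x ≤ s) {t : ℝ} (ht : 0 < t) :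
    arcPt a b η s ≠ alpha a b (contourFrom (swept η 1 s) t) ∧
      arcPt a b η s ≠ alphaTilde a b (contourFrom (swept η 1 s) t) := by
  rw [contourFrom_swept η s ht.le]
  have hσ : max 0 (|η s| - t) / |η s| ∈ Icc (0 : ℝ) 1 :=
    ⟨by positivity, div_le_one_of_le₀ (max_le (abs_nonneg _) (by linarith)) (abs_nonneg _)⟩
  have hx : x ≤ s + max 0 (t - |η s|) := by
    have := le_max_left 0 (t - |η s|)
    linarith
  refine ⟨fun he => ?_, h.ne_tilde (h.arcPt_im hs).le hσ hx⟩
  have h1 := h.inj 1 mem01 s hs _ hσ _ hx he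
  have h2 := congrArg Complex.re h1
  rw [swept_re, swept_re] at h2
  have h3 : max 0 (t - |η s|) = 0 := by linarith
  rw [h3, add_zero] at h1
  have h4 := congrArg Complex.im h1
  have h5 : t ≤ |η s| := by
    have := le_max_right 0 (t - |η s|)
    linarith
  have h6 : |η s| ≠ 0 := (ht.trans_le h5).ne'
  rw [max_eq_right (sub_nonneg.2 h5)] at h4
  simp only [swept, Complex.add_im, Complex.ofReal_im, Complex.mul_im, Complex.I_re, Complex.I_im,
    Complex.ofReal_re] at h4
  have h7 : η s * (1 - (|η s| - t) / |η s|) = 0 := by linarith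
  rcases mul_eq_zero.1 h7 with h8 | h8
  · exact h6 (by rw [h8, abs_zero])
  · field_simp at h8
    linarith

theorem integrand_contourFrom (hs : x ≤ s) :
    (∀ t ∈ Ioo 0 |η s|, integrand a b μ (contourFrom (swept η 1 s)) 0 (arcPt a b η s) t =
      (arcPt a b η s - μ + sweptRadical a b η U (arcPt a b η s) ((|η s| - t) / |η s|) s) *
        -(Complex.I * Real.sign (η s))) ∧
    ∀ t > |η s|, integrand a b μ (contourFrom (swept η 1 s)) 0 (arcPt a b η s) t =
      sweptIntegrand a b η μ U (arcPt a b η s) 0 (t + (s - |η s|)) := by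
  have hr := radical_eqOn (isRadicalBranch_contourFrom h hU hs) (h.arcPt_ne_mu hs)
    (fun t ht => contourFrom_ne h hs ht)
  refine ⟨fun t ht => ?_, fun t ht => ?_⟩
  · rw [integrand, hr (le_of_lt ht.1), (hasDerivAt_contourFrom_of_lt
      (by rw [swept_one_im]; exact ht.2)).deriv, swept_one_im]
    simp only []
    rw [max_eq_right (sub_nonneg.2 ht.2.le), max_eq_left (sub_nonpos.2 ht.2.le), add_zero]
  · have ht0 : 0 ≤ t := (abs_nonneg _).trans (le_of_lt ht)
    rw [integrand, hr ht0, (hasDerivAt_contourFrom_of_gt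
      (by rw [swept_one_im]; exact ht)).deriv]
    simp only []
    rw [max_eq_left (sub_nonpos.2 (le_of_lt ht)), zero_div,
      max_eq_right (sub_nonneg.2 (le_of_lt ht)), sweptIntegrand, sweptVel_zero]
    congr 3
    ring

theorem integrableOn_sweptIntegrand_arc (hs : x ≤ s) {σ : ℝ} (hσ : σ ∈ Icc (0 : ℝ) 1) :
    IntegrableOn (sweptIntegrand a b η μ U (arcPt a b η s) σ) (Ioi s) := by
  refine integrableOn_sweptIntegrand h hU (h.arcPt_im hs).le (h.arcPt_ne_mu hs) hσ hs
    fun t ht he => ?_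
  have h1 := congrArg Complex.re (h.inj 1 mem01 s hs σ hσ t (hs.trans (le_of_lt ht)) he)
  rw [swept_re, swept_re] at h1
  exact (ne_of_gt ht) h1.symm

/-- The descent to the real axis contributes exactly the edge term of `integral_swept_sub_arc`, so
the contour in `f₀` may be replaced by the part of `Λ` beyond `s`. -/
theorem integral_contourFrom_arc (hs : x ≤ s) :
    IntegrableOn (integrand a b μ (contourFrom (swept η 1 s)) 0 (arcPt a b η s)) (Ioi 0) ∧
    ∫ t in Ioi (0 : ℝ), integrand a b μ (contourFrom (swept η 1 s)) 0 (arcPt a b η s) t =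
      ∫ t in Ioi s, sweptIntegrand a b η μ U (arcPt a b η s) 1 t := by
  obtain ⟨e1, e2⟩ := integrand_contourFrom h hU hs
  set F := integrand a b μ (contourFrom (swept η 1 s)) 0 (arcPt a b η s)
  set z := arcPt a b η s with hz
  have hR : ContinuousOn (fun σ => z - μ + sweptRadical a b η U z σ s) (Icc 0 1) :=
    continuousOn_const.add ((continuousOn_sweptRadical_arc h hU hs).comp
      (f := fun σ : ℝ => (σ, s)) (by fun_prop) fun σ hσ => ⟨hσ, self_mem_Ici⟩)
  have i2 : IntegrableOn F (Ioi |η s|) := by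
    have h1 := integrableOn_Ioi_comp_add (c := |η s|) (d := s - |η s|)
      (f := sweptIntegrand a b η μ U z 0) (by
        rw [add_sub_cancel]
        exact integrableOn_sweptIntegrand_arc h hU hs mem00)
    exact h1.congr_fun (fun t ht => (e2 t ht).symm) measurableSet_Ioi
  have v2 : ∫ t in Ioi |η s|, F t = ∫ t in Ioi s, sweptIntegrand a b η μ U z 0 t := by
    rw [setIntegral_congr_fun measurableSet_Ioi (fun t ht => e2 t ht), integral_Ioi_comp_add,
      add_sub_cancel]
  have hc : ContinuousOn (fun t => (z - μ + sweptRadical a b η U z ((|η s| - t) / |η s|) s) *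
        -(Complex.I * Real.sign (η s))) (Icc 0 |η s|) := by
    refine (hR.comp (f := fun t => (|η s| - t) / |η s|) (by fun_prop) fun t ht => ?_).mul
      continuousOn_const
    exact ⟨div_nonneg (by linarith [ht.2]) (abs_nonneg _),
      div_le_one_of_le₀ (by linarith [ht.1]) (abs_nonneg _)⟩
  have i1 : IntervalIntegrable F volume 0 |η s| := by
    rw [intervalIntegrable_iff_integrableOn_Ioo_of_le (abs_nonneg _)]
    exact ((hc.integrableOn_Icc).mono_set Ioo_subset_Icc_self).congr_fun
      (fun t ht => (e1 t ht).symm) measurableSet_Ioo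
  have v1 : ∫ t in (0 : ℝ)..|η s|, F t =
      -∫ σ in (0 : ℝ)..1, (z - μ + sweptRadical a b η U z σ s) * (Complex.I * η s) := by
    rw [intervalIntegral.integral_of_le (abs_nonneg _), 
      integral_Ioc_eq_integral_Ioo, setIntegral_congr_fun measurableSet_Ioo e1,
      ← integral_Ioc_eq_integral_Ioo, ← intervalIntegral.integral_of_le (abs_nonneg _)]
    rw [intervalIntegral.integral_mul_const, intervalIntegral.integral_mul_const]
    rcases eq_or_ne (η s) 0 with h0 | h0
    · simp [h0]
    · have h1 : |η s| ≠ 0 := abs_ne_zero.2 h0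
      have h2 : ∀ t : ℝ, (|η s| - t) / |η s| = 1 - t / |η s| := fun t => by field_simp
      simp only [h2]
      rw [intervalIntegral.integral_comp_sub_div
        (fun σ => z - μ + sweptRadical a b η U z σ s) h1, div_self h1, sub_self, zero_div, sub_zero,
        Complex.real_smul]
      have h3 : ((Real.sign (η s) : ℝ) : ℂ) * (|η s| : ℝ) = (η s : ℂ) := by
        rw [← Complex.ofReal_mul, real_sign_mul_abs]
      rw [← h3]
      ring
  have i0 : IntegrableOn F (Ioi 0) := by
    rw [← Ioc_union_Ioi_eq_Ioi (abs_nonneg (η s))]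
    exact ((intervalIntegrable_iff_integrableOn_Ioc_of_le (abs_nonneg _)).1 i1).union i2
  refine ⟨i0, ?_⟩
  rw [← intervalIntegral.integral_interval_add_Ioi i0 i2, v1, v2,
    ← integral_swept_sub_arc h hU hs]
  ring

end
end

/-! ### Analyticity of `g` and `R` off the arc and at infinity. -/

section
variable {a b : ℂ → ℂ} {η : ℝ → ℝ} {μ x T k : ℝ} {m : ℝ → ℝ} {W : Set ℂ}
  {U : ℂ → ℝ → ℝ → ℂ} {j : ℂ} {z : ℂ}

/-- Applied with `q = |z - α|²`, this makes the radical real for real `z` and real `y`, the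
condition needed for reflection. -/
theorem im_eq_zero_of_sq_eq {r : ℂ} {q : ℝ} (hq : 0 ≤ q) (hr : r ^ 2 = q) : r.im = 0 := by
  have h1 : (r - Real.sqrt q) * (r + Real.sqrt q) = 0 := by
    have : ((Real.sqrt q : ℝ) : ℂ) ^ 2 = q := by
      rw [← Complex.ofReal_pow, Real.sq_sqrt hq]
    linear_combination hr - this
  rcases mul_eq_zero.1 h1 with h2 | h2
  · rw [sub_eq_zero.1 h2, Complex.ofReal_im]
  · rw [eq_neg_of_add_eq_zero_left h2, Complex.neg_im, Complex.ofReal_im, neg_zero]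

theorem conj_mem_mainArc {c : ℝ → ℂ} (hz : z ∈ mainArc μ x c) : conj z ∈ mainArc μ x c := by
  rcases hz with (hz | ⟨s, hs, rfl⟩) | ⟨s, hs, rfl⟩
  · rw [mem_singleton_iff] at hz
    exact Or.inl (Or.inl (by rw [hz, Complex.conj_ofReal]; rfl))
  · exact Or.inr ⟨s, hs, rfl⟩
  · exact Or.inl (Or.inr ⟨s, hs, (Complex.conj_conj _).symm⟩)

theorem conj_notMem_mainArc {c : ℝ → ℂ} (hz : z ∉ mainArc μ x c) : conj z ∉ mainArc μ x c :=
  fun h => hz (by simpa using conj_mem_mainArc h)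

namespace IsSwept
variable (h : IsSwept a b η μ x T m W)
include h

theorem isCompact_mainArc : IsCompact (mainArc μ x (arcPt a b η)) := by
  have h1 := h.isCompact_slit mem01 le_rfl
  have h2 := h1.union (h1.image Complex.continuous_conj)
  convert h2 using 1
  ext z
  simp only [mainArc, mem_union, mem_singleton_iff, mem_insert_iff, mem_image, arcPt]
  constructor
  · rintro ((h | ⟨s, hs, h⟩) | ⟨s, hs, h⟩)
    · exact Or.inl (Or.inl h)
    · exact Or.inl (Or.inr ⟨s, hs, h⟩)
    · exact Or.inr ⟨_, Or.inr ⟨s, hs, rfl⟩, h⟩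
  · rintro ((h | ⟨s, hs, h⟩) | ⟨w, (hw | ⟨s, hs, hw⟩), h⟩)
    · exact Or.inl (Or.inl h)
    · exact Or.inl (Or.inr ⟨s, hs, h⟩)
    · exact Or.inl (Or.inl (by rw [← h, hw, Complex.conj_ofReal]))
    · exact Or.inr ⟨s, hs, by rw [hw, h]⟩

theorem mem_slitDom_iff : z ∈ slitDom a b η μ 1 x ↔
    z ∈ (mainArc μ x (arcPt a b η))ᶜ ∩ {z | 0 ≤ z.im} := by
  constructor
  · rintro ⟨h1, h2⟩
    refine ⟨?_, h1⟩
    rintro ((h3 | ⟨s, hs, h3⟩) | ⟨s, hs, h3⟩)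
    · exact h2 (Or.inl h3)
    · exact h2 (Or.inr ⟨s, hs, h3⟩)
    · have h4 := h.arcPt_im hs
      have h5 : z.im = -(arcPt a b η s).im := by rw [← h3, Complex.conj_im]
      linarith
  · rintro ⟨h1, h2⟩
    refine ⟨h2, ?_⟩
    rintro (h3 | ⟨s, hs, h3⟩)
    · exact h1 (Or.inl (Or.inl h3))
    · exact h1 (Or.inl (Or.inr ⟨s, hs, h3⟩))

theorem slitDom_inter : slitDom a b η μ 1 x ∩ {z | 0 < z.im} =
    (mainArc μ x (arcPt a b η))ᶜ ∩ {z | 0 < z.im} := by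
  ext z
  constructor
  · rintro ⟨h1, h2⟩
    exact ⟨(h.mem_slitDom_iff.1 h1).1, h2⟩
  · rintro ⟨h1, h2⟩
    exact ⟨h.mem_slitDom_iff.2 ⟨h1, le_of_lt (show 0 < z.im from h2)⟩, h2⟩

theorem slitDom_eq : slitDom a b η μ 1 x = (mainArc μ x (arcPt a b η))ᶜ ∩ {z | 0 ≤ z.im} := by
  ext z
  exact h.mem_slitDom_iff

theorem ne_of_slitDom (hz : z ∈ slitDom a b η μ 1 x) {t : ℝ} (ht : t > x) :
    z ≠ alpha a b (swept η 1 t) ∧ z ≠ alphaTilde a b (swept η 1 t) :=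
  ⟨(mem_rootDom_of_slitDom hz mem01 le_rfl (le_of_lt ht)).2.2.2.2 t le_rfl,
    h.ne_tilde hz.1 mem01 (le_of_lt ht)⟩

end IsSwept

theorem ne_mu_of_slitDom (hz : z ∈ slitDom a b η μ 1 x) : z ≠ μ := fun h => hz.2 (Or.inl h)

theorem mem_slitDom_of_im_eq_zero (h : IsSwept a b η μ x T m W) (hz : z.im = 0) (hzμ : z ≠ μ) :
    z ∈ slitDom a b η μ 1 x := by
  refine ⟨hz.ge, ?_⟩
  rintro (h1 | ⟨s, hs, h1⟩)
  · exact hzμ h1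
  · have h2 := h.arcPt_im hs
    have h3 : arcPt a b η s = z := h1
    rw [h3] at h2
    exact h2.ne' hz

/-- The contour integral expression for `g` in terms of the continued radical. -/
noncomputable def gSwept (a b : ℂ → ℂ) (η : ℝ → ℝ) (μ k x : ℝ) (U : ℂ → ℝ → ℝ → ℂ) (z : ℂ) : ℂ :=
  -(1 / 2) * (-(∫ t in Ioi x, sweptIntegrand a b η μ U z 1 t) + μ * x) + (1 / 2) * k

section
variable (h : IsSwept a b η μ x T m W) (hU : IsRoot a b η μ x U)
include h hU

theorem isRadicalBranch_graph (hz : z ∈ slitDom a b η μ 1 x) :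
    IsRadicalBranch a b μ (graphContour η) x z (sweptRadical a b η U z 1) := by
  rw [← swept_one]
  exact isRadicalBranch_swept h hU hz.1 (ne_mu_of_slitDom hz) mem01 le_rfl fun t ht =>
    (h.ne_of_slitDom hz ht).1

theorem radical_graph (hz : z ∈ slitDom a b η μ 1 x) :
    EqOn (radical a b μ (graphContour η) x z) (sweptRadical a b η U z 1) (Ici x) :=
  radical_eqOn (isRadicalBranch_graph h hU hz) (ne_mu_of_slitDom hz) fun t ht => by
    rw [← swept_one]; exact h.ne_of_slitDom hz ht

theorem integrand_graph (hz : z ∈ slitDom a b η μ 1 x) :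
    EqOn (integrand a b μ (graphContour η) x z) (sweptIntegrand a b η μ U z 1) (Ici x) := by
  intro t ht
  rw [integrand, radical_graph h hU hz ht, sweptIntegrand, deriv_graphContour h.smooth]

theorem integrableOn_graph (hz : z ∈ slitDom a b η μ 1 x) :
    IntegrableOn (integrand a b μ (graphContour η) x z) (Ioi x) :=
  (integrableOn_sweptIntegrand h hU hz.1 (ne_mu_of_slitDom hz) mem01 le_rfl fun _ ht =>
    (h.ne_of_slitDom hz ht).1).congr_fun (fun _ ht =>
      (integrand_graph h hU hz (Ioi_subset_Ici_self ht)).symm) measurableSet_Ioi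

theorem gUpper_eq (hz : z ∈ slitDom a b η μ 1 x) :
    gUpper a b μ k η x z = gSwept a b η μ k x U z := by
  rw [gUpper, gSwept, setIntegral_congr_fun measurableSet_Ioi fun _ ht =>
    integrand_graph h hU hz (Ioi_subset_Ici_self ht)]

theorem sweptRadical_zero_im (hz : z.im = 0) (hzμ : z ≠ μ) {t : ℝ} (ht : x ≤ t) :
    (sweptRadical a b η U z 0 t).im = 0 := by
  have hmem : (z, (0 : ℝ), t) ∈ rootDom a b η μ x := by
    refine ⟨hz.ge, hzμ, mem00, ht, fun u hu he => ?_⟩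
    have h1 := h.upper _ (h.mem 0 mem00 u (le_trans (show x ≤ t from ht) hu))
    rw [← he] at h1
    exact h1.ne' hz
  refine im_eq_zero_of_sq_eq (Complex.normSq_nonneg (z - alpha a b t)) ?_
  rw [sweptRadical_sq hU (Or.inl hmem), Complex.normSq_eq_conj_mul_self, swept_zero, h.conj_real,
    map_sub, conj_eq_self_of_im hz, mul_comm]

/-- Move the contour to the real axis; the edge term vanishes because `η x = 0`. There the integrand
is real for real `z`. -/
theorem gSwept_im (hz : z.im = 0) (hzμ : z ≠ μ) : (gSwept a b η μ k x U z).im = 0 := by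
  have hd := integral_swept_sub h hU (z := z) (s := x) fun σ hσ => by
    refine ⟨hz.ge, hzμ, hσ, le_rfl, fun u hu he => ?_⟩
    have h1 := h.upper _ (h.mem σ hσ u hu)
    rw [← he] at h1
    exact h1.ne' hz
  simp only [h.start, Complex.ofReal_zero, mul_zero, intervalIntegral.integral_zero, neg_zero] at hd
  have hc : conj (∫ t in Ioi x, sweptIntegrand a b η μ U z 0 t) =
      ∫ t in Ioi x, sweptIntegrand a b η μ U z 0 t := by
    rw [← integral_conj]
    refine setIntegral_congr_fun measurableSet_Ioi fun t ht => ?_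
    refine Complex.conj_eq_iff_im.2 ?_
    rw [sweptIntegrand, sweptVel_zero, mul_one, Complex.add_im, Complex.sub_im, hz,
      Complex.ofReal_im, sweptRadical_zero_im h hU hz hzμ (le_of_lt ht)]
    simp
  rw [Complex.conj_eq_iff_im] at hc
  rw [gSwept, sub_eq_zero.1 hd]
  simp [hc]

theorem differentiableOn_g :
    DifferentiableOn ℂ (g a b μ k η x) (mainArc μ x (arcPt a b η))ᶜ := by
  have hcg : ContinuousOn (gSwept a b η μ k x U) (slitDom a b η μ 1 x) := by
    have := continuousOn_integral_swept h hU mem01 (le_refl x)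
    unfold gSwept
    fun_prop
  have hdg : DifferentiableOn ℂ (gSwept a b η μ k x U) (slitDom a b η μ 1 x ∩ {z | 0 < z.im}) := by
    have := differentiableOn_integral_swept h hU mem01 (le_refl x)
    unfold gSwept
    fun_prop
  refine differentiableOn_reflect h.isCompact_mainArc.isClosed.isOpen_compl
    (fun z hz => conj_notMem_mainArc hz) ?_ (fun z hz hz0 => ?_) ?_
  · rw [← h.slitDom_eq]
    exact hcg.congr fun z hz => gUpper_eq h hU hz
  · have hz' := h.mem_slitDom_iff.2 ⟨hz, hz0.ge⟩
    rw [gUpper_eq h hU hz']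
    exact gSwept_im h hU hz0 (ne_mu_of_slitDom hz')
  · rw [← h.slitDom_inter]
    exact hdg.congr fun z hz => gUpper_eq h hU hz.1

theorem g_bounded : ∃ M, ∀ z ∈ (mainArc μ x (arcPt a b η))ᶜ, ‖g a b μ k η x z‖ ≤ M := by
  obtain ⟨V, -, hV⟩ := h.exists_vel_bound
  have key : ∀ z ∈ slitDom a b η μ 1 x, ‖gUpper a b μ k η x z‖ ≤
      1 / 2 * ((∫ t in Ioi x, 9 * m t * V) + ‖(μ * x : ℂ)‖) + 1 / 2 * ‖(k : ℂ)‖ := by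
    intro z hz
    rw [gUpper_eq h hU hz, gSwept]
    refine (norm_add_le _ _).trans (add_le_add ?_ (by simp))
    rw [norm_mul]
    refine mul_le_mul (by simp) ((norm_add_le _ _).trans (add_le_add ?_ le_rfl)) (norm_nonneg _)
      (by norm_num)
    rw [norm_neg]
    refine norm_integral_le_of_norm_le ((h.integrable.const_mul 9).mul_const V) ?_
    filter_upwards [ae_restrict_mem measurableSet_Ioi] with t ht
    exact norm_sweptIntegrand_le h hU hV hz.1 (ne_mu_of_slitDom hz) mem01 (le_of_lt ht)
      (Or.inl (mem_rootDom_of_slitDom hz mem01 le_rfl (le_of_lt ht)))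
  refine ⟨1 / 2 * ((∫ t in Ioi x, 9 * m t * V) + ‖(μ * x : ℂ)‖) + 1 / 2 * ‖(k : ℂ)‖,
    fun z hz => ?_⟩
  rw [g]
  split_ifs with h0
  · exact key z (h.mem_slitDom_iff.2 ⟨hz, h0⟩)
  · rw [RCLike.norm_conj]
    refine key _ (h.mem_slitDom_iff.2 ⟨conj_notMem_mainArc hz, ?_⟩)
    simp only [mem_ofPred, Complex.conj_im]
    linarith

theorem differentiableOn_R :
    DifferentiableOn ℂ (R a b μ η x) (mainArc μ x (arcPt a b η))ᶜ := by
  have e : ∀ z ∈ slitDom a b η μ 1 x, radical a b μ (graphContour η) x z x =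
      sweptRadical a b η U z 1 x := fun z hz => radical_graph h hU hz self_mem_Ici
  refine differentiableOn_reflect h.isCompact_mainArc.isClosed.isOpen_compl
    (f := fun z => radical a b μ (graphContour η) x z x)
    (fun z hz => conj_notMem_mainArc hz) ?_ (fun z hz hz0 => ?_) ?_
  · rw [← h.slitDom_eq]
    refine ContinuousOn.congr ?_ e
    exact (continuousOn_sweptRadical h hU).comp (f := fun z => (z, (1 : ℝ), x)) (by fun_prop)
      fun z hz => mem_rootDom_of_slitDom hz mem01 le_rfl le_rfl
  · have hz' := h.mem_slitDom_iff.2 ⟨hz, hz0.ge⟩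
    simp only [e z hz']
    refine im_eq_zero_of_sq_eq (Complex.normSq_nonneg (z - alpha a b x)) ?_
    have ex : swept η 1 x = x := by simp [swept, h.start]
    rw [sweptRadical_sq hU (Or.inl (mem_rootDom_of_slitDom hz' mem01 le_rfl le_rfl)),
      Complex.normSq_eq_conj_mul_self, ex, h.conj_real, map_sub, conj_eq_self_of_im hz0, mul_comm]
  · rw [← h.slitDom_inter]
    exact (differentiableOn_sweptRadical h hU mem01 le_rfl le_rfl).congr fun z hz => e z hz.1

theorem R_sq (hz : z ∉ mainArc μ x (arcPt a b η)) :
    R a b μ η x z ^ 2 = (z - alpha a b x) * (z - conj (alpha a b x)) := by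
  have ex : swept η 1 x = x := by simp [swept, h.start]
  have key : ∀ z ∈ slitDom a b η μ 1 x, radical a b μ (graphContour η) x z x ^ 2 =
      (z - alpha a b x) * (z - conj (alpha a b x)) := by
    intro z hz
    rw [radical_graph h hU hz self_mem_Ici, sweptRadical_sq hU
      (Or.inl (mem_rootDom_of_slitDom hz mem01 le_rfl le_rfl)), ex, h.conj_real]
  rw [R]
  split_ifs with h0
  · exact key z (h.mem_slitDom_iff.2 ⟨hz, h0⟩)
  · rw [← map_pow, key _ (h.mem_slitDom_iff.2 ⟨conj_notMem_mainArc hz, by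
      simp only [mem_ofPred, Complex.conj_im]; linarith⟩)]
    simp only [map_mul, map_sub, Complex.conj_conj]
    ring

/-- The uniform bound at `t = x` keeps `R + z - μ` bounded as `z → ∞`. -/
theorem tendsto_R_div : Tendsto (fun z => R a b μ η x z / z) (cocompact ℂ) (𝓝 (-1)) := by
  have hm := h.isCompact_mainArc.compl_mem_cocompact
  have hb : ∀ z ∈ (mainArc μ x (arcPt a b η))ᶜ, ‖z - μ + R a b μ η x z‖ ≤ 9 * m x := by
    have key : ∀ z ∈ slitDom a b η μ 1 x,
        ‖z - μ + radical a b μ (graphContour η) x z x‖ ≤ 9 * m x := fun z hz => by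
      rw [radical_graph h hU hz self_mem_Ici]
      exact norm_add_sweptRadical_le h hU hz.1 (ne_mu_of_slitDom hz) mem01 le_rfl
        (Or.inl (mem_rootDom_of_slitDom hz mem01 le_rfl le_rfl))
    intro z hz
    rw [R]
    split_ifs with h0
    · exact key z (h.mem_slitDom_iff.2 ⟨hz, h0⟩)
    · have := key _ (h.mem_slitDom_iff.2 ⟨conj_notMem_mainArc hz, by
        simp only [mem_ofPred, Complex.conj_im]; linarith⟩)
      rw [← RCLike.norm_conj] at this
      simpa using this
  rw [tendsto_iff_norm_sub_tendsto_zero]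
  have hlim : Tendsto (fun z : ℂ => (9 * m x + ‖(μ : ℂ)‖) / ‖z‖) (cocompact ℂ) (𝓝 0) :=
    (tendsto_const_nhds (x := 9 * m x + ‖(μ : ℂ)‖)).div_atTop (tendsto_norm_cocompact_atTop (E := ℂ))
  refine squeeze_zero' (.of_forall fun _ => norm_nonneg _) ?_ hlim
  have hz0 : ∀ᶠ z : ℂ in cocompact ℂ, 0 < ‖z‖ :=
    (tendsto_norm_cocompact_atTop (E := ℂ)).eventually (eventually_gt_atTop 0)
  filter_upwards [hm, hz0] with z hz hz0
  have e : R a b μ η x z / z - -1 = ((z - μ + R a b μ η x z) + μ) / z := by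
    field_simp [norm_pos_iff.1 hz0]
    ring
  rw [e, norm_div]
  gcongr
  exact (norm_add_le _ _).trans (add_le_add (hb z hz) le_rfl)

end
end

/-! ### The jump relation and the continuity of `f₀` on the arc. -/

/-- The preimage of a closed set is the projection of a compact set. This turns continuity along the
parametrization, including its limit at `μ`, into continuity on the arc. -/
theorem continuousOn_of_isCompact_graph {X Y : Type*} [TopologicalSpace X] [T2Space X]
    [TopologicalSpace Y] {F : X → Y} {S : Set X} (hG : IsCompact ((fun z => (z, F z)) '' S)) :
    ContinuousOn F S := by
  refine continuousOn_iff_isClosed.2 fun t ht => ⟨Prod.fst '' (((fun z => (z, F z)) '' S) ∩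
    Prod.snd ⁻¹' t), ?_, ?_⟩
  · exact ((hG.inter_right (ht.preimage continuous_snd)).image continuous_fst).isClosed
  · ext z
    simp only [mem_inter_iff, mem_preimage, mem_image, Prod.exists, exists_and_right,
      exists_eq_right]
    constructor
    · rintro ⟨h1, h2⟩
      exact ⟨⟨F z, ⟨z, h2, rfl⟩, h1⟩, h2⟩
    · rintro ⟨⟨y, ⟨w, hw, he⟩, h1⟩, h2⟩
      simp only [Prod.mk.injEq] at he
      obtain ⟨rfl, rfl⟩ := he
      exact ⟨h1, h2⟩

/-- Conjugation exchanges the two sides of a curve, and reversing the tangent exchanges them back.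
-/
theorem HasLeftLimit.conj {G : ℂ → ℂ} {z₀ τ v : ℂ} (h : HasLeftLimit G z₀ τ v)
    (hG : ∀ᶠ z in 𝓝 z₀, G (conj z) = conj (G z)) :
    HasLeftLimit G (conj z₀) (-conj τ) (conj v) := by
  intro κ hκ
  have h1 : Tendsto (fun z : ℂ => conj z) (𝓝[{z | κ * ‖z - conj z₀‖ < ((z - conj z₀) / -conj τ).im}]
      (conj z₀)) (𝓝[{z | κ * ‖z - z₀‖ < ((z - z₀) / τ).im}] z₀) := by
    refine tendsto_nhdsWithin_iff.2 ⟨?_, ?_⟩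
    · have := (Complex.continuous_conj.tendsto (conj z₀)).mono_left
        (nhdsWithin_le_nhds (s := {z | κ * ‖z - conj z₀‖ < ((z - conj z₀) / -conj τ).im}))
      rwa [Complex.conj_conj] at this
    · filter_upwards [self_mem_nhdsWithin] with z hz
      have hz' : κ * ‖z - conj z₀‖ < ((z - conj z₀) / -conj τ).im := hz
      have e1 : conj z - z₀ = conj (z - conj z₀) := by simp
      have e2 : (conj z - z₀) / τ = -conj ((z - conj z₀) / -conj τ) := by
        rw [e1, map_div₀, map_neg, Complex.conj_conj, div_neg, neg_neg]
      change κ * ‖conj z - z₀‖ < ((conj z - z₀) / τ).im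
      rw [e2, e1, RCLike.norm_conj, Complex.neg_im, Complex.conj_im, neg_neg]
      exact hz'
  have h2 := (Complex.continuous_conj.tendsto v).comp ((h κ hκ).comp h1)
  refine h2.congr' ?_
  filter_upwards [h1.eventually (nhdsWithin_le_nhds hG)] with z hz
  simp only [Function.comp]
  rw [← hz, Complex.conj_conj]

section
variable {a b : ℂ → ℂ} {η : ℝ → ℝ} {μ x T k : ℝ} {m : ℝ → ℝ} {W : Set ℂ}
  {U : ℂ → ℝ → ℝ → ℂ} {j : ℂ} {s : ℝ} {X : ℂ → ℂ}

theorem g_conj {z : ℂ} (hz : z.im ≠ 0) : g a b μ k η x (conj z) = conj (g a b μ k η x z) := by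
  rcases lt_or_gt_of_ne hz with h | h
  · rw [g, if_pos (by rw [Complex.conj_im]; linarith), g, if_neg (not_le.2 h), Complex.conj_conj]
  · rw [g, if_neg (by rw [Complex.conj_im]; linarith), g, if_pos h.le, Complex.conj_conj]

theorem f₀_conj {z : ℂ} (hz : z.im ≠ 0) : f₀ a b X μ k (conj z) = conj (f₀ a b X μ k z) := by
  have h1 : z ≠ μ := fun h => hz (by rw [h, Complex.ofReal_im])
  have h2 : conj z ≠ μ := fun h => hz (by
    have := congrArg Complex.im h
    simpa using this)
  rw [f₀, f₀, if_neg h1, if_neg h2]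
  rcases lt_or_gt_of_ne hz with h | h
  · rw [if_pos (by rw [Complex.conj_im]; linarith), if_neg (not_le.2 h), Complex.conj_conj]
  · rw [if_neg (by rw [Complex.conj_im]; linarith), if_pos h.le, Complex.conj_conj]

/-- The one-sided boundary values of `g` on the arc. -/
noncomputable def gSide (a b : ℂ → ℂ) (η : ℝ → ℝ) (μ k x : ℝ) (U : ℂ → ℝ → ℝ → ℂ) (j : ℂ)
    (s : ℝ) : ℂ :=
  -(1 / 2) * (-(∫ t in Ioi x, bdIntegrand a b η μ U j s t) + μ * x) + (1 / 2) * k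

/-- The one-sided boundary values of `g` at `μ`. -/
noncomputable def gSideInfty (a b : ℂ → ℂ) (η : ℝ → ℝ) (μ k x : ℝ) (j : ℂ) : ℂ :=
  -(1 / 2) * (-(∫ t in Ioi x, bdIntegrandInfty a b η μ j t) + μ * x) + (1 / 2) * k

section
variable (h : IsSwept a b η μ x T m W) (hU : IsRoot a b η μ x U)
include h hU

theorem f₀_arc (hX : X (arcPt a b η s) = swept η 1 s) (hs : x ≤ s) :
    f₀ a b X μ k (arcPt a b η s) =
      (∫ t in Ioi s, sweptIntegrand a b η μ U (arcPt a b η s) 1 t) +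
        (arcPt a b η s - μ) * swept η 1 s + k := by
  rw [f₀, if_neg (h.arcPt_ne_mu hs), if_pos (h.arcPt_im hs).le, fUpper, hX,
    (integral_contourFrom_arc h hU hs).2]

/-- The terms `z - μ` over `[x, s]` integrate to `(z - μ)(y(s) - x)` with `y(s) = s + iη(s)`;
together with `μx` they yield `(z - μ) y(s) - xz`. -/
theorem gSide_add (hs : x ≤ s) :
    gSide a b η μ k x U Complex.I s + gSide a b η μ k x U (-Complex.I) s =
      (∫ t in Ioi s, sweptIntegrand a b η μ U (arcPt a b η s) 1 t) +
        (arcPt a b η s - μ) * swept η 1 s + k - x * arcPt a b η s := by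
  set z := arcPt a b η s with hz
  have hj : Complex.I ^ 2 = -1 := Complex.I_sq
  have hj' : (-Complex.I) ^ 2 = -1 := by rw [neg_sq, Complex.I_sq]
  have i1 := integrableOn_bdIntegrand h hU hj hs
  have i2 := integrableOn_bdIntegrand h hU hj' hs
  have e1 : (∫ t in Ioi x, bdIntegrand a b η μ U Complex.I s t) +
      (∫ t in Ioi x, bdIntegrand a b η μ U (-Complex.I) s t) =
      2 * (z - μ) * (swept η 1 s - x) +
        2 * ∫ t in Ioi s, sweptIntegrand a b η μ U z 1 t := by
    have i3 : ∫ t in Ioi x, bdIntegrand a b η μ U Complex.I s t +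
        bdIntegrand a b η μ U (-Complex.I) s t = ∫ t in Ioi x, (bdIntegrand a b η μ U Complex.I s +
        bdIntegrand a b η μ U (-Complex.I) s) t := rfl
    rw [← integral_add i1 i2, i3, ← intervalIntegral.integral_interval_add_Ioi (a := x) (b := s)
      (i1.add i2) ((i1.add i2).mono_set (Ioi_subset_Ioi hs))]
    congr 1
    · have hv : ∫ t in x..s, sweptVel η 1 t = swept η 1 s - swept η 1 x := by
        refine intervalIntegral.integral_eq_sub_of_hasDerivAt
          (fun t _ => hasDerivAt_swept h.smooth 1 t) ?_
        exact ((continuous_sweptVel h.smooth).comp (f := fun t => ((1 : ℝ), t))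
          (by fun_prop)).intervalIntegrable _ _
      have ex : swept η 1 x = x := by simp [swept, h.start]
      rw [← ex, ← hv, ← intervalIntegral.integral_const_mul]
      refine intervalIntegral.integral_congr_ae ?_
      have : ∀ᵐ t : ℝ, t ≠ s := Measure.ae_ne volume s
      filter_upwards [this] with t hts ht
      rw [uIoc_of_le hs] at ht
      have hlt : ¬ s ≤ t := not_le.2 (lt_of_le_of_ne ht.2 hts)
      -- Before `s` the radicals carry the factors `i` and `-i` and cancel; beyond `s` the boundary
      -- values do not depend on the side.
      simp only [Pi.add_apply, bdIntegrand, bdRoot, if_neg hlt, ← hz]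
      ring
    · rw [← integral_const_mul]
      refine setIntegral_congr_fun measurableSet_Ioi fun t ht => ?_
      have hle : s ≤ t := le_of_lt ht
      simp only [Pi.add_apply, bdIntegrand, bdRoot, if_pos hle, sweptIntegrand, sweptRadical, ← hz]
      ring
  rw [gSide, gSide]
  linear_combination (1 / 2) * e1

omit h hU in
-- At `z = μ` the term `z - μ` drops out and the integrand is linear in `j`, so the two sides
-- cancel.
theorem gSideInfty_add :
    gSideInfty a b η μ k x Complex.I + gSideInfty a b η μ k x (-Complex.I) = k - x * μ := by
  have e : (∫ t in Ioi x, bdIntegrandInfty a b η μ (-Complex.I) t) =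
      -∫ t in Ioi x, bdIntegrandInfty a b η μ Complex.I t := by
    rw [← integral_neg]
    congr 1
    ext t
    simp only [bdIntegrandInfty]
    ring
  rw [gSideInfty, gSideInfty, e]
  ring

theorem continuousOn_gSide (hj : j ^ 2 = -1) : ContinuousOn (gSide a b η μ k x U j) (Ici x) := by
  have := continuousOn_integral_bd h hU hj
  unfold gSide
  fun_prop

theorem tendsto_gSide (hj : j ^ 2 = -1) :
    Tendsto (gSide a b η μ k x U j) atTop (𝓝 (gSideInfty a b η μ k x j)) :=
  (((tendsto_integral_bd_atTop h hU hj).neg.add_const (μ * x : ℂ)).const_mul (-(1 / 2))).add_const _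

theorem tendsto_g_real (hj : j ^ 2 = -1) {l : Filter ℝ} [l.IsCountablyGenerated]
    (hl : l ≤ 𝓝 μ)
    (hlj : ∀ᶠ u : ℝ in l, u ≠ μ ∧ upperSqrt (u - μ) = j * upperSqrt (μ - u)) :
    Tendsto (fun u : ℝ => g a b μ k η x u) l (𝓝 (gSideInfty a b η μ k x j)) := by
  have h1 := (((tendsto_integral_swept_real h hU hj hl hlj).neg.add_const (μ * x : ℂ)).const_mul
    (-(1 / 2))).add_const ((1 / 2) * (k : ℂ))
  refine h1.congr' ?_
  filter_upwards [hlj] with u hu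
  have hu' := mem_slitDom_of_im_eq_zero (z := u) h (Complex.ofReal_im u)
    (fun h' => hu.1 (Complex.ofReal_injective h'))
  rw [g, if_pos hu'.1, gUpper_eq h hU hu', gSwept]

/-- It is a limit of values of `g` on the real axis, which are real. Hence the conjugate boundary
values on the lower half tend to the same limit at `μ`. -/
theorem gSideInfty_conj (hj : j ^ 2 = -1) {l : Filter ℝ} [l.IsCountablyGenerated] [l.NeBot]
    (hl : l ≤ 𝓝 μ)
    (hlj : ∀ᶠ u : ℝ in l, u ≠ μ ∧ upperSqrt (u - μ) = j * upperSqrt (μ - u)) :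
    conj (gSideInfty a b η μ k x j) = gSideInfty a b η μ k x j := by
  have h1 := tendsto_g_real (k := k) h hU hj hl hlj
  refine tendsto_nhds_unique (((Complex.continuous_conj.tendsto _).comp h1).congr' ?_) h1
  filter_upwards [hlj] with u hu
  have hu0 : (u : ℂ) ≠ μ := fun h' => hu.1 (Complex.ofReal_injective h')
  have hu' := mem_slitDom_of_im_eq_zero (z := u) h (Complex.ofReal_im u) hu0
  change conj (g a b μ k η x u) = g a b μ k η x u
  refine Complex.conj_eq_iff_im.2 ?_
  rw [g, if_pos hu'.1, gUpper_eq h hU hu']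
  exact gSwept_im h hU (Complex.ofReal_im u) hu0

theorem tendsto_g_side {S : ℂ → ℂ} {ε : ℝ} (hj : j ^ 2 = -1) (hS : IsSideSqrt S ε j)
    (hε : |ε| = 1) (hs : x < s) (hreg : deriv (arcPt a b η) s ≠ 0) {κ : ℝ} (hκ : 0 < κ) :
    Tendsto (g a b μ k η x) (𝓝[{z | κ * ‖z - arcPt a b η s‖ <
      ε * ((z - arcPt a b η s) / -deriv (arcPt a b η) s).im}] (arcPt a b η s))
      (𝓝 (gSide a b η μ k x U j s)) := by
  have h1 := (((tendsto_integral_side h hU hj hS hε hs hreg hκ).neg.add_const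
    (μ * x : ℂ)).const_mul (-(1 / 2))).add_const ((1 / 2) * (k : ℂ))
  refine h1.congr' ?_
  filter_upwards [sideFilter_slitDom h hε hs hreg hκ] with z hz
  rw [g, if_pos hz.1.1, gUpper_eq h hU hz.1, gSwept]

theorem hasLeftLimit_g (hs : x < s) (hreg : deriv (arcPt a b η) s ≠ 0) :
    HasLeftLimit (g a b μ k η x) (arcPt a b η s) (-deriv (arcPt a b η) s)
      (gSide a b η μ k x U Complex.I s) := by
  intro κ hκ
  have := tendsto_g_side (k := k) h hU Complex.I_sq isSideSqrt_upperSqrt abs_one hs hreg hκ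
  simpa only [one_mul] using this

theorem hasRightLimit_g (hs : x < s) (hreg : deriv (arcPt a b η) s ≠ 0) :
    HasRightLimit (g a b μ k η x) (arcPt a b η s) (-deriv (arcPt a b η) s)
      (gSide a b η μ k x U (-Complex.I) s) := by
  intro κ hκ
  have := tendsto_g_side (k := k) h hU (by rw [neg_sq, Complex.I_sq]) isSideSqrt_conj (by simp)
    hs hreg hκ
  rw [neg_neg]
  simpa only [neg_mul, one_mul, div_neg, Complex.neg_im, neg_neg] using this

/-- Continuity along the arc and the limit `k` at `μ` are read off from the jump relation, whose
left side is already known to be continuous. -/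
theorem continuousOn_f₀ (hX : ∀ s ≥ x, X (arcPt a b η s) = swept η 1 s) :
    ContinuousOn (f₀ a b X μ k) (mainArc μ x (arcPt a b η)) := by
  set c := arcPt a b η with hc
  have hf : ∀ s ≥ x, f₀ a b X μ k (c s) = gSide a b η μ k x U Complex.I s +
      gSide a b η μ k x U (-Complex.I) s + x * c s := fun s hs => by
    rw [gSide_add h hU hs, f₀_arc h hU (hX s hs) hs]; ring
  have hj' : (-Complex.I) ^ 2 = -1 := by rw [neg_sq, Complex.I_sq]
  have hcont : ContinuousOn (fun s => f₀ a b X μ k (c s)) (Ici x) := by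
    have h1 := continuousOn_gSide (k := k) h hU Complex.I_sq
    have h2 := continuousOn_gSide (k := k) h hU hj'
    exact ((h1.add h2).add (continuousOn_const.mul h.continuousOn_arcPt)).congr hf
  have hct : Tendsto c atTop (𝓝 μ) := h.tendsto_alpha mem01
  have hlim : Tendsto (fun s => f₀ a b X μ k (c s)) atTop (𝓝 k) := by
    have h1 := ((tendsto_gSide (k := k) h hU Complex.I_sq).add
      (tendsto_gSide (k := k) h hU hj')).add (hct.const_mul (x : ℂ))
    rw [gSideInfty_add, sub_add_cancel] at h1
    exact h1.congr' ((eventually_ge_atTop x).mono fun s hs => (hf s hs).symm)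
  have hμ : f₀ a b X μ k μ = k := if_pos rfl
  have hG : IsCompact ((fun z => (z, f₀ a b X μ k z)) '' insert (μ : ℂ) (c '' Ici x)) := by
    have h1 := isCompact_insert_image_Ici (h.continuousOn_arcPt.prodMk hcont)
      (hct.prodMk_nhds hlim)
    rwa [image_insert_eq, hμ, ← image_comp]
  have hG' : IsCompact ((fun z => (z, f₀ a b X μ k z)) '' ((fun s => conj (c s)) '' Ici x ∪
      {(μ : ℂ)})) := by
    have h2 := hG.image (f := fun p : ℂ × ℂ => (conj p.1, conj p.2)) (by fun_prop)
    convert h2 using 1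
    rw [← image_comp, union_singleton, image_insert_eq, image_insert_eq, ← image_comp, ← image_comp]
    congr 1
    · simp [hμ]
    · refine image_congr fun s hs => ?_
      simp only [Function.comp]
      rw [f₀_conj (h.arcPt_im hs).ne']
  have hu := hG.union hG'
  rw [← image_union] at hu
  convert continuousOn_of_isCompact_graph hu using 1
  rw [mainArc, ← singleton_union]
  ext z
  simp only [mem_union]
  tauto

end
end

/-! ### Square-root uniformization at the branch point. -/

/-- Off the diagonal this is a quotient of continuous functions; at the diagonal strict
differentiability and continuity of the derivative give the joint limit. -/
theorem continuousOn_dslope_prod {f : ℂ → ℂ} {W : Set ℂ} (hW : IsOpen W)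
    (hf : DifferentiableOn ℂ f W) :
    ContinuousOn (fun p : ℂ × ℂ => dslope f p.1 p.2) (W ×ˢ W) := by
  rintro ⟨w, y⟩ ⟨hw, hy⟩
  simp only at hw hy
  refine ContinuousAt.continuousWithinAt ?_
  have hfc : ∀ u ∈ W, ContinuousAt f u := fun u hu =>
    (hf.differentiableAt (hW.mem_nhds hu)).continuousAt
  rcases eq_or_ne w y with rfl | hne
  · rw [ContinuousAt, dslope_same]
    have hs : HasStrictDerivAt f (deriv f w) w :=
      (hf.analyticAt (hW.mem_nhds hw)).hasStrictDerivAt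
    rw [Metric.tendsto_nhds]
    intro ε hε
    have h1 := hs.hasStrictFDerivAt.isLittleO.def (c := ε / 2) (by positivity)
    have hd : ContinuousAt (deriv f) w :=
      ((hf.deriv hW).differentiableAt (hW.mem_nhds hw)).continuousAt
    have h2 : ∀ᶠ p : ℂ × ℂ in 𝓝 (w, w), dist (deriv f p.1) (deriv f w) < ε :=
      (hd.comp (f := Prod.fst) (x := (w, w)) continuousAt_fst).eventually (Metric.ball_mem_nhds _ hε)
    filter_upwards [h1, h2] with p hp1 hp2
    rcases eq_or_ne p.2 p.1 with he | he
    · rw [he, dslope_same]; exact hp2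
    · rw [dslope_of_ne _ he, slope_def_field, dist_eq_norm]
      have h0 : p.2 - p.1 ≠ 0 := sub_ne_zero.2 he
      have e1 : (f p.2 - f p.1) / (p.2 - p.1) - deriv f w =
          -(f p.1 - f p.2 - (p.1 - p.2) * deriv f w) / (p.2 - p.1) := by
        field_simp; ring
      rw [e1, norm_div, norm_neg, div_lt_iff₀ (norm_pos_iff.2 h0)]
      simp only [ContinuousLinearMap.toSpanSingleton_apply, smul_eq_mul] at hp1
      rw [norm_sub_rev p.1 p.2] at hp1
      have := norm_pos_iff.2 h0
      nlinarith
  · have h1 : (fun p : ℂ × ℂ => dslope f p.1 p.2) =ᶠ[𝓝 (w, y)]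
        fun p => (f p.2 - f p.1) / (p.2 - p.1) := by
      have : ∀ᶠ p : ℂ × ℂ in 𝓝 (w, y), p.2 ≠ p.1 :=
        (isOpen_ne_fun continuous_snd continuous_fst).mem_nhds hne.symm
      filter_upwards [this] with p hp
      rw [dslope_of_ne _ hp, slope_def_field]
    refine ContinuousAt.congr ?_ h1.symm
    refine ContinuousAt.div ?_ (by fun_prop) (sub_ne_zero.2 hne.symm)
    exact ((hfc y hy).comp (f := Prod.snd) (x := (w, y)) continuousAt_snd).sub
      ((hfc w hw).comp (f := Prod.fst) (x := (w, y)) continuousAt_fst)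

/-- The primitive of a holomorphic function along the segments from the origin. -/
theorem hasDerivAt_radial_integral {G : ℂ → ℂ} {Z : Set ℂ} (hZ : IsOpen Z)
    (hG : DifferentiableOn ℂ G Z) {ζ : ℂ} (hζ : ∀ v ∈ Icc (0 : ℝ) 1, (v * ζ : ℂ) ∈ Z) :
    HasDerivAt (fun ζ : ℂ => ∫ v in (0 : ℝ)..1, ζ * G (v * ζ)) (G ζ) ζ := by
  -- A thickening of the segment `[0, ζ]` is convex and still inside `Z`, so `G` has a primitive
  -- there and the radial integral is `F ζ' - F 0` for `ζ'` near `ζ`.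
  set K := (fun v : ℝ => (v * ζ : ℂ)) '' Icc 0 1
  have hK : IsCompact K := isCompact_Icc.image (by fun_prop)
  have hKc : Convex ℝ K := by
    have h1 := (convex_Icc (0 : ℝ) 1).linear_image ((LinearMap.id : ℝ →ₗ[ℝ] ℝ).smulRight ζ)
    have e : K = ((LinearMap.id : ℝ →ₗ[ℝ] ℝ).smulRight ζ) '' Icc (0 : ℝ) 1 := by
      refine image_congr fun v _ => ?_
      simp
    rw [e]
    exact h1
  obtain ⟨δ, hδ, hδZ⟩ := hK.exists_thickening_subset_open hZ (by
    rintro _ ⟨v, hv, rfl⟩; exact hζ v hv)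
  obtain ⟨F, hF⟩ := (hKc.thickening δ).exists_forall_hasDerivWithinAt (hG.mono hδZ)
  have hF' : ∀ y ∈ Metric.thickening δ K, HasDerivAt F (G y) y := fun y hy =>
    (hF y hy).hasDerivAt (Metric.isOpen_thickening.mem_nhds hy)
  have hmem : ∀ ζ' ∈ Metric.ball ζ δ, ∀ v ∈ Icc (0 : ℝ) 1,
      (v * ζ' : ℂ) ∈ Metric.thickening δ K := by
    intro ζ' hζ' v hv
    refine Metric.mem_thickening_iff.2 ⟨v * ζ, ⟨v, hv, rfl⟩, ?_⟩
    rw [dist_eq_norm, ← mul_sub, norm_mul, Complex.norm_real, Real.norm_eq_abs, abs_of_nonneg hv.1]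
    rw [Metric.mem_ball, dist_eq_norm] at hζ'
    calc v * ‖ζ' - ζ‖ ≤ 1 * ‖ζ' - ζ‖ := by gcongr; exact hv.2
      _ < δ := by rwa [one_mul]
  have hval : ∀ ζ' ∈ Metric.ball ζ δ, ∫ v in (0 : ℝ)..1, ζ' * G (v * ζ') = F ζ' - F 0 := by
    intro ζ' hζ'
    have hd : ∀ v ∈ uIcc (0 : ℝ) 1, HasDerivAt (fun v : ℝ => F (v * ζ')) (ζ' * G (v * ζ')) v := by
      intro v hv
      rw [uIcc_of_le zero_le_one] at hv
      have h1 : HasDerivAt (fun v : ℝ => (v * ζ' : ℂ)) ζ' v := by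
        simpa using (hasDerivAt_id v).ofReal_comp.mul_const ζ'
      refine ((hF' _ (hmem ζ' hζ' v hv)).comp v h1).congr_deriv (mul_comm _ _)
    have hc : ContinuousOn (fun v : ℝ => ζ' * G (v * ζ')) (uIcc 0 1) := by
      rw [uIcc_of_le zero_le_one]
      exact continuousOn_const.mul ((hG.continuousOn.mono hδZ).comp
        (f := fun v : ℝ => (v * ζ' : ℂ)) (by fun_prop) fun v hv => hmem ζ' hζ' v hv)
    rw [intervalIntegral.integral_eq_sub_of_hasDerivAt hd hc.intervalIntegrable]
    simp
  have h1 := (hF' ζ (by simpa using hmem ζ (Metric.mem_ball_self hδ) 1 (by simp))).sub_const (F 0)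
  exact h1.congr_of_eventuallyEq (by
    filter_upwards [Metric.ball_mem_nhds ζ hδ] with ζ' hζ' using hval ζ' hζ')

/-- `r w y` is a square root of `(α(w) - α(y)) (α(w) - α̃(y)) / (y - w)` for `w ∈ B` and `y` in a
convex neighbourhood `N` of `B`. -/
structure IsLocalSqrt (a b : ℂ → ℂ) (N B : Set ℂ) (r : ℂ → ℂ → ℂ) : Prop where
  isOpen_N : IsOpen N
  convex : Convex ℝ N
  isOpen_B : IsOpen B
  subset : B ⊆ N
  diff_alpha : DifferentiableOn ℂ (alpha a b) N
  diff_tilde : DifferentiableOn ℂ (alphaTilde a b) N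
  cont : ContinuousOn (fun p : ℂ × ℂ => r p.1 p.2) (B ×ˢ N)
  sq : ∀ w ∈ B, ∀ y ∈ N, (y - w) * r w y ^ 2 =
    (alpha a b w - alpha a b y) * (alpha a b w - alphaTilde a b y)
  ne : ∀ w ∈ B, ∀ y ∈ N, r w y ≠ 0

/-- The quotient under the root is `-(dslope α)(w,y) (α(w) - α̃(y))`. It is nonzero on `{w₀} × K`,
by regularity at `y = w₀` and injectivity elsewhere, hence near it by the tube lemma; a product of
convex sets then carries a continuous root. -/
theorem exists_isLocalSqrt {a b : ℂ → ℂ} {W K : Set ℂ} {w₀ : ℂ} (hW : IsOpen W)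
    (hα : DifferentiableOn ℂ (alpha a b) W) (hα' : DifferentiableOn ℂ (alphaTilde a b) W)
    (hK : IsCompact K) (hKc : Convex ℝ K) (hKW : K ⊆ W) (hw₀ : w₀ ∈ K)
    (hreg : deriv (alpha a b) w₀ ≠ 0) (hinj : ∀ y ∈ K, alpha a b y = alpha a b w₀ → y = w₀)
    (hne : ∀ y ∈ W, ∀ y' ∈ W, alpha a b y ≠ alphaTilde a b y') :
    ∃ N B r, IsLocalSqrt a b N B r ∧ K ⊆ N ∧ N ⊆ W ∧ w₀ ∈ B := by
  have hD := continuousOn_dslope_prod hW hα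
  have hOo : IsOpen ((W ×ˢ W) ∩ (fun p : ℂ × ℂ => dslope (alpha a b) p.1 p.2) ⁻¹' {0}ᶜ) :=
    hD.isOpen_inter_preimage (hW.prod hW) isOpen_compl_singleton
  obtain ⟨u, v, hu, hv, hwu, hKv, huv⟩ := generalized_tube_lemma (isCompact_singleton (x := w₀)) hK
    hOo (by
      rintro ⟨w, y⟩ ⟨hw, hy⟩
      rw [mem_singleton_iff] at hw
      simp only at hw hy
      subst hw
      refine ⟨⟨hKW hw₀, hKW hy⟩, ?_⟩
      rw [mem_preimage, mem_compl_singleton_iff]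
      rcases eq_or_ne y w with rfl | hyw
      · rwa [dslope_same]
      · rw [dslope_of_ne _ hyw, slope_def_field]
        exact div_ne_zero (sub_ne_zero.2 fun h => hyw (hinj y hy h)) (sub_ne_zero.2 hyw))
  obtain ⟨δ, hδ, hδv⟩ := hK.exists_thickening_subset_open (hv.inter hW) fun y hy => ⟨hKv hy, hKW hy⟩
  set N := Metric.thickening δ K
  have hNo : IsOpen N := Metric.isOpen_thickening
  have hKN : K ⊆ N := Metric.self_subset_thickening hδ K
  obtain ⟨ε, hε, hεB⟩ := Metric.isOpen_iff.1 (hu.inter hNo) w₀ ⟨hwu rfl, hKN hw₀⟩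
  set B := Metric.ball w₀ ε
  have hNc : Convex ℝ N := hKc.thickening δ
  have hBN : B ⊆ N := fun w hw => (hεB hw).2
  have hD0 : ∀ w ∈ B, ∀ y ∈ N, dslope (alpha a b) w y ≠ 0 := fun w hw y hy =>
    (huv (show (w, y) ∈ u ×ˢ v from ⟨(hεB hw).1, (hδv hy).1⟩)).2
  let q : ℂ → ℂ → ℂ := fun w y =>
    -(dslope (alpha a b) w y * (alpha a b w - alphaTilde a b y))
  have hNW : N ⊆ W := fun y hy => (hδv hy).2
  have hqc : ContinuousOn (fun p : ℂ × ℂ => q p.1 p.2) (B ×ˢ N) := by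
    refine ((hD.mono (prod_mono (hBN.trans hNW) hNW)).mul (ContinuousOn.sub ?_ ?_)).neg
    · exact hα.continuousOn.comp continuousOn_fst fun p hp => hNW (hBN hp.1)
    · exact hα'.continuousOn.comp continuousOn_snd fun p hp => hNW hp.2
  have hq0 : ∀ w ∈ B, ∀ y ∈ N, q w y ≠ 0 := fun w hw y hy => neg_ne_zero.2
    (mul_ne_zero (hD0 w hw y hy) (sub_ne_zero.2 (hne w (hNW (hBN hw)) y (hNW hy))))
  let O : Set ((ℂ × ℂ) × ℝ) := {p | p.1 ∈ B ×ˢ N ∧ p.2 ∈ Icc (0 : ℝ) 1}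
  have hseg : ∀ {S : Set ℂ}, Convex ℝ S → w₀ ∈ S → ∀ w ∈ S, ∀ θ ∈ Icc (0 : ℝ) 1,
      w₀ + θ * (w - w₀) ∈ S := by
    intro S hS h0 w hw θ hθ
    have := hS.add_smul_sub_mem h0 hw hθ
    simpa only [Complex.real_smul] using this
  obtain ⟨R, hRc, hRsq, -⟩ := exists_sqrt_of_starLike (O := O)
    (q := fun p => q (w₀ + p.2 * (p.1.1 - w₀)) (w₀ + p.2 * (p.1.2 - w₀)))
    (r₀ := fun _ => (q w₀ w₀) ^ ((2 : ℕ)⁻¹ : ℂ))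
    (fun p hp θ hθ => ⟨hp.1, mul_nonneg hθ.1 hp.2.1, mul_le_one₀ hθ.2 hp.2.1 hp.2.2⟩)
    (by
      refine hqc.comp (f := fun p : (ℂ × ℂ) × ℝ =>
        (w₀ + p.2 * (p.1.1 - w₀), w₀ + p.2 * (p.1.2 - w₀))) (by fun_prop) fun p hp => ⟨?_, ?_⟩
      · exact hseg (convex_ball _ _) (Metric.mem_ball_self hε) _ hp.1.1 _ hp.2
      · exact hseg hNc (hKN hw₀) _ hp.1.2 _ hp.2)
    (fun p hp => hq0 _ (hseg (convex_ball _ _) (Metric.mem_ball_self hε) _ hp.1.1 _ hp.2) _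
      (hseg hNc (hKN hw₀) _ hp.1.2 _ hp.2))
    continuousOn_const (fun p hp => by
      simp only [Complex.ofReal_zero, zero_mul, add_zero]
      exact Complex.cpow_nat_inv_pow _ two_ne_zero)
  have hO1 : ∀ p ∈ B ×ˢ N, (p, (1 : ℝ)) ∈ O := fun p hp => ⟨hp, by simp⟩
  have hsq : ∀ w ∈ B, ∀ y ∈ N, R ((w, y), 1) ^ 2 = q w y := fun w hw y hy => by
    have := hRsq ((w, y), 1) (hO1 _ ⟨hw, hy⟩)
    simpa using this
  refine ⟨N, B, fun w y => R ((w, y), 1), ⟨hNo, hNc, Metric.isOpen_ball, hBN, hα.mono hNW,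
    hα'.mono hNW, ?_, fun w hw y hy => ?_, fun w hw y hy h0 => ?_⟩, hKN, hNW,
    Metric.mem_ball_self hε⟩
  · exact hRc.comp (f := fun p : ℂ × ℂ => (p, (1 : ℝ))) (by fun_prop) hO1
  · rw [hsq w hw y hy]
    have := sub_smul_dslope (alpha a b) w y
    rw [smul_eq_mul] at this
    simp only [q]
    linear_combination (-(alpha a b w - alphaTilde a b y)) * this
  · have := hsq w hw y hy
    simp only [h0] at this
    exact hq0 w hw y hy (by rw [← this]; simp)

/-- The primitive of the radical near the branch point `w`, as a function of the square root
`ζ` of `y - w`. -/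
noncomputable def localPrim (r : ℂ → ℂ → ℂ) (w ζ : ℂ) : ℂ :=
  ∫ v in (0 : ℝ)..1, ζ * (2 * (v * ζ) ^ 2 * r w (w + (v * ζ) ^ 2))

theorem localPrim_zero (r : ℂ → ℂ → ℂ) (w : ℂ) : localPrim r w 0 = 0 := by
  simp [localPrim]

/-- This isolates the dependence on the choice of `ζ` in one factor. The remaining integral involves
no root of `y - w` and can be differentiated in `w`. -/
theorem localPrim_eq (r : ℂ → ℂ → ℂ) {w y ζ : ℂ} (hζ : ζ ^ 2 = y - w) :
    localPrim r w ζ = ζ * (y - w) *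
      ∫ v in (0 : ℝ)..1, 2 * (v : ℂ) ^ 2 * r w (w + (v : ℂ) ^ 2 * (y - w)) := by
  rw [localPrim, ← intervalIntegral.integral_const_mul]
  refine intervalIntegral.integral_congr fun v _ => ?_
  simp only [mul_pow, hζ]
  ring

namespace IsLocalSqrt
variable {a b : ℂ → ℂ} {N B : Set ℂ} {r : ℂ → ℂ → ℂ} {w : ℂ} (h : IsLocalSqrt a b N B r)
include h

theorem segment_mem (hw : w ∈ B) {y : ℂ} (hy : y ∈ N) {θ : ℝ} (hθ : θ ∈ Icc (0 : ℝ) 1) :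
    w + θ * (y - w) ∈ N := by
  have := h.convex.add_smul_sub_mem (h.subset hw) hy hθ
  simpa only [Complex.real_smul] using this

/-- Away from `w` this is a continuous root of a holomorphic function; the point `w` is a removable
singularity. -/
theorem differentiableOn_right (hw : w ∈ B) : DifferentiableOn ℂ (r w) N := by
  have hc : ContinuousOn (r w) N :=
    h.cont.comp (f := fun y => (w, y)) (by fun_prop) fun y hy => ⟨hw, hy⟩
  have hwN := h.isOpen_N.mem_nhds (h.subset hw)
  refine (Complex.differentiableOn_compl_singleton_and_continuousAt_iff hwN).1
    ⟨fun y hy => ?_, hc.continuousAt hwN⟩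
  have hyN := h.isOpen_N.mem_nhds hy.1
  have hyw : y - w ≠ 0 := sub_ne_zero.2 hy.2
  have hq : DifferentiableAt ℂ (fun y => (alpha a b w - alpha a b y) *
      (alpha a b w - alphaTilde a b y) / (y - w)) y := by
    have h1 := h.diff_alpha.differentiableAt hyN
    have h2 := h.diff_tilde.differentiableAt hyN
    fun_prop (disch := assumption)
  refine (hasDerivAt_of_sq_eq (hc.continuousAt hyN) hq.hasDerivAt ?_
    (h.ne w hw y hy.1)).differentiableAt.differentiableWithinAt
  filter_upwards [hyN, isOpen_ne.mem_nhds hy.2] with u hu huw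
  rw [eq_div_iff (sub_ne_zero.2 huw), ← h.sq w hw u hu, mul_comm]

theorem hasDerivAt_localPrim (hw : w ∈ B) {ζ : ℂ} (hζ : w + ζ ^ 2 ∈ N) :
    HasDerivAt (localPrim r w) (2 * ζ ^ 2 * r w (w + ζ ^ 2)) ζ := by
  have hZ : IsOpen {ζ : ℂ | w + ζ ^ 2 ∈ N} := h.isOpen_N.preimage (by fun_prop)
  refine hasDerivAt_radial_integral (G := fun ζ => 2 * ζ ^ 2 * r w (w + ζ ^ 2)) hZ ?_
    fun v hv => ?_
  · refine DifferentiableOn.mul (by fun_prop) ?_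
    exact (h.differentiableOn_right hw).comp (f := fun ζ => w + ζ ^ 2) (by fun_prop) fun ζ hζ => hζ
  · have := h.segment_mem hw hζ (θ := v ^ 2) ⟨sq_nonneg v, pow_le_one₀ hv.1 hv.2⟩
    rw [add_sub_cancel_left] at this
    simp only [mem_ofPred]
    convert this using 2
    push_cast
    ring

theorem div_sq (hw : w ∈ B) {y ρ : ℂ} (hy : y ∈ N)
    (hρ : ρ ^ 2 = (alpha a b w - alpha a b y) * (alpha a b w - alphaTilde a b y)) :
    (ρ / r w y) ^ 2 = y - w := by
  rw [div_pow, hρ, ← h.sq w hw y hy, mul_div_cancel_right₀]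
  exact pow_ne_zero 2 (h.ne w hw y hy)

/-- The integral of the radical along a path. -/
theorem integral_path (hw : w ∈ B) {l l' ρ : ℝ → ℂ} {t₀ t₁ : ℝ} (ht : t₀ ≤ t₁) {S : Set ℝ}
    (hS : S.Countable) (hlc : ContinuousOn l (Icc t₀ t₁)) (hlN : ∀ t ∈ Icc t₀ t₁, l t ∈ N)
    (hl : ∀ t ∈ Ioo t₀ t₁ \ S, HasDerivAt l (l' t) t) (hlw : ∀ t ∈ Ioo t₀ t₁, l t ≠ w)
    (hρ : ContinuousOn ρ (Icc t₀ t₁))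
    (hρsq : ∀ t ∈ Icc t₀ t₁, ρ t ^ 2 =
      (alpha a b w - alpha a b (l t)) * (alpha a b w - alphaTilde a b (l t)))
    (hi : IntervalIntegrable (fun t => ρ t * l' t) volume t₀ t₁) :
    ∫ t in t₀..t₁, ρ t * l' t =
      localPrim r w (ρ t₁ / r w (l t₁)) - localPrim r w (ρ t₀ / r w (l t₀)) := by
  have hrc : ContinuousOn (fun t => r w (l t)) (Icc t₀ t₁) :=
    h.cont.comp (f := fun t => (w, l t)) (continuousOn_const.prodMk hlc) fun t ht => ⟨hw, hlN t ht⟩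
  set ζ : ℝ → ℂ := fun t => ρ t / r w (l t) with hζ
  have hζc : ContinuousOn ζ (Icc t₀ t₁) := hρ.div hrc fun t ht => h.ne w hw _ (hlN t ht)
  have hζsq : ∀ t ∈ Icc t₀ t₁, ζ t ^ 2 = l t - w := fun t ht =>
    h.div_sq hw (hlN t ht) (hρsq t ht)
  have hmem : ∀ t ∈ Icc t₀ t₁, w + ζ t ^ 2 ∈ N := fun t ht => by
    rw [hζsq t ht, add_sub_cancel]; exact hlN t ht
  refine integral_eq_of_hasDerivAt_off_countable_of_le (fun t => localPrim r w (ζ t)) _ ht hS ?_ ?_ hi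
  · intro t ht
    exact (h.hasDerivAt_localPrim hw (hmem t ht)).continuousAt.comp_continuousWithinAt (hζc t ht)
  · intro t htS
    have htI := Ioo_subset_Icc_self htS.1
    have hζ0 : ζ t ≠ 0 := fun h0 => by
      have := hζsq t htI
      rw [h0, zero_pow two_ne_zero, eq_comm, sub_eq_zero] at this
      exact hlw t htS.1 this
    have hd : HasDerivAt ζ (l' t / (2 * ζ t)) t := by
      refine hasDerivAt_of_sq_eq (hζc.continuousAt (Icc_mem_nhds htS.1.1 htS.1.2))
        ((hl t htS).sub_const w) ?_ hζ0
      filter_upwards [Icc_mem_nhds htS.1.1 htS.1.2] with u hu using hζsq u hu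
    refine ((h.hasDerivAt_localPrim hw (hmem t htI)).comp t hd).congr_deriv ?_
    have hr : ρ t = ζ t * r w (l t) := (div_mul_cancel₀ _ (h.ne w hw _ (hlN t htI))).symm
    rw [hr, hζsq t htI, add_sub_cancel]
    have e := hζsq t htI
    field_simp
    rw [← e]
    ring

end IsLocalSqrt

namespace IsLocalSqrt
variable {a b : ℂ → ℂ} {N B : Set ℂ} {r : ℂ → ℂ → ℂ} {w y : ℂ} (h : IsLocalSqrt a b N B r)
include h

theorem differentiableAt_left (hw : w ∈ B) {l : ℂ → ℂ} (hl : DifferentiableAt ℂ l w)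
    (hlN : l w ∈ N) (hlw : l w ≠ w) : DifferentiableAt ℂ (fun w => r w (l w)) w := by
  have hB := h.isOpen_B.mem_nhds hw
  have hN : ∀ᶠ u in 𝓝 w, l u ∈ N := hl.continuousAt.eventually (h.isOpen_N.mem_nhds hlN)
  have hne : ∀ᶠ u in 𝓝 w, l u - u ≠ 0 :=
    (hl.continuousAt.sub continuousAt_id).eventually_ne (sub_ne_zero.2 hlw)
  have hc : ContinuousAt (fun w => r w (l w)) w :=
    (h.cont.continuousAt ((h.isOpen_B.prod h.isOpen_N).mem_nhds (show (w, l w) ∈ B ×ˢ N from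
      ⟨hw, hlN⟩))).comp (f := fun w => (w, l w)) (continuousAt_id.prodMk hl.continuousAt)
  have hq : DifferentiableAt ℂ (fun w => (alpha a b w - alpha a b (l w)) *
      (alpha a b w - alphaTilde a b (l w)) / (l w - w)) w := by
    have h1 := h.diff_alpha.differentiableAt (h.isOpen_N.mem_nhds (h.subset hw))
    have h2 := (h.diff_alpha.differentiableAt (h.isOpen_N.mem_nhds hlN)).comp w hl
    have h3 := (h.diff_tilde.differentiableAt (h.isOpen_N.mem_nhds hlN)).comp w hl
    exact ((h1.sub h2).mul (h1.sub h3)).div (hl.sub differentiableAt_id) (sub_ne_zero.2 hlw)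
  refine (hasDerivAt_of_sq_eq hc hq.hasDerivAt ?_ (h.ne w hw _ hlN)).differentiableAt
  filter_upwards [hB, hN, hne] with u hu huN hu0
  rw [eq_div_iff hu0, ← h.sq u hu _ huN, mul_comm]

/-- For `v > 0` the point `w + v²(y - w)` differs from `w`, so the integrand is holomorphic in `w`
and bounded on a small ball; the single value `v = 0` does not matter. -/
theorem differentiableAt_localInt (hw : w ∈ B) (hy : y ∈ N) (hwy : w ≠ y) :
    DifferentiableAt ℂ (fun w => ∫ v in (0 : ℝ)..1, 2 * (v : ℂ) ^ 2 *
      r w (w + (v : ℂ) ^ 2 * (y - w))) w := by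
  obtain ⟨ε, hε, hεB⟩ := Metric.nhds_basis_closedBall.mem_iff.1
    ((h.isOpen_B.inter isOpen_ne).mem_nhds (show w ∈ B ∩ {u | u ≠ y} from ⟨hw, hwy⟩))
  have hmem : ∀ u ∈ Metric.closedBall w ε, ∀ v ∈ Icc (0 : ℝ) 1,
      (u, u + (v : ℂ) ^ 2 * (y - u)) ∈ B ×ˢ N := fun u hu v hv => by
    refine ⟨(hεB hu).1, ?_⟩
    have := h.segment_mem (hεB hu).1 hy (θ := v ^ 2) ⟨sq_nonneg v, pow_le_one₀ hv.1 hv.2⟩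
    push_cast at this
    exact this
  have hF : ContinuousOn (fun p : ℂ × ℝ => 2 * (p.2 : ℂ) ^ 2 *
      r p.1 (p.1 + (p.2 : ℂ) ^ 2 * (y - p.1))) (Metric.closedBall w ε ×ˢ Icc 0 1) :=
    ContinuousOn.mul (by fun_prop) (h.cont.comp
      (f := fun p : ℂ × ℝ => (p.1, p.1 + (p.2 : ℂ) ^ 2 * (y - p.1))) (by fun_prop)
      fun p hp => hmem p.1 hp.1 p.2 hp.2)
  obtain ⟨M, hM⟩ := ((isCompact_closedBall w ε).prod (isCompact_Icc (a := (0 : ℝ)) (b := 1))).exists_bound_of_continuousOn hF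
  simp only [intervalIntegral.integral_of_le zero_le_one]
  have hb := Metric.ball_subset_closedBall (x := w) (ε := ε)
  refine (differentiableOn_integral_of_bound (M := fun _ => M) measurableSet_Ioc Metric.isOpen_ball
    ?_ (fun u hu => ?_) (fun v hv u hu => ?_) fun v hv u hu => ?_).differentiableAt
    (Metric.ball_mem_nhds w hε)
  · exact (continuous_const.integrableOn_Icc).mono_set Ioc_subset_Icc_self
  · refine ContinuousOn.aestronglyMeasurable ?_ measurableSet_Ioc
    exact hF.comp (f := fun v : ℝ => (u, v)) (by fun_prop) fun v hv =>
      ⟨hb hu, Ioc_subset_Icc_self hv⟩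
  · have huB := hεB (hb hu)
    have hv0 : (v : ℂ) ≠ 0 := Complex.ofReal_ne_zero.2 hv.1.ne'
    refine (DifferentiableAt.const_mul ?_ _).differentiableWithinAt
    refine h.differentiableAt_left huB.1 (l := fun u => u + (v : ℂ) ^ 2 * (y - u)) (by fun_prop)
      (hmem u (hb hu) v (Ioc_subset_Icc_self hv)).2 fun he => ?_
    have : (v : ℂ) ^ 2 * (y - u) = 0 := by linear_combination he
    exact mul_ne_zero (pow_ne_zero 2 hv0) (sub_ne_zero.2 (Ne.symm huB.2)) this
  · exact hM (u, v) ⟨hb hu, Ioc_subset_Icc_self hv⟩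

/-- The primitive is of order `3/2` at the branch point. -/
theorem exists_norm_localPrim_le {w₀ : ℂ} (hw₀ : w₀ ∈ B) :
    ∃ M, ∀ᶠ w in 𝓝 w₀, ∀ ζ, ζ ^ 2 = w₀ - w → ‖localPrim r w ζ‖ ≤ M * ‖w₀ - w‖ ^ (3 / 2 : ℝ) := by
  have hc : ContinuousAt (fun p : ℂ × ℂ => r p.1 p.2) (w₀, w₀) :=
    h.cont.continuousAt ((h.isOpen_B.prod h.isOpen_N).mem_nhds ⟨hw₀, h.subset hw₀⟩)
  have h1 : ∀ᶠ p : ℂ × ℂ in 𝓝 (w₀, w₀), ‖r p.1 p.2‖ < ‖r w₀ w₀‖ + 1 :=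
    hc.norm.eventually (gt_mem_nhds (lt_add_one _))
  obtain ⟨ε, hε, hε'⟩ := Metric.eventually_nhds_iff_ball.1 h1
  refine ⟨2 * (‖r w₀ w₀‖ + 1), ?_⟩
  filter_upwards [Metric.ball_mem_nhds w₀ hε] with w hw ζ hζ
  have hn : ‖ζ‖ ^ 2 = ‖w₀ - w‖ := by rw [← norm_pow, hζ]
  have h3 : ‖w₀ - w‖ ^ (3 / 2 : ℝ) = ‖ζ‖ ^ 3 := by
    rw [← hn, ← Real.rpow_natCast, ← Real.rpow_mul (norm_nonneg _), ← Real.rpow_natCast]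
    norm_num
  rw [h3, localPrim]
  have := intervalIntegral.norm_integral_le_of_norm_le_const (a := (0 : ℝ)) (b := 1)
    (f := fun v : ℝ => ζ * (2 * (v * ζ) ^ 2 * r w (w + (v * ζ) ^ 2)))
    (C := 2 * (‖r w₀ w₀‖ + 1) * ‖ζ‖ ^ 3) fun v hv => ?_
  · simpa using this
  · rw [uIoc_of_le zero_le_one] at hv
    have hm : w + (v * ζ) ^ 2 ∈ Metric.ball w₀ ε := by
      have h5 := (convex_ball w₀ ε).add_smul_sub_mem hw (Metric.mem_ball_self hε) (t := v ^ 2)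
        ⟨sq_nonneg v, pow_le_one₀ hv.1.le hv.2⟩
      rw [Complex.real_smul, ← hζ] at h5
      convert h5 using 2
      push_cast
      ring
    have hm' : (w, w + (v * ζ) ^ 2) ∈ Metric.ball (w₀, w₀) ε := by
      rw [← ball_prod_same]
      exact ⟨hw, hm⟩
    have h6 := (hε' _ hm').le
    simp only [norm_mul, norm_pow, Complex.norm_real, Complex.norm_ofNat, Real.norm_eq_abs,
      abs_of_pos hv.1]
    have hv2 : v ^ 2 ≤ 1 := pow_le_one₀ hv.1.le hv.2
    calc ‖ζ‖ * (2 * (v * ‖ζ‖) ^ 2 * ‖r w (w + (v * ζ) ^ 2)‖)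
        = 2 * ‖ζ‖ ^ 3 * (v ^ 2 * ‖r w (w + (v * ζ) ^ 2)‖) := by ring
      _ ≤ 2 * ‖ζ‖ ^ 3 * (1 * (‖r w₀ w₀‖ + 1)) := by gcongr
      _ = _ := by ring

end IsLocalSqrt

/-! ### Contour integrals for points near the arc. -/

theorem continuous_contourFrom (w : ℂ) : Continuous (contourFrom w) := by
  unfold contourFrom; fun_prop

theorem contourFrom_zero (w : ℂ) : contourFrom w 0 = w := by
  rw [contourFrom_of_le (abs_nonneg _), sub_zero, real_sign_mul_abs, mul_comm]
  exact Complex.re_add_im w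

/-- The contour leaves `w` vertically and then moves to the right, so the principal root of `y - w`
is continuous along it. -/
theorem contourFrom_sub_mem_slitPlane {w : ℂ} {t : ℝ} (ht : 0 < t) :
    contourFrom w t - w ∈ Complex.slitPlane := by
  rw [Complex.mem_slitPlane_iff]
  rcases le_or_gt t |w.im| with h1 | h1
  · right
    have h0 : w.im ≠ 0 := abs_pos.1 (ht.trans_le h1)
    have e : (contourFrom w t - w).im = -(Real.sign w.im * t) := by
      rw [contourFrom_of_le h1]
      have := real_sign_mul_abs w.im
      simp only [Complex.sub_im, Complex.add_im, Complex.ofReal_im, Complex.mul_im, Complex.I_re,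
        Complex.I_im, Complex.ofReal_re]
      linear_combination this
    rw [e]
    exact neg_ne_zero.2 (mul_ne_zero (fun h => h0 (Real.sign_eq_zero_iff.1 h)) ht.ne')
  · left
    rw [contourFrom_of_ge h1.le]
    simpa using h1

theorem contourFrom_mem {N : Set ℂ} (hN : Convex ℝ N) {w : ℂ} {s : ℝ} (hw : w ∈ N)
    (hre : (w.re : ℂ) ∈ N) (hs : (s : ℂ) ∈ N) (hlt : w.re < s) {t : ℝ} (ht : 0 ≤ t)
    (ht' : t ≤ |w.im| + (s - w.re)) : contourFrom w t ∈ N := by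
  rcases le_or_gt t |w.im| with h1 | h1
  · rcases eq_or_ne w.im 0 with h0 | h0
    · have : t = 0 := le_antisymm (by simpa [h0] using h1) ht
      rw [this, contourFrom_zero]; exact hw
    · have h2 : 0 < |w.im| := abs_pos.2 h0
      have := hN.add_smul_sub_mem hw hre (t := t / |w.im|)
        ⟨by positivity, div_le_one_of_le₀ h1 h2.le⟩
      convert this using 1
      rw [contourFrom_of_le h1]
      have h3 := real_sign_mul_abs w.im
      apply Complex.ext
      · simp
      · simp
        field_simp
        linear_combination |w.im| * h3 - t * h3
  · have h2 : 0 < s - w.re := sub_pos.2 hlt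
    have := hN.add_smul_sub_mem hre hs (t := (t - |w.im|) / (s - w.re))
      ⟨div_nonneg (by linarith) h2.le, div_le_one_of_le₀ (by linarith) h2.le⟩
    convert this using 1
    rw [contourFrom_of_ge h1.le, Complex.real_smul, ← Complex.ofReal_sub, ← Complex.ofReal_mul,
      ← Complex.ofReal_add, div_mul_cancel₀ _ h2.ne']

section
variable {a b : ℂ → ℂ} {η : ℝ → ℝ} {μ x T k : ℝ} {m : ℝ → ℝ} {W : Set ℂ}
  {U : ℂ → ℝ → ℝ → ℂ} {N B : Set ℂ} {r : ℂ → ℂ → ℂ} {z w : ℂ} {s : ℝ}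

section
variable (h : IsSwept a b η μ x T m W) (hU : IsRoot a b η μ x U) (hL : IsLocalSqrt a b N B r)
include h hU hL

/-- For `z` off the arc the vertical contour may leave the swept region. The branch is therefore
built from the local root up to the real point `s` and from the swept radical beyond it. -/
theorem exists_radicalBranch_local (hw : w ∈ B) (hwz : alpha a b w = z) (hre : (w.re : ℂ) ∈ N)
    (hs : (s : ℂ) ∈ N) (hlt : w.re < s) (hdom : (z, (0 : ℝ), s) ∈ rootDom a b η μ x) :
    ∃ ρ, IsRadicalBranch a b μ (contourFrom w) 0 z ρ ∧
      ∀ t ≥ |w.im| + (s - w.re), ρ t = sweptRadical a b η U z 0 (s + (t - (|w.im| + (s - w.re)))) := by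
  set t₁ := |w.im| + (s - w.re) with ht₁
  have hws : |w.im| < t₁ := by linarith
  have ht₁0 : 0 < t₁ := (abs_nonneg _).trans_lt hws
  have hl1 : contourFrom w t₁ = s := by
    rw [contourFrom_of_ge hws.le, ht₁]
    congr 1
    ring
  have hlge : ∀ t ≥ t₁, contourFrom w t = ((s + (t - t₁) : ℝ) : ℂ) := fun t ht => by
    rw [contourFrom_of_ge (hws.le.trans ht), ht₁]
    congr 1
    ring
  have hmem : ∀ t ∈ Icc 0 t₁, contourFrom w t ∈ N := fun t ht =>
    contourFrom_mem hL.convex (hL.subset hw) hre hs hlt ht.1 ht.2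
  let root : ℝ → ℂ := fun t => (contourFrom w t - w) ^ ((2 : ℕ)⁻¹ : ℂ)
  have hroot_sq : ∀ t, root t ^ 2 = contourFrom w t - w := fun t =>
    Complex.cpow_nat_inv_pow _ two_ne_zero
  have hroot : ContinuousOn root (Ici 0) := by
    intro t ht
    refine ContinuousAt.continuousWithinAt ?_
    have hc : ContinuousAt (fun t => contourFrom w t - w) t :=
      ((continuous_contourFrom w).sub continuous_const).continuousAt
    rcases eq_or_lt_of_le (mem_Ici.1 ht) with h0 | h0
    · subst h0
      have e0 : root 0 = 0 := by simp [root, contourFrom_zero]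
      rw [ContinuousAt, e0]
      refine tendsto_zero_of_sq ?_
      simp only [hroot_sq]
      rw [ContinuousAt, contourFrom_zero, sub_self] at hc
      exact hc
    · exact hc.cpow continuousAt_const (contourFrom_sub_mem_slitPlane h0)
  have hQ : ∀ t ∈ Icc 0 t₁, root t ^ 2 * r w (contourFrom w t) ^ 2 =
      (z - alpha a b (contourFrom w t)) * (z - alphaTilde a b (contourFrom w t)) := fun t ht => by
    rw [hroot_sq, hL.sq w hw _ (hmem t ht), hwz]
  have hR1 : sweptRadical a b η U z 0 s ^ 2 = root t₁ ^ 2 * r w s ^ 2 := by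
    rw [sweptRadical_sq hU (Or.inl hdom), ← hl1, hQ t₁ ⟨ht₁0.le, le_rfl⟩, hl1, swept_zero]
  have hne1 : root t₁ * r w s ≠ 0 := by
    refine mul_ne_zero (fun h0 => ?_) (hL.ne w hw _ hs)
    have h1 := hroot_sq t₁
    rw [h0, hl1, zero_pow two_ne_zero, eq_comm, sub_eq_zero] at h1
    rw [← h1, Complex.ofReal_re] at hlt
    exact lt_irrefl _ hlt
  -- Two roots of the same number: `κ = ±1` adjusts the local branch to the one that comes from
  -- `+∞`.
  set κ := sweptRadical a b η U z 0 s / (root t₁ * r w s) with hκ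
  have hκ2 : κ ^ 2 = 1 := by
    rw [hκ, div_pow, mul_pow, hR1, div_self]
    rw [← mul_pow]
    exact pow_ne_zero 2 hne1
  have hdomt : ∀ t ≥ t₁, (z, (0 : ℝ), s + (t - t₁)) ∈ rootDom a b η μ x := fun t ht =>
    rootDom_mono hdom (by linarith [show t₁ ≤ t from ht])
  let ρ : ℝ → ℂ := fun t => if t ≤ t₁ then κ * (root t * r w (contourFrom w t))
    else sweptRadical a b η U z 0 (s + (t - t₁))
  have hρge : ∀ t ≥ t₁, ρ t = sweptRadical a b η U z 0 (s + (t - t₁)) := by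
    intro t ht
    rcases eq_or_lt_of_le (show t₁ ≤ t from ht) with h1 | h1
    · rw [← h1]
      simp only [ρ, if_pos le_rfl, hl1, hκ, sub_self, add_zero]
      rw [div_mul_cancel₀ _ hne1]
    · exact if_neg (not_le.2 h1)
  refine ⟨ρ, ⟨?_, fun t ht => ?_, ?_⟩, hρge⟩
  · rw [← Icc_union_Ici_eq_Ici ht₁0.le]
    refine ContinuousOn.union_of_isClosed ?_ ?_ isClosed_Icc isClosed_Ici
    · have h1 : ContinuousOn (fun t => κ * (root t * r w (contourFrom w t))) (Icc 0 t₁) := by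
        refine continuousOn_const.mul ((hroot.mono Icc_subset_Ici_self).mul ?_)
        exact (hL.differentiableOn_right hw).continuousOn.comp
          (continuous_contourFrom w).continuousOn hmem
      exact h1.congr fun t ht => if_pos ht.2
    · have h1 : ContinuousOn (fun t => sweptRadical a b η U z 0 (s + (t - t₁))) (Ici t₁) :=
        (continuousOn_sweptRadical h hU).comp (f := fun t => (z, (0 : ℝ), s + (t - t₁)))
          (by fun_prop) hdomt
      exact h1.congr hρge
  · rcases le_total t t₁ with h1 | h1
    · simp only [ρ, if_pos h1]
      rw [mul_pow, hκ2, one_mul, mul_pow, hQ t ⟨ht, h1⟩]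
    · rw [hρge t h1, sweptRadical_sq hU (Or.inl (hdomt t h1)), swept_zero, hlge t h1]
  · have h1 := (tendsto_sweptRadical h hU hdom.1 hdom.2.1 mem00).comp
      (tendsto_atTop_add_const_left atTop s (tendsto_atTop_add_const_right atTop (-t₁) tendsto_id))
    refine h1.congr' ?_
    filter_upwards [eventually_ge_atTop t₁] with t ht
    rw [hρge t ht]
    rfl

/-- Up to `s` the integral of the radical is a difference of values of `localPrim`, and the value at
the start vanishes because `ζ = 0` at `y = w`. -/
theorem integral_contourFrom_local (hw : w ∈ B) (hwz : alpha a b w = z)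
    (hre : (w.re : ℂ) ∈ N) (hs : (s : ℂ) ∈ N) (hlt : w.re < s)
    (hdom : (z, (0 : ℝ), s) ∈ rootDom a b η μ x) :
    ∫ t in Ioi (0 : ℝ), integrand a b μ (contourFrom w) 0 z t =
      (z - μ) * (s - w) + localPrim r w (sweptRadical a b η U z 0 s / r w s) +
        ∫ t in Ioi s, sweptIntegrand a b η μ U z 0 t := by
  obtain ⟨ρ, hρ, hρge⟩ := exists_radicalBranch_local h hU hL hw hwz hre hs hlt hdom
  set t₁ := |w.im| + (s - w.re) with ht₁
  have hws : |w.im| < t₁ := by linarith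
  have ht₁0 : 0 < t₁ := (abs_nonneg _).trans_lt hws
  have hl1 : contourFrom w t₁ = s := by
    rw [contourFrom_of_ge hws.le, ht₁]
    congr 1
    ring
  have hlge : ∀ t ≥ t₁, contourFrom w t = ((s + (t - t₁) : ℝ) : ℂ) := fun t ht => by
    rw [contourFrom_of_ge (hws.le.trans ht), ht₁]
    congr 1
    ring
  have hmem : ∀ t ∈ Icc 0 t₁, contourFrom w t ∈ N := fun t ht =>
    contourFrom_mem hL.convex (hL.subset hw) hre hs hlt ht.1 ht.2
  have hlw : ∀ t > 0, contourFrom w t ≠ w := fun t ht h0 => by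
    have := contourFrom_sub_mem_slitPlane (w := w) ht
    rw [h0, sub_self] at this
    exact Complex.zero_notMem_slitPlane this
  have hne : ∀ t > 0, z ≠ alpha a b (contourFrom w t) ∧ z ≠ alphaTilde a b (contourFrom w t) := by
    intro t ht
    rcases le_total t t₁ with h1 | h1
    · have hm := hmem t ⟨le_of_lt ht, h1⟩
      have h2 := hL.sq w hw _ hm
      have h3 : (contourFrom w t - w) * r w (contourFrom w t) ^ 2 ≠ 0 :=
        mul_ne_zero (sub_ne_zero.2 (hlw t ht)) (pow_ne_zero 2 (hL.ne w hw _ hm))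
      rw [h2, hwz] at h3
      exact ⟨sub_ne_zero.1 (left_ne_zero_of_mul h3), sub_ne_zero.1 (right_ne_zero_of_mul h3)⟩
    · have hst : s ≤ s + (t - t₁) := by linarith
      rw [hlge t h1, ← swept_zero η (s + (t - t₁))]
      exact ⟨hdom.2.2.2.2 _ hst, h.ne_tilde hdom.1 mem00 (hdom.2.2.2.1.trans hst)⟩
  have hrad := radical_eqOn hρ hdom.2.1 hne
  set F := integrand a b μ (contourFrom w) 0 z with hF
  let l' : ℝ → ℂ := fun t => if t < |w.im| then -(Complex.I * Real.sign w.im) else 1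
  have hl' : ∀ t ∈ Ioo 0 t₁ \ {|w.im|}, HasDerivAt (contourFrom w) (l' t) t := by
    intro t ht
    rcases lt_or_gt_of_ne (show t ≠ |w.im| from ht.2) with h1 | h1
    · simp only [l', if_pos h1]
      exact hasDerivAt_contourFrom_of_lt h1
    · simp only [l', if_neg (not_lt.2 h1.le)]
      exact hasDerivAt_contourFrom_of_gt h1
  have hl'i : IntervalIntegrable l' volume 0 t₁ := by
    refine IntervalIntegrable.trans (b := |w.im|) ?_ ?_
    · rw [intervalIntegrable_iff_integrableOn_Ioo_of_le (abs_nonneg _)]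
      refine IntegrableOn.congr_fun (f := fun _ => -(Complex.I * Real.sign w.im)) ?_
        (fun t ht => (if_pos ht.2).symm) measurableSet_Ioo
      exact (continuous_const.integrableOn_Icc).mono_set Ioo_subset_Icc_self
    · rw [intervalIntegrable_iff_integrableOn_Ioo_of_le hws.le]
      refine IntegrableOn.congr_fun (f := fun _ => 1) ?_
        (fun t ht => (if_neg (not_lt.2 ht.1.le)).symm) measurableSet_Ioo
      exact (continuous_const.integrableOn_Icc).mono_set Ioo_subset_Icc_self
  have hρc : ContinuousOn ρ (Icc 0 t₁) := hρ.1.mono Icc_subset_Ici_self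
  have hρi : IntervalIntegrable (fun t => ρ t * l' t) volume 0 t₁ :=
    hl'i.continuousOn_mul (by rwa [uIcc_of_le ht₁0.le])
  have hFae : ∀ᵐ t : ℝ, t ∈ uIoc 0 t₁ → (z - μ) * l' t + ρ t * l' t = F t := by
    have h1 : ∀ᵐ t : ℝ, t ≠ |w.im| := Measure.ae_ne volume _
    have h2 : ∀ᵐ t : ℝ, t ≠ t₁ := Measure.ae_ne volume _
    filter_upwards [h1, h2] with t ht1 ht2 ht
    rw [uIoc_of_le ht₁0.le] at ht
    rw [hF, integrand, hrad ht.1.le, (hl' t ⟨⟨ht.1, lt_of_le_of_ne ht.2 ht2⟩, ht1⟩).deriv]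
    ring
  have hFi : IntervalIntegrable F volume 0 t₁ :=
    ((hl'i.const_mul (z - μ)).add hρi).congr_ae ((ae_restrict_iff' measurableSet_uIoc).2 hFae)
  have v1 : ∫ t in (0 : ℝ)..t₁, F t = (z - μ) * (s - w) +
      localPrim r w (sweptRadical a b η U z 0 s / r w s) := by
    rw [← intervalIntegral.integral_congr_ae hFae,
      intervalIntegral.integral_add (hl'i.const_mul (z - μ)) hρi,
      intervalIntegral.integral_const_mul,
      integral_eq_of_hasDerivAt_off_countable_of_le (contourFrom w) l' ht₁0.le
        (countable_singleton |w.im|) (continuous_contourFrom w).continuousOn hl' hl'i,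
      hL.integral_path hw ht₁0.le (countable_singleton |w.im|)
        (continuous_contourFrom w).continuousOn hmem hl' (fun t ht => hlw t ht.1) hρc
        (fun t ht => by rw [hwz]; exact hρ.2.1 t ht.1) hρi, hl1, contourFrom_zero,
      hρge t₁ le_rfl, sub_self, add_zero]
    have h0 : ρ 0 = 0 := by
      have := hρ.2.1 0 self_mem_Ici
      rw [contourFrom_zero, hwz, sub_self, zero_mul] at this
      exact pow_eq_zero_iff two_ne_zero |>.1 this
    rw [h0, zero_div, localPrim_zero, sub_zero]
  have hint : IntegrableOn (sweptIntegrand a b η μ U z 0) (Ioi s) :=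
    integrableOn_sweptIntegrand h hU hdom.1 hdom.2.1 mem00 hdom.2.2.2.1 fun t ht =>
      hdom.2.2.2.2 t (le_of_lt ht)
  have e2 : ∀ t ∈ Ioi t₁, F t = sweptIntegrand a b η μ U z 0 (t + (s - t₁)) := by
    intro t ht
    have ht' : t₁ < t := ht
    rw [hF, integrand, hrad (ht₁0.trans ht').le, (hasDerivAt_contourFrom_of_gt (hws.trans ht')).deriv,
      hρge t ht'.le, sweptIntegrand, sweptVel_zero]
    congr 3
    ring
  have i2 : IntegrableOn F (Ioi t₁) := by
    have h1 := integrableOn_Ioi_comp_add (c := t₁) (d := s - t₁)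
      (f := sweptIntegrand a b η μ U z 0) (by rwa [add_sub_cancel])
    exact h1.congr_fun (fun t ht => (e2 t ht).symm) measurableSet_Ioi
  have v2 : ∫ t in Ioi t₁, F t = ∫ t in Ioi s, sweptIntegrand a b η μ U z 0 t := by
    rw [setIntegral_congr_fun measurableSet_Ioi e2, integral_Ioi_comp_add, add_sub_cancel]
  rw [← intervalIntegral.integral_interval_add_Ioi' hFi i2, v1, v2]

/-- The path follows the graph from `x`, descends over `s` and continues along the real axis. The
values of `localPrim` at the corner cancel, so the last integral and the value at `s` are the same
as in `f₀`. -/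
theorem integral_swept_local (hxs : x ≤ s)
    (hN : ∀ σ ∈ Icc (0 : ℝ) 1, ∀ t ∈ Icc x s, swept η σ t ∈ N)
    (hz : z ∈ slitDom a b η μ 1 x) (hw : w ∈ B) (hwz : alpha a b w = z)
    (hdom : ∀ σ ∈ Icc (0 : ℝ) 1, (z, σ, s) ∈ rootDom a b η μ x) :
    ∫ t in Ioi x, sweptIntegrand a b η μ U z 1 t =
      (z - μ) * (s - x) + localPrim r w (sweptRadical a b η U z 0 s / r w s) -
        localPrim r w (sweptRadical a b η U z 1 x / r w x) +
        ∫ t in Ioi s, sweptIntegrand a b η μ U z 0 t := by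
  have ex : swept η 1 x = x := by simp [swept, h.start]
  have hsx : ∀ t ≥ x, (z, (1 : ℝ), t) ∈ rootDom a b η μ x := fun t ht =>
    mem_rootDom_of_slitDom hz mem01 le_rfl ht
  have hzμ := ne_mu_of_slitDom hz
  have hvc := continuous_sweptVel h.smooth
  have hsc := continuous_swept h.smooth.continuous
  have hint : IntegrableOn (sweptIntegrand a b η μ U z 1) (Ioi x) :=
    integrableOn_sweptIntegrand h hU hz.1 hzμ mem01 le_rfl fun t ht => (h.ne_of_slitDom hz ht).1
  have hRt : ContinuousOn (fun t => sweptRadical a b η U z 1 t) (Icc x s) :=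
    (continuousOn_sweptRadical h hU).comp (f := fun t => (z, (1 : ℝ), t)) (by fun_prop)
      fun t ht => hsx t ht.1
  have hRσ : ContinuousOn (fun σ => sweptRadical a b η U z σ s) (Icc 0 1) :=
    (continuousOn_sweptRadical h hU).comp (f := fun σ => (z, σ, s)) (by fun_prop) hdom
  have hv1 : Continuous fun t => sweptVel η 1 t := hvc.comp (f := fun t => ((1 : ℝ), t)) (by fun_prop)
  have i1 : IntervalIntegrable (fun t => sweptRadical a b η U z 1 t * sweptVel η 1 t) volume x s :=
    (hRt.mul hv1.continuousOn).intervalIntegrable_of_Icc hxs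
  have i2 : IntervalIntegrable (fun σ => sweptRadical a b η U z σ s * (Complex.I * η s)) volume 0 1 :=
    (hRσ.mul continuousOn_const).intervalIntegrable_of_Icc zero_le_one
  have v1 : ∫ t in x..s, sweptIntegrand a b η μ U z 1 t = (z - μ) * (swept η 1 s - x) +
      (localPrim r w (sweptRadical a b η U z 1 s / r w (swept η 1 s)) -
        localPrim r w (sweptRadical a b η U z 1 x / r w x)) := by
    have e : ∀ t, sweptIntegrand a b η μ U z 1 t =
        (z - μ) * sweptVel η 1 t + sweptRadical a b η U z 1 t * sweptVel η 1 t := fun t => by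
      rw [sweptIntegrand]; ring
    simp only [e]
    rw [intervalIntegral.integral_add ((hv1.intervalIntegrable _ _).const_mul _) i1,
      intervalIntegral.integral_const_mul,
      intervalIntegral.integral_eq_sub_of_hasDerivAt (fun t _ => hasDerivAt_swept h.smooth 1 t)
        (hv1.intervalIntegrable _ _),
      hL.integral_path hw hxs countable_empty
        (hsc.comp (f := fun t => ((1 : ℝ), t)) (by fun_prop)).continuousOn
        (fun t ht => hN 1 mem01 t ht) (fun t _ => hasDerivAt_swept h.smooth 1 t)
        (fun t ht he => (hsx t ht.1.le).2.2.2.2 t le_rfl (by rw [← hwz, ← he]; rfl)) hRt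
        (fun t ht => by rw [hwz]; exact sweptRadical_sq hU (Or.inl (hsx t ht.1))) i1]
    simp only [Function.comp, ex]
  have v2 : ∫ σ in (0 : ℝ)..1, (z - μ + sweptRadical a b η U z σ s) * (Complex.I * η s) =
      (z - μ) * (swept η 1 s - s) +
      (localPrim r w (sweptRadical a b η U z 1 s / r w (swept η 1 s)) -
        localPrim r w (sweptRadical a b η U z 0 s / r w s)) := by
    simp only [add_mul]
    have e1 : swept η 1 s - s = Complex.I * η s := by simp [swept]
    rw [intervalIntegral.integral_add (continuous_const.intervalIntegrable _ _) i2,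
      hL.integral_path hw zero_le_one countable_empty
        (hsc.comp (f := fun σ => (σ, s)) (by fun_prop)).continuousOn
        (fun σ hσ => hN σ hσ s ⟨hxs, le_rfl⟩) (fun σ _ => hasDerivAt_swept_left η σ s)
        (fun σ hσ he => (hdom σ (Ioo_subset_Icc_self hσ)).2.2.2.2 s le_rfl
          (by rw [← hwz, ← he]; rfl)) hRσ
        (fun σ hσ => by rw [hwz]; exact sweptRadical_sq hU (Or.inl (hdom σ hσ))) i2]
    simp only [Function.comp, swept_zero, e1, intervalIntegral.integral_const]
    simp
  have v3 := integral_swept_sub h hU hdom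
  rw [v2] at v3
  rw [← intervalIntegral.integral_interval_add_Ioi hint (hint.mono_set (Ioi_subset_Ioi hxs)), v1]
  linear_combination v3

end
end

/-! ### Analyticity of `f₀` on the arc and the endpoint behaviour of `g`. -/

section
variable {a b : ℂ → ℂ} {η : ℝ → ℝ} {μ x T k : ℝ} {m : ℝ → ℝ} {W C : Set ℂ} {X : ℂ → ℂ}
  {U : ℂ → ℝ → ℝ → ℂ} {N B : Set ℂ} {r : ℂ → ℂ → ℂ} {z w : ℂ} {s : ℝ}

theorem deriv_alpha_ne_zero {z₀ : ℂ} (hC : IsOpen C) (hX : DifferentiableOn ℂ X C)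
    (hXr : ∀ z ∈ C, alpha a b (X z) = z) (hz₀ : z₀ ∈ C)
    (hα : DifferentiableAt ℂ (alpha a b) (X z₀)) : deriv (alpha a b) (X z₀) ≠ 0 := by
  intro h0
  have h1 := HasDerivAt.comp (h₂ := alpha a b) (h := X) z₀ hα.hasDerivAt
    (hX.differentiableAt (hC.mem_nhds hz₀)).hasDerivAt
  rw [h0, zero_mul] at h1
  have h2 : HasDerivAt (alpha a b ∘ X) 1 z₀ := (hasDerivAt_id z₀).congr_of_eventuallyEq (by
    filter_upwards [hC.mem_nhds hz₀] with z hz using hXr z hz)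
  exact zero_ne_one (h1.unique h2)

section
variable (h : IsSwept a b η μ x T m W)
include h

/-- The compact convex set is the vertical segment from the arc parameter to its real foot, so that
one neighbourhood contains the whole descent. -/
theorem IsSwept.exists_isLocalSqrt (hs : x ≤ s) (hreg : deriv (alpha a b) (swept η 1 s) ≠ 0) :
    ∃ N B r, IsLocalSqrt a b N B r ∧ (s : ℂ) ∈ N ∧ swept η 1 s ∈ B := by
  have hseg : segment ℝ (s : ℂ) (swept η 1 s) = (fun σ => swept η σ s) '' Icc (0 : ℝ) 1 := by
    rw [segment_eq_image']
    refine image_congr fun θ _ => ?_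
    simp only [swept, Complex.real_smul]
    push_cast
    ring
  have hmem : ∀ σ ∈ Icc (0 : ℝ) 1, swept η σ s ∈ segment ℝ (s : ℂ) (swept η 1 s) := fun σ hσ => by
    rw [hseg]; exact ⟨σ, hσ, rfl⟩
  have hc := continuous_swept h.smooth.continuous
  obtain ⟨N, B, r, h1, h2, -, h3⟩ := _root_.exists_isLocalSqrt (K := segment ℝ (s : ℂ) (swept η 1 s))
    h.isOpen h.diff_alpha h.diff_tilde (by
      rw [hseg]
      exact isCompact_Icc.image (hc.comp (f := fun σ => (σ, s)) (by fun_prop)))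
    (convex_segment _ _) (by
      rw [hseg]
      rintro _ ⟨σ, hσ, rfl⟩
      exact h.mem σ hσ s hs) (hmem 1 mem01) hreg (by
      rw [hseg]
      rintro _ ⟨σ, hσ, rfl⟩ he
      exact h.inj σ hσ s hs 1 mem01 s hs he)
    (fun y hy y' hy' he => by
      have e1 := h.upper y hy
      have e2 := h.lower y' hy'
      rw [he] at e1
      linarith)
  refine ⟨N, B, r, h1, h2 ?_, h3⟩
  have := hmem 0 mem00
  rwa [swept_zero] at this

/-- The points near `α(s)` are not met by `α` on the swept region beyond `s₁ > s`. -/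
theorem IsSwept.eventually_mem_rootDom (hs : x ≤ s) {s₁ : ℝ} (hs₁ : s < s₁) :
    ∀ᶠ z in 𝓝 (arcPt a b η s), 0 < z.im ∧
      ∀ σ ∈ Icc (0 : ℝ) 1, (z, σ, s₁) ∈ rootDom a b η μ x := by
  set T' := max s₁ T
  have hxs₁ : x ≤ s₁ := hs.trans hs₁.le
  have hsT : s₁ ≤ T' := le_max_left _ _
  -- Beyond `T'` all contours coincide, so the values of `α` to be avoided lie, together with `μ`,
  -- in a compact set.
  have hK : IsCompact (((fun p : ℝ × ℝ => alpha a b (swept η p.1 p.2)) '' (Icc 0 1 ×ˢ Icc s₁ T')) ∪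
      insert (μ : ℂ) ((fun t => alpha a b (swept η 0 t)) '' Ici T')) := by
    refine ((isCompact_Icc.prod isCompact_Icc).image_of_continuousOn
      (h.continuousOn_alpha.mono (prod_mono_right fun t ht => hxs₁.trans ht.1))).union
      (h.isCompact_slit mem00 (hxs₁.trans hsT))
  have hne : ∀ σ ∈ Icc (0 : ℝ) 1, ∀ t ≥ s₁, arcPt a b η s ≠ alpha a b (swept η σ t) := by
    intro σ hσ t ht he
    have h1 := congrArg Complex.re (h.inj 1 mem01 s hs σ hσ t (hxs₁.trans ht) he)
    rw [swept_re, swept_re] at h1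
    have h2 : s₁ ≤ t := ht
    linarith
  have hn : ∀ᶠ z in 𝓝 (arcPt a b η s), z ∉ (((fun p : ℝ × ℝ => alpha a b (swept η p.1 p.2)) ''
      (Icc 0 1 ×ˢ Icc s₁ T')) ∪ insert (μ : ℂ) ((fun t => alpha a b (swept η 0 t)) '' Ici T')) := by
    refine hK.isClosed.isOpen_compl.mem_nhds ?_
    rintro (⟨p, hp, he⟩ | (he | ⟨t, ht, he⟩))
    · exact hne p.1 hp.1 p.2 hp.2.1 he.symm
    · exact h.arcPt_ne_mu hs he
    · exact hne 0 mem00 t (hsT.trans ht) he.symm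
  have him : ∀ᶠ z in 𝓝 (arcPt a b η s), 0 < z.im :=
    (isOpen_lt continuous_const Complex.continuous_im).mem_nhds (h.arcPt_im hs)
  filter_upwards [hn, him] with z hz hz0
  refine ⟨hz0, fun σ hσ => ⟨hz0.le, fun he => hz (Or.inr (Or.inl he)), hσ, hxs₁, fun t ht he => ?_⟩⟩
  rcases le_total t T' with h1 | h1
  · exact hz (Or.inl ⟨(σ, t), ⟨hσ, ht, h1⟩, he.symm⟩)
  · refine hz (Or.inr (Or.inr ⟨t, h1, ?_⟩))
    have e : swept η 0 t = swept η σ t := by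
      simp [swept, h.tail t ((le_max_right s₁ T).trans h1)]
    simp only [e]
    exact he.symm

variable (hU : IsRoot a b η μ x U) (hC : IsOpen C) (hX : DifferentiableOn ℂ X C)
  (hXr : ∀ z ∈ C, alpha a b (X z) = z)
include hU

theorem f₀_local (hL : IsLocalSqrt a b N B r) (hw : X z ∈ B) (hwz : alpha a b (X z) = z)
    (hre : ((X z).re : ℂ) ∈ N) (hs : (s : ℂ) ∈ N) (hlt : (X z).re < s)
    (hdom : (z, (0 : ℝ), s) ∈ rootDom a b η μ x) :
    f₀ a b X μ k z = (z - μ) * s +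
      localPrim r (X z) (sweptRadical a b η U z 0 s / r (X z) s) +
      (∫ t in Ioi s, sweptIntegrand a b η μ U z 0 t) + k := by
  rw [f₀, if_neg hdom.2.1, if_pos hdom.1, fUpper,
    integral_contourFrom_local h hU hL hw hwz hre hs hlt hdom]
  ring

include hC hX hXr

omit hU hXr in
theorem eventually_local (hL : IsLocalSqrt a b N B r) (hs : x ≤ s)
    (hmem : arcPt a b η s ∈ C) (hXs : X (arcPt a b η s) = swept η 1 s) (hsN : (s : ℂ) ∈ N)
    (hsB : swept η 1 s ∈ B) {s₁ : ℝ} (hs₁ : s < s₁) :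
    ∀ᶠ z in 𝓝 (arcPt a b η s), z ∈ C ∧ X z ∈ B ∧ ((X z).re : ℂ) ∈ N ∧ (X z).re < s₁ ∧
      0 < z.im ∧ ∀ σ ∈ Icc (0 : ℝ) 1, (z, σ, s₁) ∈ rootDom a b η μ x := by
  have hXc : ContinuousAt X (arcPt a b η s) :=
    (hX.differentiableAt (hC.mem_nhds hmem)).continuousAt
  have hrec : ContinuousAt (fun z => (X z).re) (arcPt a b η s) :=
    Complex.continuous_re.continuousAt.comp hXc
  have hre : (X (arcPt a b η s)).re = s := by rw [hXs, swept_re]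
  have e1 : ∀ᶠ z in 𝓝 (arcPt a b η s), X z ∈ B :=
    hXc.eventually (hL.isOpen_B.mem_nhds (by rwa [hXs]))
  have e2 : ∀ᶠ z in 𝓝 (arcPt a b η s), ((X z).re : ℂ) ∈ N :=
    (Complex.continuous_ofReal.continuousAt.comp hrec).eventually
      (hL.isOpen_N.mem_nhds (by simpa only [Function.comp, hre] using hsN))
  have e3 : ∀ᶠ z in 𝓝 (arcPt a b η s), (X z).re < s₁ :=
    hrec.eventually (gt_mem_nhds (show (X (arcPt a b η s)).re < s₁ by rwa [hre]))
  filter_upwards [hC.mem_nhds hmem, e1, e2, e3, h.eventually_mem_rootDom hs hs₁]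
    with z h1 h2 h3 h4 h5 using ⟨h1, h2, h3, h4, h5⟩

/-- Split the integral at a real `s₁` slightly to the right of `s`. There `R(s₁, z) / r(x(z), s₁)`
is a holomorphic root of `s₁ - x(z)`, which does not vanish near `α(s)`, so the local primitive is
analytic in `z`. -/
theorem analyticAt_f₀ (hs : x ≤ s) (hmem : arcPt a b η s ∈ C)
    (hXs : X (arcPt a b η s) = swept η 1 s) : AnalyticAt ℂ (f₀ a b X μ k) (arcPt a b η s) := by
  obtain ⟨N, B, r, hL, hsN, hsB⟩ := h.exists_isLocalSqrt hs (by
    rw [← hXs]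
    refine deriv_alpha_ne_zero hC hX hXr hmem ?_
    rw [hXs]
    exact h.diff_alpha.differentiableAt (h.isOpen.mem_nhds (h.mem 1 mem01 s hs)))
  obtain ⟨s₁, hs₁, hs₁N⟩ : ∃ s₁ > s, (s₁ : ℂ) ∈ N := by
    have h1 : ∀ᶠ t : ℝ in 𝓝[>] s, (t : ℂ) ∈ N := nhdsWithin_le_nhds
      (Complex.continuous_ofReal.continuousAt.eventually (hL.isOpen_N.mem_nhds hsN))
    obtain ⟨t, ht1, ht2⟩ := (h1.and self_mem_nhdsWithin).exists
    exact ⟨t, ht2, ht1⟩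
  rw [Complex.analyticAt_iff_eventually_differentiableAt]
  have hev := eventually_local h hC hX hL hs hmem hXs hsN hsB hs₁
  filter_upwards [hev, hev.eventually_nhds] with z hz hzn
  obtain ⟨hzC, hzB, -, hlt, him, hdom⟩ := hz
  have hzslit : z ∈ slitDom a b η μ 0 s₁ ∩ {z | 0 < z.im} :=
    ⟨slitDom_of_mem_rootDom (hdom 0 mem00), him⟩
  have hopen := (h.isOpen_slitDom mem00 (hs.trans hs₁.le)).mem_nhds hzslit
  have hne : X z ≠ s₁ := fun he => by
    rw [he, Complex.ofReal_re] at hlt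
    exact lt_irrefl _ hlt
  have dX : DifferentiableAt ℂ X z := hX.differentiableAt (hC.mem_nhds hzC)
  have dR := (differentiableOn_sweptRadical h hU mem00 (hs.trans hs₁.le)
    (le_refl s₁)).differentiableAt hopen
  have dI := (differentiableOn_integral_swept h hU mem00 (hs.trans hs₁.le)).differentiableAt hopen
  have dr : DifferentiableAt ℂ (fun z => r (X z) s₁) z :=
    (hL.differentiableAt_left hzB (l := fun _ => (s₁ : ℂ)) (by fun_prop) hs₁N hne.symm).comp z dX
  have dk := (hL.differentiableAt_localInt hzB hs₁N hne).comp z dX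
  have d1 : DifferentiableAt ℂ (fun z => (z - μ) * s₁ + (sweptRadical a b η U z 0 s₁ / r (X z) s₁ *
      (s₁ - X z) * ∫ v in (0 : ℝ)..1, 2 * (v : ℂ) ^ 2 * r (X z) (X z + (v : ℂ) ^ 2 * (s₁ - X z))) +
      (∫ t in Ioi s₁, sweptIntegrand a b η μ U z 0 t) + k) z :=
    (((by fun_prop : DifferentiableAt ℂ (fun z : ℂ => (z - μ) * s₁) z).add
      (((dR.div dr (hL.ne _ hzB _ hs₁N)).mul (dX.const_sub (s₁ : ℂ))).mul dk)).add dI).add_const _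
  refine d1.congr_of_eventuallyEq ?_
  filter_upwards [hzn] with u hu
  obtain ⟨huC, huB, hure, hult, huim, hudom⟩ := hu
  rw [f₀_local h hU hL huB (hXr u huC) hure hs₁N hult (hudom 0 mem00), localPrim_eq]
  refine hL.div_sq huB hs₁N ?_
  rw [sweptRadical_sq hU (Or.inl (hudom 0 mem00)), hXr u huC, swept_zero]

/-- The analytic part is `(f₀ - xz)/2`. In the difference with `g` everything beyond the branch
point cancels except `-½ localPrim` at a root of `x - x(z)`, which is of order `3/2`; `x - x(z) =
O(z - e)` since the inverse is differentiable. -/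
theorem g_endpoint (hmem : arcPt a b η x ∈ C) (hXs : X (arcPt a b η x) = swept η 1 x) :
    ∃ A : ℂ → ℂ, AnalyticAt ℂ A (arcPt a b η x) ∧
      (fun z => g a b μ k η x z - A z) =O[𝓝[(mainArc μ x (arcPt a b η))ᶜ] (arcPt a b η x)]
        (fun z => ‖z - arcPt a b η x‖ ^ (3 / 2 : ℝ)) := by
  set e := arcPt a b η x with he
  have ex : swept η 1 x = x := by simp [swept, h.start]
  have exσ : ∀ σ, swept η σ x = x := fun σ => by simp [swept, h.start]
  refine ⟨fun z => (f₀ a b X μ k z - x * z) / 2, ?_, ?_⟩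
  · have := analyticAt_f₀ (k := k) h hU hC hX hXr le_rfl hmem hXs
    fun_prop
  obtain ⟨N, B, r, hL, hsN, hsB⟩ := h.exists_isLocalSqrt (le_refl x) (by
    rw [← hXs]
    refine deriv_alpha_ne_zero hC hX hXr hmem ?_
    rw [hXs]
    exact h.diff_alpha.differentiableAt (h.isOpen.mem_nhds (h.mem 1 mem01 x le_rfl)))
  obtain ⟨s₁, hs₁, hsw⟩ : ∃ s₁ > x, ∀ σ ∈ Icc (0 : ℝ) 1, ∀ t ∈ Icc x s₁, swept η σ t ∈ N := by
    obtain ⟨u, v, -, hv, hu, hxv, huv⟩ := generalized_tube_lemma (isCompact_Icc (a := (0 : ℝ)) (b := 1))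
      (isCompact_singleton (x := x))
      (hL.isOpen_N.preimage (continuous_swept h.smooth.continuous)) (by
        rintro ⟨σ, t⟩ ⟨-, ht⟩
        rw [mem_singleton_iff] at ht
        simp only at ht
        rw [mem_preimage, ht, exσ]
        exact hsN)
    obtain ⟨ε, hε, hεv⟩ := Metric.isOpen_iff.1 hv x (hxv rfl)
    refine ⟨x + ε / 2, by linarith, fun σ hσ t ht => huv (show (σ, t) ∈ u ×ˢ v from
      ⟨hu hσ, hεv ?_⟩)⟩
    rw [Metric.mem_ball, Real.dist_eq, abs_lt]
    constructor <;> linarith [ht.1, ht.2]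
  have hs₁N : (s₁ : ℂ) ∈ N := by
    have := hsw 0 mem00 s₁ ⟨hs₁.le, le_rfl⟩
    rwa [swept_zero] at this
  have hXd := hX.differentiableAt (hC.mem_nhds hmem)
  have hxB : (x : ℂ) ∈ B := by rwa [ex] at hsB
  obtain ⟨M, hM⟩ := hL.exists_norm_localPrim_le hxB
  have hM' : ∀ᶠ z in 𝓝 e, ∀ ζ, ζ ^ 2 = (x : ℂ) - X z →
      ‖localPrim r (X z) ζ‖ ≤ M * ‖(x : ℂ) - X z‖ ^ (3 / 2 : ℝ) := by
    have hXc : Tendsto X (𝓝 e) (𝓝 (x : ℂ)) := by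
      have := hXd.continuousAt.tendsto
      rwa [hXs, ex] at this
    exact hXc.eventually hM
  obtain ⟨K, hK⟩ := hXd.hasDerivAt.isBigO_sub.bound
  have hev := eventually_local h hC hX hL le_rfl hmem hXs hsN hsB hs₁
  refine IsBigO.of_bound (1 / 2 * (|M| * |K| ^ (3 / 2 : ℝ))) ?_
  filter_upwards [self_mem_nhdsWithin, nhdsWithin_le_nhds hev, nhdsWithin_le_nhds hM',
    nhdsWithin_le_nhds hK] with z hzA hz hzM hzK
  obtain ⟨hzC, hzB, hre, hlt, him, hdom⟩ := hz
  have hslit : z ∈ slitDom a b η μ 1 x := h.mem_slitDom_iff.2 ⟨hzA, him.le⟩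
  set ζ := sweptRadical a b η U z 1 x / r (X z) x with hζ
  have hζsq : ζ ^ 2 = x - X z := by
    refine hL.div_sq hzB hsN ?_
    rw [sweptRadical_sq hU (Or.inl (mem_rootDom_of_slitDom hslit mem01 le_rfl le_rfl)),
      hXr z hzC, ex]
  have hdiff : g a b μ k η x z - (f₀ a b X μ k z - x * z) / 2 =
      -(1 / 2) * localPrim r (X z) ζ := by
    rw [g, if_pos him.le, gUpper_eq h hU hslit, gSwept,
      integral_swept_local h hU hL hs₁.le hsw hslit hzB (hXr z hzC) hdom,
      f₀_local h hU hL hzB (hXr z hzC) hre hs₁N hlt (hdom 0 mem00)]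
    ring
  rw [hdiff, norm_mul]
  have h1 : ‖(x : ℂ) - X z‖ ≤ |K| * ‖z - e‖ := by
    rw [norm_sub_rev]
    rw [hXs, ex] at hzK
    exact hzK.trans (by gcongr; exact le_abs_self K)
  have h2 : ‖(-(1 / 2) : ℂ)‖ = 1 / 2 := by simp
  rw [h2, mul_assoc]
  refine mul_le_mul_of_nonneg_left ?_ (by norm_num)
  calc ‖localPrim r (X z) ζ‖ ≤ M * ‖(x : ℂ) - X z‖ ^ (3 / 2 : ℝ) := hzM ζ hζsq
    _ ≤ |M| * (|K| * ‖z - e‖) ^ (3 / 2 : ℝ) := by gcongr; exact le_abs_self M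
    _ = _ := by
      rw [Real.mul_rpow (abs_nonneg _) (norm_nonneg _), Real.norm_of_nonneg (by positivity)]
      ring

end
end

/-! ### The swept region of an admissible contour. -/

section
variable {a b : ℂ → ℂ} {D L C : Set ℂ} {X : ℂ → ℂ} {η : ℝ → ℝ} {μm μ p x k : ℝ}

namespace IsConformalInverse

theorem left_inv_of_mem (hC : IsConformalInverse a b D L C X) {y : ℂ}
    (hy : y ∈ range ((↑) : ℝ → ℂ) ∪ X '' C) : X (alpha a b y) = y := by
  rcases hy with ⟨t, rfl⟩ | ⟨z, hz, rfl⟩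
  · exact hC.left_inv t
  · rw [hC.right_inv z hz]

theorem mem_domain (hA : ConditionsA a b D L μm μ p) (hC : IsConformalInverse a b D L C X) {y : ℂ}
    (hy : y ∈ range ((↑) : ℝ → ℂ) ∪ X '' C) : y ∈ D ∧ 0 < (alpha a b y).im := by
  rcases hy with ⟨t, rfl⟩ | ⟨z, hz, rfl⟩
  · exact ⟨hA.real_mem_D t, hA.im_alpha_pos t⟩
  · exact ⟨hC.mapsTo hz, by rw [hC.right_inv z hz]; exact hA.L_upper z (hC.subset hz)⟩

end IsConformalInverse

theorem IsAdmissibleContour.real (hA : ConditionsA a b D L μm μ p) :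
    IsAdmissibleContour a b C X x (fun _ => 0) where
  smooth := contDiff_const
  start := rfl
  tail := ⟨0, fun _ _ => rfl⟩
  region := fun t _ σ _ => by
    have e : graphContour (fun _ => σ * 0) t = t := by simp [graphContour]
    rw [e]
    exact ⟨Or.inl ⟨t, rfl⟩, hA.im_alphaTilde_neg t⟩

/-- The inverse function, valid on the real axis and on `X '' C`, makes `α` injective on the swept
region. The majorant is a multiple of `max(t, T)^(-p)`, integrable since `p > 1`. -/
theorem IsAdmissibleContour.exists_isSwept (hA : ConditionsA a b D L μm μ p)
    (hC : IsConformalInverse a b D L C X) (hη : IsAdmissibleContour a b C X x η) :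
    ∃ T m W, IsSwept a b η μ x T m W := by
  have hreg : ∀ σ ∈ Icc (0 : ℝ) 1, ∀ t ≥ x,
      swept η σ t ∈ range ((↑) : ℝ → ℂ) ∪ X '' C ∧ (alphaTilde a b (swept η σ t)).im < 0 :=
    fun σ hσ t ht => hη.region t ht σ hσ
  set W := {y ∈ D | 0 < (alpha a b y).im ∧ (alphaTilde a b y).im < 0} with hW
  have hWD : W ⊆ D := fun y hy => hy.1
  have hWo : IsOpen W := by
    have h1 := (Complex.continuous_im.comp_continuousOn
      hA.differentiableOn_alpha.continuousOn).isOpen_inter_preimage hA.isOpen_D isOpen_Ioi (t := Ioi 0)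
    have h2 := (Complex.continuous_im.comp_continuousOn
      hA.differentiableOn_alphaTilde.continuousOn).isOpen_inter_preimage hA.isOpen_D isOpen_Iio
        (t := Iio 0)
    convert h1.inter h2 using 1
    ext y
    exact ⟨fun hy => ⟨⟨hy.1, hy.2.1⟩, hy.1, hy.2.2⟩, fun hy => ⟨hy.1.1, hy.1.2, hy.2.2⟩⟩
  have hmem : ∀ σ ∈ Icc (0 : ℝ) 1, ∀ t ≥ x, swept η σ t ∈ W := fun σ hσ t ht =>
    have h1 := hreg σ hσ t ht
    have h2 := IsConformalInverse.mem_domain hA hC h1.1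
    ⟨h2.1, h2.2, h1.2⟩
  obtain ⟨T₀, hT₀⟩ := hη.tail
  obtain ⟨T₁, hT₁⟩ := eventually_atTop.1 hA.decay_right
  set T := max (max T₀ T₁) (max x 1) with hT
  have hT0 : T₀ ≤ T := (le_max_left _ _).trans (le_max_left _ _)
  have hT1 : T₁ ≤ T := (le_max_right _ _).trans (le_max_left _ _)
  have hxT : x ≤ T := (le_max_left _ _).trans (le_max_right _ _)
  have hTpos : 0 < T := one_pos.trans_le ((le_max_right _ _).trans (le_max_right _ _))
  have hcpt : IsCompact (Icc (0 : ℝ) 1 ×ˢ Icc x T) := isCompact_Icc.prod isCompact_Icc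
  have hbd : ∀ f : ℂ → ℂ, DifferentiableOn ℂ f D →
      ∃ K, ∀ q ∈ Icc (0 : ℝ) 1 ×ˢ Icc x T, ‖f (swept η q.1 q.2) - μ‖ ≤ K := fun f hf =>
    hcpt.exists_bound_of_continuousOn ((hf.continuousOn.comp
      (continuous_swept hη.smooth.continuous).continuousOn
      fun q hq => (hmem q.1 hq.1 q.2 hq.2.1).1).sub continuousOn_const)
  obtain ⟨K, hK⟩ := hbd _ hA.differentiableOn_alpha
  obtain ⟨K', hK'⟩ := hbd _ hA.differentiableOn_alphaTilde
  -- The `2` serves the tail, where `a - μ` and `b` are each bounded by `t^(-p)`; the other entry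
  -- makes `M T^(-p)` exceed the bounds on the compact part.
  set M := max 2 (max K K' * T ^ p) with hM
  have hM0 : 0 < M := two_pos.trans_le (le_max_left _ _)
  have hp0 : 0 < p := one_pos.trans hA.one_lt_p
  have hreal : ∀ t ≥ T, ‖a t - μ‖ + ‖b t‖ ≤ M * (max t T) ^ (-p) := fun t ht => by
    have h1 := hT₁ t (hT1.trans ht)
    rw [abs_of_pos (hTpos.trans_le ht)] at h1
    rw [max_eq_left ht]
    have h2 : (0 : ℝ) ≤ t ^ (-p) := Real.rpow_nonneg (hTpos.le.trans ht) _
    calc _ ≤ 2 * t ^ (-p) := by linarith [h1.1, h1.2]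
      _ ≤ M * t ^ (-p) := mul_le_mul_of_nonneg_right (le_max_left _ _) h2
  have hcompact : ∀ r : ℝ, r ≤ max K K' → ∀ t ≤ T, r ≤ M * (max t T) ^ (-p) := fun r hr t ht => by
    rw [max_eq_right ht]
    calc r ≤ max K K' := hr
      _ = max K K' * T ^ p * T ^ (-p) := by
        rw [mul_assoc, ← Real.rpow_add hTpos, add_neg_cancel, Real.rpow_zero, mul_one]
      _ ≤ M * T ^ (-p) :=
        mul_le_mul_of_nonneg_right (le_max_right _ _) (Real.rpow_nonneg hTpos.le _)
  have hsw : ∀ σ, ∀ t ≥ T, swept η σ t = t := fun σ t ht => by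
    simp [swept, hT₀ t (hT0.trans ht)]
  refine ⟨T, fun t => M * (max t T) ^ (-p), W, ?_⟩
  exact
  { isOpen := hWo
    diff_alpha := hA.differentiableOn_alpha.mono hWD
    diff_tilde := hA.differentiableOn_alphaTilde.mono hWD
    mem := hmem
    upper := fun y hy => hy.2.1
    lower := fun y hy => hy.2.2
    inj := fun σ hσ t ht σ' hσ' t' ht' he => by
      rw [← hC.left_inv_of_mem (hreg σ hσ t ht).1, he, hC.left_inv_of_mem (hreg σ' hσ' t' ht').1]
    conj_real := hA.alphaTilde_ofReal
    smooth := hη.smooth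
    start := hη.start
    tail := fun t ht => hT₀ t (hT0.trans ht)
    le_tail := hxT
    anti := fun s _ t _ hst => mul_le_mul_of_nonneg_left
      (Real.rpow_le_rpow_of_nonpos (hTpos.trans_le (le_max_right _ _)) (max_le_max_right _ hst)
        (by linarith)) hM0.le
    integrable := by
      rw [← Ioc_union_Ioi_eq_Ioi hxT]
      refine IntegrableOn.union ?_ ?_
      · refine (integrableOn_const (C := M * T ^ (-p)) (by simp)).congr_fun (fun t ht => ?_)
          measurableSet_Ioc
        simp only [max_eq_right ht.2]
      · refine IntegrableOn.congr_fun ((integrableOn_Ioi_rpow_of_lt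
          (neg_lt_neg hA.one_lt_p) hTpos).const_mul M) (fun t ht => ?_) measurableSet_Ioi
        simp only [max_eq_left (le_of_lt (mem_Ioi.1 ht))]
    tendsto := by
      have h1 := ((tendsto_rpow_neg_atTop hp0).comp
        (tendsto_atTop_mono (fun t => le_max_left t T) tendsto_id)).const_mul M
      rwa [mul_zero] at h1
    bound := fun σ hσ t ht => by
      rcases le_total t T with h1 | h1
      · exact hcompact _ ((hK (σ, t) ⟨hσ, ht, h1⟩).trans (le_max_left _ _)) t h1
      · rw [hsw σ t h1]
        refine le_trans ?_ (hreal t h1)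
        calc _ = ‖(a t - μ) + Complex.I * b t‖ := by rw [alpha]; ring_nf
          _ ≤ _ := (norm_add_le _ _).trans (by simp)
    bound' := fun σ hσ t ht => by
      rcases le_total t T with h1 | h1
      · exact hcompact _ ((hK' (σ, t) ⟨hσ, ht, h1⟩).trans (le_max_right _ _)) t h1
      · rw [hsw σ t h1]
        refine le_trans ?_ (hreal t h1)
        calc _ = ‖(a t - μ) - Complex.I * b t‖ := by rw [alphaTilde]; ring_nf
          _ ≤ _ := (norm_sub_le _ _).trans (by simp) }

end

/-! ### Assembly of the Riemann–Hilbert problem. -/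

section
variable {a b : ℂ → ℂ} {η : ℝ → ℝ} {μ x T k : ℝ} {m : ℝ → ℝ} {W C : Set ℂ} {X : ℂ → ℂ}
  {U : ℂ → ℝ → ℝ → ℂ}

theorem IsSwept.isMainArc (h : IsSwept a b η μ x T m W) :
    IsMainArc (alpha a b x) μ x (arcPt a b η) where
  start := by simp [arcPt, swept, h.start]
  continuousOn := h.continuousOn_arcPt
  injOn := fun _ hs _ ht he => h.arcPt_inj hs ht he
  upper := fun _ hs => h.arcPt_im hs
  tendsto := h.tendsto_alpha mem01

theorem upperSqrt_side_left (μ : ℝ) : ∀ᶠ u : ℝ in 𝓝[<] μ,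
    u ≠ μ ∧ upperSqrt (u - μ) = Complex.I * upperSqrt (μ - u) := by
  filter_upwards [self_mem_nhdsWithin] with u hu
  have hu' : u < μ := hu
  refine ⟨hu'.ne, ?_⟩
  rw [← upperSqrt_neg (by simpa using hu'), neg_sub]

theorem upperSqrt_side_right (μ : ℝ) : ∀ᶠ u : ℝ in 𝓝[>] μ,
    u ≠ μ ∧ upperSqrt (u - μ) = -Complex.I * upperSqrt (μ - u) := by
  filter_upwards [self_mem_nhdsWithin] with u hu
  have hu' : μ < u := hu
  refine ⟨hu'.ne', ?_⟩
  have h1 : upperSqrt (μ - u) = Complex.I * upperSqrt (u - μ) := by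
    rw [← upperSqrt_neg (by simpa using hu'), neg_sub]
  rw [h1, ← mul_assoc, neg_mul, Complex.I_mul_I, neg_neg, one_mul]

/-- Reflection of an estimate modulo analytic functions. -/
theorem endpoint_conj {G : ℂ → ℂ} {S : Set ℂ} {e : ℂ} {r : ℝ} (hS : ∀ z ∈ S, conj z ∈ S)
    (hG : ∀ᶠ z in 𝓝 e, G (conj z) = conj (G z))
    (hA : ∃ A : ℂ → ℂ, AnalyticAt ℂ A e ∧
      (fun z => G z - A z) =O[𝓝[S] e] (fun z => ‖z - e‖ ^ r)) :
    ∃ A : ℂ → ℂ, AnalyticAt ℂ A (conj e) ∧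
      (fun z => G z - A z) =O[𝓝[S] (conj e)] (fun z => ‖z - conj e‖ ^ r) := by
  obtain ⟨A, hA1, hA2⟩ := hA
  have hc : Tendsto (fun z : ℂ => conj z) (𝓝 (conj e)) (𝓝 e) := by
    have := Complex.continuous_conj.tendsto (conj e)
    rwa [Complex.conj_conj] at this
  refine ⟨fun z => conj (A (conj z)), ?_, ?_⟩
  · rw [Complex.analyticAt_iff_eventually_differentiableAt] at hA1 ⊢
    filter_upwards [hc.eventually hA1] with z hz
    exact differentiableAt_conj_conj hz
  · have h1 : Tendsto (fun z : ℂ => conj z) (𝓝[S] (conj e)) (𝓝[S] e) :=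
      tendsto_nhdsWithin_iff.2 ⟨hc.mono_left nhdsWithin_le_nhds,
        eventually_nhdsWithin_of_forall hS⟩
    have h2 := hA2.comp_tendsto h1
    rw [← isBigO_norm_left] at h2 ⊢
    refine (h2.congr' ?_ ?_)
    · filter_upwards [nhdsWithin_le_nhds (hc.eventually hG)] with z hz
      simp only [Function.comp]
      rw [Complex.conj_conj] at hz
      rw [hz, ← RCLike.norm_conj, map_sub]
    · refine .of_forall fun z => ?_
      simp only [Function.comp]
      rw [← RCLike.norm_conj (z - conj e), map_sub, Complex.conj_conj]

theorem f₀_conj_of_mem (h : IsSwept a b η μ x T m W) {z : ℂ}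
    (hz : z ∈ mainArc μ x (arcPt a b η)) :
    f₀ a b X μ k (conj z) = conj (f₀ a b X μ k z) := by
  rcases hz with (hz | ⟨s, hs, rfl⟩) | ⟨s, hs, rfl⟩
  · have hz' : z = μ := hz
    rw [hz', Complex.conj_ofReal, f₀, if_pos rfl, Complex.conj_ofReal]
  · exact f₀_conj (h.arcPt_im hs).ne'
  · refine f₀_conj ?_
    rw [Complex.conj_im]
    exact (neg_neg_of_pos (h.arcPt_im hs)).ne

theorem solvesRHP (h : IsSwept a b η μ x T m W) (hU : IsRoot a b η μ x U) (hC : IsOpen C)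
    (hX : DifferentiableOn ℂ X C) (hXr : ∀ z ∈ C, alpha a b (X z) = z)
    (hXs : ∀ s ≥ x, X (arcPt a b η s) = swept η 1 s) (hmem : arcPt a b η x ∈ C) :
    SolvesRHP μ x (arcPt a b η) (f₀ a b X μ k) (g a b μ k η x) := by
  have hI : (-Complex.I) ^ 2 = -1 := by rw [neg_sq, Complex.I_sq]
  have hcj : ∀ s ≥ x, ∀ᶠ z in 𝓝 (arcPt a b η s),
      g a b μ k η x (conj z) = conj (g a b μ k η x z) := fun s hs => by
    filter_upwards [(isOpen_lt continuous_const Complex.continuous_im).mem_nhds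
      (show (0 : ℝ) < (arcPt a b η s).im from h.arcPt_im hs)] with z hz
    exact g_conj (ne_of_gt hz)
  have hleft := gSideInfty_conj (k := k) h hU Complex.I_sq nhdsWithin_le_nhds
    (upperSqrt_side_left μ)
  have hright := gSideInfty_conj (k := k) h hU hI nhdsWithin_le_nhds (upperSqrt_side_right μ)
  have hconj := Complex.continuous_conj
  have hsum : ∀ s ≥ x, gSide a b η μ k x U Complex.I s + gSide a b η μ k x U (-Complex.I) s =
      f₀ a b X μ k (arcPt a b η s) - x * arcPt a b η s := fun s hs => by
    rw [gSide_add h hU hs, f₀_arc h hU (hXs s hs) hs]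
  obtain ⟨M, hM⟩ := g_bounded (k := k) h hU
  have hend := g_endpoint (k := k) h hU hC hX hXr hmem (hXs x le_rfl)
  exact
  { analytic := differentiableOn_g h hU
    analytic_infty := analytic_infty_of_bounded h.isCompact_mainArc.isBounded
      (differentiableOn_g h hU) hM
    data_symm := fun z hz => f₀_conj_of_mem h hz
    data_cont := continuousOn_f₀ h hU hXs
    jump := by
      have cp := continuousOn_gSide (k := k) h hU Complex.I_sq
      have cm := continuousOn_gSide (k := k) h hU hI
      have tp := tendsto_gSide (k := k) h hU Complex.I_sq
      have tm := tendsto_gSide (k := k) h hU hI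
      refine ⟨gSide a b η μ k x U Complex.I, gSide a b η μ k x U (-Complex.I),
        fun s => conj (gSide a b η μ k x U Complex.I s),
        fun s => conj (gSide a b η μ k x U (-Complex.I) s),
        gSideInfty a b η μ k x Complex.I, gSideInfty a b η μ k x (-Complex.I),
        ⟨cp, cm, hconj.comp_continuousOn cp, hconj.comp_continuousOn cm⟩,
        ⟨tp, tm, ?_, ?_⟩, ?_, ?_, ?_, ?_, hsum, ?_, ?_⟩
      · have := (hconj.tendsto _).comp tp
        rwa [hleft] at this
      · have := (hconj.tendsto _).comp tm
        rwa [hright] at this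
      · exact fun s hs hreg => ⟨hasLeftLimit_g h hU hs hreg, hasRightLimit_g h hU hs hreg⟩
      -- The tangent on the upper half is `-c'`, since `c` runs from the upper endpoint towards `μ`;
      -- conjugation turns it into `conj c'` and keeps left and right.
      · intro s hs hreg
        have h1 := (hasLeftLimit_g (k := k) h hU hs hreg).conj (hcj s hs.le)
        have h2 := HasLeftLimit.conj (hasRightLimit_g (k := k) h hU hs hreg) (hcj s hs.le)
        rw [map_neg, neg_neg] at h1
        rw [neg_neg] at h2
        exact ⟨h1, h2⟩
      · exact tendsto_g_real h hU Complex.I_sq nhdsWithin_le_nhds (upperSqrt_side_left μ)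
      · exact tendsto_g_real h hU hI nhdsWithin_le_nhds (upperSqrt_side_right μ)
      · intro s hs
        have := congrArg conj (hsum s hs)
        rwa [map_add, map_sub, map_mul, Complex.conj_ofReal,
          ← f₀_conj (h.arcPt_im hs).ne'] at this
      · rw [gSideInfty_add, f₀, if_pos rfl]
    endpoint_upper := hend
    endpoint_lower := endpoint_conj (fun _ hz => conj_notMem_mainArc hz) (hcj x le_rfl) hend }

end

theorem theorem2 (a b : ℂ → ℂ) (D L : Set ℂ) (μm μp p : ℝ)
    (hA : ConditionsA a b D L μm μp p) :
    -- the inverse function exists near the regular points of the curve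
    (∃ (C : Set ℂ) (X : ℂ → ℂ), IsConformalInverse a b D L C X) ∧
    ∀ (C : Set ℂ) (X : ℂ → ℂ), IsConformalInverse a b D L C X →
    ∀ (k x : ℝ), deriv (alpha a b) x ≠ 0 →
    -- the real axis is an admissible contour of integration
    IsAdmissibleContour a b C X x (fun _ => 0) ∧
    ∀ η : ℝ → ℝ, IsAdmissibleContour a b C X x η →
    ∀ c : ℝ → ℂ, c = (fun s => alpha a b (graphContour η s)) →
      -- the image of the contour is a main arc with endpoint `α(x)`
      IsMainArc (alpha a b x) μp x c ∧
      -- the radical has its cut on the main arc and is normalized by `R(x, z) / z → -1`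
      (DifferentiableOn ℂ (R a b μp η x) (mainArc μp x c)ᶜ ∧
        (∀ z ∉ mainArc μp x c,
          R a b μp η x z ^ 2 = (z - alpha a b x) * (z - conj (alpha a b x))) ∧
        Tendsto (fun z => R a b μp η x z / z) (cocompact ℂ) (𝓝 (-1))) ∧
      -- the radicals and integrals in the formulas for `g` and `f₀` are well defined
      (∀ z ∉ mainArc μp x c, 0 ≤ z.im →
        IsRadicalBranch a b μp (graphContour η) x z (radical a b μp (graphContour η) x z) ∧
        IntegrableOn (integrand a b μp (graphContour η) x z) (Ioi x)) ∧
      (∀ s ≥ x,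
        IsRadicalBranch a b μp (contourFrom (X (c s))) 0 (c s)
          (radical a b μp (contourFrom (X (c s))) 0 (c s)) ∧
        IntegrableOn (integrand a b μp (contourFrom (X (c s))) 0 (c s)) (Ioi 0)) ∧
      -- `f₀` is analytic at the points of the main arc in `C`
      (∀ s ≥ x, c s ∈ C → AnalyticAt ℂ (f₀ a b X μp k) (c s)) ∧
      -- `g` and `f₀` solve the Riemann-Hilbert problem
      SolvesRHP μp x c (f₀ a b X μp k) (g a b μp k η x) := by
  refine ⟨hA.exists_isConformalInverse, fun C X hC k x hreg =>
    ⟨IsAdmissibleContour.real hA, fun η hη c hc => ?_⟩⟩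
  obtain rfl : c = arcPt a b η := by
    rw [hc, ← swept_one]
    rfl
  obtain ⟨T, m, W, h⟩ := hη.exists_isSwept hA hC
  obtain ⟨U, hU⟩ := h.exists_isRoot
  have hXs : ∀ s ≥ x, X (arcPt a b η s) = swept η 1 s := fun s hs =>
    hC.left_inv_of_mem (hη.region s hs 1 mem01).1
  have hmem : arcPt a b η x ∈ C := by
    rw [h.isMainArc.start]
    exact hC.regular_mem x hreg
  refine ⟨h.isMainArc, ⟨differentiableOn_R h hU, fun z hz => ?_, tendsto_R_div h hU⟩,
    fun z hz hz0 => ?_, fun s hs => ?_, fun s hs hsC =>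
      analyticAt_f₀ h hU hC.isOpen hC.analytic hC.right_inv hs hsC (hXs s hs),
    solvesRHP h hU hC.isOpen hC.analytic hC.right_inv hXs hmem⟩
  · exact R_sq h hU hz
  · have hz' := h.mem_slitDom_iff.2 ⟨hz, hz0⟩
    exact ⟨radical_spec (isRadicalBranch_graph h hU hz'), integrableOn_graph h hU hz'⟩
  · rw [hXs s hs]
    exact ⟨radical_spec (isRadicalBranch_contourFrom h hU hs), (integral_contourFrom_arc h hU hs).1⟩
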